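/- **Setting.** Let $\mathcal N$ be a network on $m$ modes, given as a finite sequence of $|\mathcal N|$ building blocks. Each block consists of a loss element of transmissivity $\eta\in[0,1]$ on each of two distinct modes $a\ne b$ (every photon passing it survives independently with probability $\eta$), followed by an arbitrary $2\times 2$ unitary linear-optical transformation of the modes $a,b$. Let $\Lambda_{\mathcal N}$ be the resulting channel on the bosonic Fock space of $m$ modes. Let $s$ be the smallest number of beamsplitters traversed by any path from an input mode to an output mode (a path reaching a beamsplitter may leave it through either of its modes), and let $\eta_{\rm eff}=\eta^s$. For $n\le m$ let $\Psi_n$ be the projector onto $|1,\dots,1,0,\dots,0\rangle$ ($n$ ones). Let $\Lambda_{t}$ denote uniform losses of transmissivity $t$ on all modes, let $\mathcal D(\rho;\Lambda)$ be the distribution of the photon-number measurement on $\Lambda(\rho)$, and let $\|P-Q\|=\frac12\sum_x|P(x)-Q(x)|$. Put $$\sigma_{t}=\sum_{l=0}^n\binom nl t^l(1-t)^{n-l}\,\frac1{(2\pi)^n}\int_{[0,2\pi]^n}\big(|v_\varphi\rangle\langle v_\varphi|\big)^{\otimes l}\,d\varphi,\qquad |v_\varphi\rangle=\frac1{\sqrt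 n}\sum_{j=1}^n e^{-i\varphi_j}|j\rangle ,$$ and let $\tilde d(t)$ be the trace distance between $\sigma_t$ and $\Lambda_t(\Psi_n)$. **Model of computation.** A classical algorithm is a fixed program of a probabilistic real RAM (exact real arithmetic $+,-,\times,/,\sqrt{\ }$ and comparisons at unit cost, no rounding, integer addressing, independent uniform random numbers in $[0,1]$ and uniform random phases). Its input consists of $m$, $n$, $\eta$, and the modes and unitary entries of the blocks. It samples a distribution *efficiently* if on every run it halts within a number of steps polynomial in $m+n+|\mathcal N|$ and its output has exactly that distribution. **Statement.** There is one such program with the following properties. 1. For every network $\mathcal N$ and every $\eta\in[0,1]$ there is a network $\tilde{\mathcal N}$ with the same beamsplitters in the same order and with exactly $sm$ fewer loss elements (each of transmissivity $\eta$, possibly at other positions) such that $\Lambda_{\mathcal N}=\Lambda_{\tilde{\mathcal N}}\circ\Lambda_{\eta_{\rm eff}}$. For every $n\le m$ the program efficiently samples $\mathcal D(\sigma_{\eta_{\rm eff}};\Lambda_{\tilde{\mathcal N}})$, and $$\big\|\mathcal D(\Psi_n;\Lambda_{\mathcal N})-\mathcal D(\sigma_{\eta_{\rm eff}};\Lambda_{\tilde{\mathcal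 N}})\big\|\le\tilde d(\eta_{\rm eff}),$$ $$\tilde d(\eta_{\rm eff})=\sum_{l=0}^n\binom nl\eta_{\rm eff}^l(1-\eta_{\rm eff})^{n-l}\Big(1-\frac{n!}{n^l(n-l)!}\Big)\le\frac{\eta_{\rm eff}^2n}{2}+\frac{\eta_{\rm eff}(1-\eta_{\rm eff})}{2}.$$ 2. For every $\eta\in[0,1)$ there is a constant $C>0$, depending only on $\eta$, such that for every $\varepsilon>0$ there is $n_0$ with the following property: for all $n\ge n_0$, all $m\ge n$, and every $m$-mode network $\mathcal N$ with $s\ge C\log n$, the program efficiently samples a distribution within total variation distance $\varepsilon$ of $\mathcal D(\Psi_n;\Lambda_{\mathcal N})$. -/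

import Mathlib

open MeasureTheory
open scoped ComplexConjugate

noncomputable section

namespace LossyOptics

/-! ## Bosonic Fock space with a photon-number cutoff

All transformations below never create photons, so the span of the Fock states with at most `K`
photons is invariant, and operators on it are matrices indexed by occupation-number vectors. -/

/-- Occupation-number vectors of `m` modes with at most `K` photons in total. -/
abbrev Fock (m K : ℕ) : Type := {p : Fin m → ℕ // ∑ i, p i ≤ K}

instance Fock.instFinite (m K : ℕ) : Finite (Fock m K) := by
  refine Finite.of_injective
    (fun p : Fock m K => fun i : Fin m => (⟨p.1 i, ?_⟩ : Fin (K + 1))) ?_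
  · exact Nat.lt_succ_of_le
      ((Finset.single_le_sum (fun j _ => Nat.zero_le (p.1 j)) (Finset.mem_univ i)).trans p.2)
  · intro p q h
    apply Subtype.ext
    funext i
    exact congrArg Fin.val (congrFun h i)

instance Fock.instFintype (m K : ℕ) : Fintype (Fock m K) := Fintype.ofFinite _

/-- Operators (in particular density operators) on the Fock space, in the occupation-number
basis. -/
abbrev Op (m K : ℕ) : Type := Matrix (Fock m K) (Fock m K) ℂ

/-- `∏ i, p_i!`. -/
def occFactorial {m : ℕ} (p : Fin m → ℕ) : ℕ := ∏ i, (p i).factorial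

/-- The amplitude `⟨p| f(a₁†, …, a_m†) |vacuum⟩` of a polynomial `f` in the creation operators:
the variable `X i` stands for `a_i†`, and `∏ i, (a_i†)^(p_i) |vacuum⟩ = √(∏ i, p_i!) |p⟩`. -/
def amplitude {m K : ℕ} (f : MvPolynomial (Fin m) ℂ) (p : Fock m K) : ℂ :=
  (Real.sqrt (occFactorial p.1) : ℂ) * f.coeff (Finsupp.equivFunOnFinite.symm p.1)

/-- The creation operator `∑ j, v_j a_j†` of a single-photon state `v`. -/
def creation {m : ℕ} (v : Fin m → ℂ) : MvPolynomial (Fin m) ℂ :=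
  ∑ j, MvPolynomial.C (v j) * MvPolynomial.X j

/-- The operator induced on Fock space by a single-particle matrix `U`: it substitutes
`a_i† ↦ ∑ j, U_{ji} a_j†` in `|q⟩ = ∏ i, (a_i†)^(q_i) / √(q_i!) |vacuum⟩`. -/
def secondQuant {m : ℕ} (K : ℕ) (U : Matrix (Fin m) (Fin m) ℂ) : Op m K :=
  fun p q => amplitude (∏ i, creation (fun j => U j i) ^ (q.1 i)) p /
    (Real.sqrt (occFactorial q.1) : ℂ)

/-! ## Loss elements, beamsplitters and networks -/

/-- Kraus operator of a loss element of transmissivity `η` on mode `i`, for the event that exactly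
`k` photons are lost:
`|q⟩ ↦ √(binom(q_i, k) η^(q_i - k) (1 - η)^k) |q - k e_i⟩`. -/
def lossKraus {m : ℕ} (K : ℕ) (η : ℝ) (i : Fin m) (k : ℕ) : Op m K :=
  fun p q => if q.1 = Function.update p.1 i (p.1 i + k)
    then (Real.sqrt (((q.1 i).choose k : ℝ) * η ^ (p.1 i) * (1 - η) ^ k) : ℂ) else 0

/-- The channel of a loss element: each photon in mode `i` survives with probability `η`. -/
def lossChannel {m : ℕ} (K : ℕ) (η : ℝ) (i : Fin m) (ρ : Op m K) : Op m K :=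
  ∑ k ∈ Finset.range (K + 1),
    lossKraus K η i k * ρ * (lossKraus K η i k).conjTranspose

/-- A lossless two-mode linear-optical element: an arbitrary `2 × 2` unitary on two distinct
modes. -/
structure Beamsplitter (m : ℕ) where
  fst : Fin m
  snd : Fin m
  ne : fst ≠ snd
  u : Matrix.unitaryGroup (Fin 2) ℂ

/-- The single-particle `m × m` matrix of a two-mode element. -/
def Beamsplitter.matrix {m : ℕ} (g : Beamsplitter m) : Matrix (Fin m) (Fin m) ℂ :=
  fun i j =>
    if i = g.fst then
      if j = g.fst then g.u.1 0 0 else if j = g.snd then g.u.1 0 1 else 0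
    else if i = g.snd then
      if j = g.fst then g.u.1 1 0 else if j = g.snd then g.u.1 1 1 else 0
    else if i = j then 1 else 0

/-- The elements of a general lossy network: single-mode loss elements and beamsplitters. -/
inductive Element (m : ℕ) where
  | loss (i : Fin m)
  | bs (g : Beamsplitter m)

/-- The channel of an element, when every loss element has transmissivity `η`. -/
def Element.channel {m : ℕ} (K : ℕ) (η : ℝ) : Element m → Op m K → Op m K
  | .loss i, ρ => lossChannel K η i ρ
  | .bs g, ρ => secondQuant K g.matrix * ρ * (secondQuant K g.matrix).conjTranspose

/-- The channel of a list of elements; the head of the list acts first. -/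
def channel {m : ℕ} (K : ℕ) (η : ℝ) (L : List (Element m)) (ρ : Op m K) : Op m K :=
  L.foldl (fun τ e => e.channel K η τ) ρ

/-- Uniform losses of transmissivity `η`: one loss element on every mode. -/
def uniformLoss {m : ℕ} (K : ℕ) (η : ℝ) (ρ : Op m K) : Op m K :=
  channel K η ((List.finRange m).map Element.loss) ρ

/-- The beamsplitters of a list of elements, in order. -/
def beamsplitters {m : ℕ} (L : List (Element m)) : List (Beamsplitter m) :=
  L.filterMap (fun e => match e with
    | .loss _ => none
    | .bs g => some g)

/-- The number of loss elements of a list of elements. -/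
def lossCount {m : ℕ} (L : List (Element m)) : ℕ :=
  L.countP (fun e => match e with
    | .loss _ => true
    | .bs _ => false)

/-- A network of lossy two-mode building blocks on `m` modes, of arbitrary geometry, in a
chronological order of its blocks. -/
abbrev Network (m : ℕ) : Type := List (Beamsplitter m)

/-- Each block of a network is a beamsplitter with a loss element in both of its input arms. -/
def Network.elements {m : ℕ} (N : Network m) : List (Element m) :=
  N.flatMap (fun g => [Element.loss g.fst, Element.loss g.snd, Element.bs g])

/-- `PathLength N i j k`: some path from input mode `i` to output mode `j` traverses exactly `k`
beamsplitters. On reaching a beamsplitter, a path may leave it through either of its two modes. -/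
inductive PathLength {m : ℕ} : Network m → Fin m → Fin m → ℕ → Prop
  | nil (i : Fin m) : PathLength [] i i 0
  | hit {g : Beamsplitter m} {N : Network m} {i i' j : Fin m} {k : ℕ}
      (hi : i = g.fst ∨ i = g.snd) (hi' : i' = g.fst ∨ i' = g.snd)
      (h : PathLength N i' j k) : PathLength (g :: N) i j (k + 1)
  | miss {g : Beamsplitter m} {N : Network m} {i j : Fin m} {k : ℕ}
      (h₁ : i ≠ g.fst) (h₂ : i ≠ g.snd)
      (h : PathLength N i j k) : PathLength (g :: N) i j k

/-- The smallest number of beamsplitters traversed by a path from an input to an output. -/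
def minDepth {m : ℕ} (N : Network m) : ℕ := sInf {k | ∃ i j, PathLength N i j k}

/-! ## States, measurement and distances -/

/-- The occupation numbers `(1, …, 1, 0, …, 0)` with `n` ones. -/
def standardOcc (m n : ℕ) : Fock m n :=
  ⟨fun i => if i.1 < n then 1 else 0, by
    rw [Finset.sum_boole, Nat.cast_id, ← Finset.card_map Fin.valEmbedding]
    refine (Finset.card_le_card (t := Finset.range n) ?_).trans_eq (Finset.card_range n)
    intro a ha
    simp only [Finset.mem_map, Finset.mem_filter, Finset.mem_univ, true_and] at ha
    obtain ⟨i, hi, rfl⟩ := ha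
    exact Finset.mem_range.2 hi⟩

/-- The projector onto the standard input state `|1, …, 1, 0, …, 0⟩`. -/
def inputState (m n : ℕ) : Op m n := Matrix.single (standardOcc m n) (standardOcc m n) 1

/-- The vector `|v⟩^{⊗ l} = (∑ j, v_j a_j†)^l / √(l!) |vacuum⟩`. -/
def productVec {m : ℕ} (K : ℕ) (v : Fin m → ℂ) (l : ℕ) : Fock m K → ℂ :=
  fun p => amplitude (creation v ^ l) p / (Real.sqrt l.factorial : ℂ)

/-- The single-photon state `(1/√n) ∑_{i < n} exp(-i φ_i) |i⟩`. -/
def phaseState (m n : ℕ) (φ : Fin n → ℝ) : Fin m → ℂ :=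
  fun i => if h : i.1 < n then
    Complex.exp (-(Complex.I * (φ ⟨i.1, h⟩ : ℂ))) / (Real.sqrt n : ℂ) else 0

/-- The particle-separable `l`-photon state
`(2π)^{-n} ∫_{[0,2π]^n} (|v_φ⟩⟨v_φ|)^{⊗ l} dφ`, where `v_φ = phaseState m n φ`. -/
def sepState (m n l : ℕ) : Op m n :=
  fun p q => (((2 * Real.pi) ^ n : ℝ) : ℂ)⁻¹ *
    ∫ φ in Set.Icc (0 : Fin n → ℝ) (fun _ => 2 * Real.pi),
      productVec n (phaseState m n φ) l p * conj (productVec n (phaseState m n φ) l q)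

/-- The mixture `∑_l binom(n, l) η^l (1 - η)^(n - l) sepState m n l`. -/
def sepMixture (m n : ℕ) (η : ℝ) : Op m n :=
  ∑ l ∈ Finset.range (n + 1),
    (((n.choose l : ℝ) * η ^ l * (1 - η) ^ (n - l) : ℝ) : ℂ) • sepState m n l

/-- The distribution of the photon-number measurement on the state `ρ`. -/
def outputDist {m K : ℕ} (ρ : Op m K) : Fock m K → ℝ := fun p => (ρ p p).re

/-- Total variation distance. -/
def tvDist {α : Type*} [Fintype α] (P Q : α → ℝ) : ℝ := (1 / 2) * ∑ x, |P x - Q x|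

/-- Trace distance `(1/2) tr √((ρ - σ)† (ρ - σ))`. -/
def traceDist {α : Type*} [Fintype α] [DecidableEq α] (ρ σ : Matrix α α ℂ) : ℝ :=
  (1 / 2) * ∑ i, Real.sqrt
    ((Matrix.isHermitian_conjTranspose_mul_self (ρ - σ)).eigenvalues i)

/-- `d̃(η)`: the trace distance between the separable mixture and the standard input state after
uniform losses of transmissivity `η`. -/
def sepDist (m n : ℕ) (η : ℝ) : ℝ :=
  traceDist (sepMixture m n η) (uniformLoss n η (inputState m n))

/-! ## A probabilistic real RAM

Programs of a fixed finite text, with natural-number arrays (used for addressing and output) and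
real arrays, exact arithmetic at unit cost, and independent random numbers. There is no
rounding (floor) operation. -/

/-- Expressions of natural-number type. `get a e` is the cell with index `e` of the array `a`. -/
inductive NExp where
  | const (k : ℕ)
  | get (a : ℕ) (e : NExp)
  | add (e f : NExp)
  | sub (e f : NExp)

/-- Expressions of real type. -/
inductive RExp where
  | const (k : ℤ)
  | get (a : ℕ) (e : NExp)
  | ofNat (e : NExp)
  | add (x y : RExp)
  | sub (x y : RExp)
  | mul (x y : RExp)
  | div (x y : RExp)
  | sqrt (x : RExp)

/-- Tests. -/
inductive Test where
  | ltN (e f : NExp)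
  | ltR (x y : RExp)

/-- Programs. `uniform a e` stores a uniformly random number of `[0, 1]`, and `phase a e b f`
stores the cosine and the sine of a uniformly random angle. -/
inductive Cmd where
  | skip
  | setN (a : ℕ) (e : NExp) (f : NExp)
  | setR (a : ℕ) (e : NExp) (x : RExp)
  | uniform (a : ℕ) (e : NExp)
  | phase (a : ℕ) (e : NExp) (b : ℕ) (f : NExp)
  | seq (c d : Cmd)
  | ite (b : Test) (c d : Cmd)
  | loop (b : Test) (c : Cmd)

/-- Memory contents: the arrays, and the number of random numbers consumed so far. -/
structure Store where
  nat : ℕ → ℕ → ℕ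
  real : ℕ → ℕ → ℝ
  used : ℕ

def NExp.eval (st : Store) : NExp → ℕ
  | .const k => k
  | .get a e => st.nat a (e.eval st)
  | .add e f => e.eval st + f.eval st
  | .sub e f => e.eval st - f.eval st

def RExp.eval (st : Store) : RExp → ℝ
  | .const k => k
  | .get a e => st.real a (e.eval st)
  | .ofNat e => (e.eval st : ℝ)
  | .add x y => x.eval st + y.eval st
  | .sub x y => x.eval st - y.eval st
  | .mul x y => x.eval st * y.eval st
  | .div x y => x.eval st / y.eval st
  | .sqrt x => Real.sqrt (x.eval st)

def Test.holds (st : Store) : Test → Prop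
  | .ltN e f => e.eval st < f.eval st
  | .ltR x y => x.eval st < y.eval st

/-- Number of operations in an expression. -/
def NExp.cost : NExp → ℕ
  | .const _ => 1
  | .get _ e => e.cost + 1
  | .add e f => e.cost + f.cost + 1
  | .sub e f => e.cost + f.cost + 1

/-- Number of operations in an expression. -/
def RExp.cost : RExp → ℕ
  | .const _ => 1
  | .get _ e => e.cost + 1
  | .ofNat e => e.cost + 1
  | .add x y => x.cost + y.cost + 1
  | .sub x y => x.cost + y.cost + 1
  | .mul x y => x.cost + y.cost + 1
  | .div x y => x.cost + y.cost + 1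
  | .sqrt x => x.cost + 1

/-- Number of operations in a test. -/
def Test.cost : Test → ℕ
  | .ltN e f => e.cost + f.cost + 1
  | .ltR x y => x.cost + y.cost + 1

def Store.writeN (st : Store) (a k v : ℕ) : Store :=
  { st with nat := Function.update st.nat a (Function.update (st.nat a) k v) }

def Store.writeR (st : Store) (a k : ℕ) (v : ℝ) : Store :=
  { st with real := Function.update st.real a (Function.update (st.real a) k v) }

def Store.tick (st : Store) : Store := { st with used := st.used + 1 }

/-- `Exec ω c st t st'`: with the random numbers `ω`, the program `c` started in `st` halts in `st'`
after exactly `t` steps. -/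
inductive Exec (ω : ℕ → unitInterval) : Cmd → Store → ℕ → Store → Prop
  | skip (st : Store) : Exec ω .skip st 1 st
  | setN (st : Store) (a : ℕ) (e f : NExp) :
      Exec ω (.setN a e f) st (e.cost + f.cost + 1) (st.writeN a (e.eval st) (f.eval st))
  | setR (st : Store) (a : ℕ) (e : NExp) (x : RExp) :
      Exec ω (.setR a e x) st (e.cost + x.cost + 1) (st.writeR a (e.eval st) (x.eval st))
  | uniform (st : Store) (a : ℕ) (e : NExp) :
      Exec ω (.uniform a e) st (e.cost + 1)
        (st.writeR a (e.eval st) (ω st.used : ℝ)).tick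
  | phase (st : Store) (a : ℕ) (e : NExp) (b : ℕ) (f : NExp) :
      Exec ω (.phase a e b f) st (e.cost + f.cost + 1)
        (((st.writeR a (e.eval st) (Real.cos (2 * Real.pi * (ω st.used : ℝ)))).writeR b
          (f.eval st) (Real.sin (2 * Real.pi * (ω st.used : ℝ))))).tick
  | seq {c d : Cmd} {st st' st'' : Store} {t t' : ℕ} (h : Exec ω c st t st')
      (h' : Exec ω d st' t' st'') : Exec ω (.seq c d) st (t + t') st''
  | iteTrue {b : Test} {c d : Cmd} {st st' : Store} {t : ℕ} (hb : b.holds st)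
      (h : Exec ω c st t st') : Exec ω (.ite b c d) st (b.cost + t) st'
  | iteFalse {b : Test} {c d : Cmd} {st st' : Store} {t : ℕ} (hb : ¬ b.holds st)
      (h : Exec ω d st t st') : Exec ω (.ite b c d) st (b.cost + t) st'
  | loopDone {b : Test} {c : Cmd} {st : Store} (hb : ¬ b.holds st) :
      Exec ω (.loop b c) st b.cost st
  | loopStep {b : Test} {c : Cmd} {st st' st'' : Store} {t t' : ℕ} (hb : b.holds st)
      (h : Exec ω c st t st') (h' : Exec ω (.loop b c) st' t' st'') :
      Exec ω (.loop b c) st (b.cost + t + t') st''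

/-- The random numbers determine the run: its final memory and its number of steps. -/
theorem Exec.det {ω : ℕ → unitInterval} {c : Cmd} {st st₁ st₂ : Store} {t₁ t₂ : ℕ}
    (h₁ : Exec ω c st t₁ st₁) (h₂ : Exec ω c st t₂ st₂) : t₁ = t₂ ∧ st₁ = st₂ := by
  induction h₁ generalizing t₂ st₂ with
  | skip | setN | setR | uniform | phase => cases h₂; exact ⟨rfl, rfl⟩
  | seq _ _ ih ih' =>
    cases h₂ with
    | seq k k' =>
      obtain ⟨rfl, rfl⟩ := ih k
      obtain ⟨rfl, rfl⟩ := ih' k'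
      exact ⟨rfl, rfl⟩
  | iteTrue hb _ ih =>
    cases h₂ with
    | iteTrue _ k => obtain ⟨rfl, rfl⟩ := ih k; exact ⟨rfl, rfl⟩
    | iteFalse hb' => exact absurd hb hb'
  | iteFalse hb _ ih =>
    cases h₂ with
    | iteFalse _ k => obtain ⟨rfl, rfl⟩ := ih k; exact ⟨rfl, rfl⟩
    | iteTrue hb' => exact absurd hb' hb
  | loopDone hb =>
    cases h₂ with
    | loopDone => exact ⟨rfl, rfl⟩
    | loopStep hb' => exact absurd hb' hb
  | loopStep hb _ _ ih ih' =>
    cases h₂ with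
    | loopDone hb' => exact absurd hb hb'
    | loopStep _ k k' =>
      obtain ⟨rfl, rfl⟩ := ih k
      obtain ⟨rfl, rfl⟩ := ih' k'
      exact ⟨rfl, rfl⟩

/-- Independent uniform random numbers. -/
def tapeLaw : Measure (ℕ → unitInterval) :=
  Measure.infinitePi (fun _ : ℕ => (volume : Measure unitInterval))

/-- The memory at the start. Natural-number array `0` holds `m`, `n` and the number of
blocks, arrays `1` and `2` hold the two modes of each block; real array `0` holds `η`, and
arrays `1, …, 8` hold the real and imaginary parts of the entries of each `2 × 2` unitary. All other
cells are `0`. -/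
def inputStore {m : ℕ} (n : ℕ) (η : ℝ) (N : Network m) : Store where
  nat := fun a k =>
    match a with
    | 0 => if k = 0 then m else if k = 1 then n else if k = 2 then N.length else 0
    | 1 => (N[k]?).elim 0 (fun g => g.fst.1)
    | 2 => (N[k]?).elim 0 (fun g => g.snd.1)
    | _ => 0
  real := fun a k =>
    match a with
    | 0 => if k = 0 then η else 0
    | 1 => (N[k]?).elim 0 (fun g => (g.u.1 0 0).re)
    | 2 => (N[k]?).elim 0 (fun g => (g.u.1 0 0).im)
    | 3 => (N[k]?).elim 0 (fun g => (g.u.1 0 1).re)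
    | 4 => (N[k]?).elim 0 (fun g => (g.u.1 0 1).im)
    | 5 => (N[k]?).elim 0 (fun g => (g.u.1 1 0).re)
    | 6 => (N[k]?).elim 0 (fun g => (g.u.1 1 0).im)
    | 7 => (N[k]?).elim 0 (fun g => (g.u.1 1 1).re)
    | 8 => (N[k]?).elim 0 (fun g => (g.u.1 1 1).im)
    | _ => 0
  used := 0

/-- Started in `st`, the program `c` always halts within `T` steps, and the occupation numbers that
it leaves in cells `0, …, m - 1` of the natural-number array `3` are distributed exactly as `Q`. -/
def SamplesWithin {m K : ℕ} (c : Cmd) (st : Store) (T : ℕ) (Q : Fock m K → ℝ) : Prop :=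
  ∃ out : (ℕ → unitInterval) → Fock m K,
    (∀ ω, ∃ t ≤ T, ∃ st', Exec ω c st t st' ∧ ∀ j : Fin m, st'.nat 3 j.1 = (out ω).1 j) ∧
    ∀ p, MeasurableSet (out ⁻¹' {p}) ∧ tapeLaw.real (out ⁻¹' {p}) = Q p

end LossyOptics

end

open LossyOptics

noncomputable section

namespace LossyOptics

/-! ## Graded coherent vectors -/

/-! A lossy linear-optical network is governed by a single `m × m` matrix, its transfer matrix `T`:
a coherent amplitude vector `v` becomes `T v`. `channel_coherentOp` makes this exact under the
photon cutoff. The operators `coherentOp`, built from fixed-photon-number components of coherent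
vectors `v` (ket) and `w` (bra) with a scalar `z` that accounts for lost photons, are mapped to
operators of the same form, and `z + ⟨v, w⟩` is conserved. A linear map is determined by its values
on them, so equal transfer matrices give equal channels (`channel_eq_of_transfer_eq`).

Extracting losses thereby becomes matrix algebra. Equal losses on the two modes of a beamsplitter
commute with it, so they can be pulled to the input block by block. The number of losses collected
on a mode is the length of some path from that mode, hence at least `s`
(`Network.exists_extracted_losses`).

For the simulation, `σ_t` is itself the `n`-photon phase-averaged product state after uniform losses
(`uniformLoss_sepState`). The remaining network applied to `σ_t` therefore equals the original
network applied to the lossless product state, and the program needs neither `s` nor the remaining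
network. It draws the phases once, propagates one single-photon vector through the blocks, and
detects `n` photons independently with the resulting probabilities; for fixed phases the true output
law is the same multinomial law (`channel_productOp_diag`).

For the error, phase averaging makes `σ_t` diagonal: `l` surviving photons fall independently and
uniformly into `n` modes. In the lossy Fock state they occupy a uniformly random `l`-subset. The two
differ only through collisions, and `n! / (n^l (n-l)!)` is the birthday probability of having none.
The distance is thus the mean collision probability, at most `E[l(l-1)] / (2n)` with `l` binomial.
Channel and measurement do not increase it (`tvDist_channel_le`). Depth `s ≥ log n / (1-η)` forces
`t ≤ 1/n`, and then the error is at most `1/n`. -/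

/-- `∏ i, v_i ^ p_i`. -/
def monomialEval {m : ℕ} (v : Fin m → ℂ) (p : Fin m → ℕ) : ℂ := ∏ i, v i ^ p i

/-- The `l`-photon component of the coherent vector with amplitudes `v`. -/
def coherent {m : ℕ} (K l : ℕ) (v : Fin m → ℂ) : Fock m K → ℂ :=
  fun p => if ∑ i, p.1 i = l then monomialEval v p.1 / (Real.sqrt (occFactorial p.1) : ℂ) else 0

theorem occFactorial_pos {m : ℕ} (p : Fin m → ℕ) : 0 < occFactorial p :=
  Finset.prod_pos fun i _ => Nat.factorial_pos (p i)

theorem sqrt_occFactorial_ne_zero {m : ℕ} (p : Fin m → ℕ) :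
    (Real.sqrt (occFactorial p) : ℂ) ≠ 0 := by
  have := Real.sqrt_pos.2 (Nat.cast_pos (α := ℝ).2 (occFactorial_pos p))
  exact_mod_cast this.ne'

theorem sqrt_occFactorial_mul_self {m : ℕ} (p : Fin m → ℕ) :
    (Real.sqrt (occFactorial p) : ℂ) * (Real.sqrt (occFactorial p) : ℂ) = occFactorial p := by
  rw [← Complex.ofReal_mul, Real.mul_self_sqrt (Nat.cast_nonneg _)]
  simp

theorem sum_fock_eq_sum_piAntidiag {m K l : ℕ} (hl : l ≤ K) {M : Type*} [AddCommMonoid M]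
    (f : (Fin m → ℕ) → M) :
    ∑ q : Fock m K, (if ∑ i, q.1 i = l then f q.1 else 0) =
      ∑ q ∈ Finset.piAntidiag Finset.univ l, f q := by
  rw [← Finset.sum_filter]
  refine Finset.sum_bij (fun q _ => q.1) ?_ ?_ ?_ ?_
  · intro q hq
    simpa using hq
  · intro q _ q' _ h
    exact Subtype.ext h
  · intro q hq
    have hq' : ∑ i, q i = l := by simpa using hq
    exact ⟨⟨q, hq'.le.trans hl⟩, by simpa using hq', rfl⟩
  · intro q _
    rfl

theorem multinomial_eq_div {m l : ℕ} (q : Fin m → ℕ) (hq : ∑ i, q i = l) :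
    (Nat.multinomial Finset.univ q : ℂ) = l.factorial / occFactorial q := by
  have h := Nat.multinomial_spec Finset.univ q
  rw [hq] at h
  have h0 : (occFactorial q : ℂ) ≠ 0 := by exact_mod_cast (occFactorial_pos q).ne'
  rw [eq_div_iff h0, ← h, mul_comm]
  simp [occFactorial]

theorem sum_pow_eq_sum_fock {m : ℕ} {R : Type*} [CommRing R] [Algebra ℂ R] (f : Fin m → R)
    {K l : ℕ} (hl : l ≤ K) :
    (∑ i, f i) ^ l = ∑ q : Fock m K, if ∑ i, q.1 i = l then
      ((l.factorial / occFactorial q.1 : ℂ)) • ∏ i, f i ^ q.1 i else 0 := by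
  rw [sum_fock_eq_sum_piAntidiag hl
      (f := fun q => ((l.factorial / occFactorial q : ℂ)) • ∏ i, f i ^ q i),
    Finset.sum_pow_eq_sum_piAntidiag]
  refine Finset.sum_congr rfl fun q hq => ?_
  have hq' : ∑ i, q i = l := by simpa using hq
  rw [← multinomial_eq_div q hq', Algebra.smul_def]
  simp

theorem coeff_creation_pow {m : ℕ} (v : Fin m → ℂ) (l : ℕ) (p : Fin m → ℕ) :
    (creation v ^ l).coeff (Finsupp.equivFunOnFinite.symm p) =
      if ∑ i, p i = l then (l.factorial / occFactorial p : ℂ) * monomialEval v p else 0 := by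
  have key : ∀ q : Fin m → ℕ, ∏ i, (MvPolynomial.C (v i) * MvPolynomial.X i) ^ q i =
      MvPolynomial.monomial (Finsupp.equivFunOnFinite.symm q) (monomialEval v q) := by
    intro q
    rw [MvPolynomial.monomial_eq, Finsupp.prod_fintype _ _ (by simp)]
    simp [mul_pow, Finset.prod_mul_distrib, monomialEval]
  rw [creation, sum_pow_eq_sum_fock _ (le_refl l),
    sum_fock_eq_sum_piAntidiag (le_refl l)
      (f := fun q => ((l.factorial / occFactorial q : ℂ)) •
        ∏ i, (MvPolynomial.C (v i) * MvPolynomial.X i) ^ q i)]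
  simp only [key, MvPolynomial.coeff_sum, MvPolynomial.coeff_smul, MvPolynomial.coeff_monomial,
    EmbeddingLike.apply_eq_iff_eq, smul_eq_mul, mul_ite, mul_zero]
  rw [Finset.sum_ite_eq']
  simp

theorem amplitude_creation_pow {m K : ℕ} (v : Fin m → ℂ) (l : ℕ) (p : Fock m K) :
    amplitude (creation v ^ l) p = l.factorial * coherent K l v p := by
  unfold amplitude coherent
  rw [coeff_creation_pow]
  split_ifs with h
  · rw [← sqrt_occFactorial_mul_self]
    have := sqrt_occFactorial_ne_zero p.1
    field_simp
  · simp

theorem amplitude_sum {m K : ℕ} {ι : Type*} (s : Finset ι) (f : ι → MvPolynomial (Fin m) ℂ)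
    (p : Fock m K) : amplitude (∑ i ∈ s, f i) p = ∑ i ∈ s, amplitude (f i) p := by
  simp [amplitude, MvPolynomial.coeff_sum, Finset.mul_sum]

theorem amplitude_smul {m K : ℕ} (c : ℂ) (f : MvPolynomial (Fin m) ℂ) (p : Fock m K) :
    amplitude (c • f) p = c * amplitude f p := by
  simp [amplitude]; ring

theorem productVec_eq_coherent {m K : ℕ} (v : Fin m → ℂ) (l : ℕ) (p : Fock m K) :
    productVec K v l p = (Real.sqrt l.factorial : ℂ) * coherent K l v p := by
  have h0 : (Real.sqrt l.factorial : ℂ) ≠ 0 := by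
    exact_mod_cast (Real.sqrt_pos.2 (Nat.cast_pos.2 l.factorial_pos)).ne'
  have h1 : (Real.sqrt l.factorial : ℂ) * (Real.sqrt l.factorial : ℂ) = l.factorial := by
    rw [← Complex.ofReal_mul, Real.mul_self_sqrt (Nat.cast_nonneg _)]; simp
  rw [productVec, amplitude_creation_pow, ← h1]
  field_simp

/-- Up to the factor `l!` both sides are the amplitudes of `creation (U.mulVec v) ^ l`: substituting
creation operators is multiplicative, so it can be carried out inside the power of a linear form.
The bound `l ≤ K` ensures that every term of the multinomial expansion is below the cutoff. -/
theorem secondQuant_mulVec_coherent {m K l : ℕ} (hl : l ≤ K) (U : Matrix (Fin m) (Fin m) ℂ)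
    (v : Fin m → ℂ) :
    (secondQuant K U).mulVec (coherent K l v) = coherent K l (U.mulVec v) := by
  funext p
  have hl0 : (l.factorial : ℂ) ≠ 0 := by exact_mod_cast l.factorial_ne_zero
  apply mul_left_cancel₀ hl0
  have hc : creation (U.mulVec v) = ∑ i, v i • creation (fun j => U j i) := by
    simp only [creation, Matrix.mulVec, dotProduct, map_sum, Finset.sum_mul, Finset.smul_sum]
    rw [Finset.sum_comm]
    refine Finset.sum_congr rfl fun i _ => Finset.sum_congr rfl fun j _ => ?_
    rw [MvPolynomial.smul_eq_C_mul, map_mul]; ring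
  rw [← amplitude_creation_pow, hc, sum_pow_eq_sum_fock _ hl, amplitude_sum, Matrix.mulVec,
    dotProduct, Finset.mul_sum]
  refine Finset.sum_congr rfl fun q _ => ?_
  unfold coherent
  split_ifs with h
  · rw [amplitude_smul]
    have : ∏ i, (v i • creation (fun j => U j i)) ^ q.1 i =
        monomialEval v q.1 • ∏ i, creation (fun j => U j i) ^ q.1 i := by
      simp only [smul_pow, monomialEval]
      rw [Finset.prod_smul]
    rw [this, amplitude_smul, secondQuant, ← sqrt_occFactorial_mul_self]
    have := sqrt_occFactorial_ne_zero q.1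
    field_simp
  · simp [amplitude]

/-! ## Coherent operators and their images under channels -/

/-- The operator with the `(a, b)`-photon coherent component, of which pairs of photons are removed
with weights `z ^ k / k!`. -/
def coherentOp {m : ℕ} (K a b : ℕ) (z : ℂ) (v w : Fin m → ℂ) : Op m K :=
  ∑ k ∈ Finset.range (min a b + 1), (z ^ k / k.factorial) •
    Matrix.vecMulVec (coherent K (a - k) v) (star (coherent K (b - k) w))

theorem coherentOp_apply {m K a b : ℕ} (z : ℂ) (v w : Fin m → ℂ) (p q : Fock m K) :
    coherentOp K a b z v w p q =
      if ∑ i, p.1 i ≤ a ∧ ∑ i, p.1 i + b = ∑ i, q.1 i + a then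
        z ^ (a - ∑ i, p.1 i) / (a - ∑ i, p.1 i).factorial *
          (monomialEval v p.1 / (Real.sqrt (occFactorial p.1) : ℂ) *
            conj (monomialEval w q.1 / (Real.sqrt (occFactorial q.1) : ℂ))) else 0 := by
  unfold coherentOp
  rw [Matrix.sum_apply]
  simp only [Matrix.smul_apply, Matrix.vecMulVec_apply, Pi.star_apply, smul_eq_mul, coherent]
  split_ifs with h
  · rw [Finset.sum_eq_single (a - ∑ i, p.1 i)]
    · rw [if_pos (by omega), if_pos (by omega)]; rfl
    · intro k hk hne
      rw [Finset.mem_range] at hk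
      rw [if_neg (by omega)]; simp
    · intro hk
      rw [Finset.mem_range] at hk
      omega
  · refine Finset.sum_eq_zero fun k hk => ?_
    rw [Finset.mem_range] at hk
    by_cases h1 : ∑ i, p.1 i = a - k
    · rw [if_neg (c := ∑ i, q.1 i = b - k) (by omega)]; simp
    · rw [if_neg h1]; simp

theorem secondQuant_coherentOp {m K a b : ℕ} (ha : a ≤ K) (hb : b ≤ K)
    (U : Matrix (Fin m) (Fin m) ℂ) (z : ℂ) (v w : Fin m → ℂ) :
    secondQuant K U * coherentOp K a b z v w * (secondQuant K U).conjTranspose =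
      coherentOp K a b z (U.mulVec v) (U.mulVec w) := by
  unfold coherentOp
  rw [Finset.mul_sum, Finset.sum_mul]
  refine Finset.sum_congr rfl fun k _ => ?_
  rw [Matrix.mul_smul, Matrix.smul_mul, Matrix.mul_vecMulVec, Matrix.vecMulVec_mul,
    secondQuant_mulVec_coherent (by omega), ← secondQuant_mulVec_coherent (l := b - k) (by omega),
    Matrix.star_mulVec]

/-- The amplitude vector after a loss element on mode `i`. -/
def lossMatrix {m : ℕ} (η : ℝ) (i : Fin m) : Matrix (Fin m) (Fin m) ℂ :=
  Matrix.diagonal (fun j => if j = i then (Real.sqrt η : ℂ) else 1)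

theorem lossMatrix_mulVec {m : ℕ} (η : ℝ) (i : Fin m) (v : Fin m → ℂ) (j : Fin m) :
    (lossMatrix η i).mulVec v j = (if j = i then (Real.sqrt η : ℂ) else 1) * v j := by
  rw [lossMatrix, Matrix.mulVec_diagonal]

theorem monomialEval_lossMatrix {m : ℕ} (η : ℝ) (i : Fin m) (v : Fin m → ℂ) (p : Fin m → ℕ) :
    monomialEval ((lossMatrix η i).mulVec v) p = (Real.sqrt η : ℂ) ^ p i * monomialEval v p := by
  simp only [monomialEval, lossMatrix_mulVec, mul_pow, Finset.prod_mul_distrib]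
  congr 1
  rw [Finset.prod_eq_single i]
  · simp
  · intro j _ hj
    simp [hj]
  · simp

theorem sum_update_add {m : ℕ} (p : Fin m → ℕ) (i : Fin m) (k : ℕ) :
    ∑ j, Function.update p i (p i + k) j = ∑ j, p j + k := by
  rw [Finset.sum_update_of_mem (Finset.mem_univ i),
    ← Finset.add_sum_erase Finset.univ p (Finset.mem_univ i), Finset.sdiff_singleton_eq_erase]
  omega

theorem monomialEval_update_add {m : ℕ} (v : Fin m → ℂ) (p : Fin m → ℕ) (i : Fin m) (k : ℕ) :
    monomialEval v (Function.update p i (p i + k)) = v i ^ k * monomialEval v p := by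
  unfold monomialEval
  rw [← Finset.mul_prod_erase Finset.univ _ (Finset.mem_univ i),
    ← Finset.mul_prod_erase Finset.univ (fun j => v j ^ p j) (Finset.mem_univ i),
    Function.update_self, pow_add]
  rw [Finset.prod_congr rfl fun j hj => by
    rw [Function.update_of_ne (Finset.ne_of_mem_erase hj)]]
  ring

theorem occFactorial_update_add {m : ℕ} (p : Fin m → ℕ) (i : Fin m) (k : ℕ) :
    occFactorial (Function.update p i (p i + k)) =
      (p i + k).choose k * k.factorial * occFactorial p := by
  unfold occFactorial
  rw [← Finset.mul_prod_erase Finset.univ _ (Finset.mem_univ i),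
    ← Finset.mul_prod_erase Finset.univ (fun j => (p j).factorial) (Finset.mem_univ i),
    Function.update_self]
  rw [Finset.prod_congr rfl fun j hj => by
    rw [Function.update_of_ne (Finset.ne_of_mem_erase hj)]]
  rw [← Nat.add_choose_mul_factorial_mul_factorial (p i) k, ← Nat.choose_symm_add]
  ring

/-- The nonzero entry of `lossKraus` in the row `p`. -/
def lossWeight {m : ℕ} (η : ℝ) (i : Fin m) (k : ℕ) (p : Fin m → ℕ) : ℝ :=
  Real.sqrt (((p i + k).choose k : ℝ) * η ^ p i * (1 - η) ^ k)

theorem sqrt_pow_of_nonneg {η : ℝ} (h0 : 0 ≤ η) (n : ℕ) :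
    Real.sqrt (η ^ n) = Real.sqrt η ^ n := by
  rw [← Real.sqrt_sq (pow_nonneg (Real.sqrt_nonneg η) n), ← pow_mul, mul_comm, pow_mul,
    Real.sq_sqrt h0]

/-- The normalisation of coherent components absorbs the binomial coefficient of the Kraus weight
into `1 / k!`. What remains is a rescaling of mode `i` by `√η` and a factor depending on `k` alone.
-/
theorem lossWeight_div {m : ℕ} {η : ℝ} (h0 : 0 ≤ η) (h1 : η ≤ 1) (i : Fin m) (k : ℕ)
    (p : Fin m → ℕ) :
    lossWeight η i k p / Real.sqrt (occFactorial (Function.update p i (p i + k))) =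
      Real.sqrt η ^ p i * Real.sqrt ((1 - η) ^ k / k.factorial) / Real.sqrt (occFactorial p) := by
  have h1' : 0 ≤ 1 - η := by linarith
  have hk : (0 : ℝ) < k.factorial := by exact_mod_cast k.factorial_pos
  have hc : (0 : ℝ) < (p i + k).choose k := by
    exact_mod_cast Nat.choose_pos (Nat.le_add_left _ _)
  have ho : (0 : ℝ) < occFactorial p := by exact_mod_cast occFactorial_pos p
  rw [lossWeight, occFactorial_update_add, ← sqrt_pow_of_nonneg h0, ← Real.sqrt_mul (by positivity),
    ← Real.sqrt_div (by positivity), ← Real.sqrt_div (by positivity)]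
  congr 1
  push_cast
  field_simp

/-- Each Kraus operator has at most one nonzero entry per row, so both matrix products collapse to a
single term. The condition under the sum discards those `k` for which the state before the loss
would exceed the cutoff. -/
theorem lossChannel_apply {m K : ℕ} (η : ℝ) (i : Fin m) (ρ : Op m K) (p q : Fock m K) :
    lossChannel K η i ρ p q = ∑ k ∈ Finset.range (K + 1),
      if h : ∑ j, p.1 j + k ≤ K ∧ ∑ j, q.1 j + k ≤ K then
        (lossWeight η i k p.1 : ℂ) * ρ
          ⟨Function.update p.1 i (p.1 i + k), (sum_update_add p.1 i k).trans_le h.1⟩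
          ⟨Function.update q.1 i (q.1 i + k), (sum_update_add q.1 i k).trans_le h.2⟩ *
        (lossWeight η i k q.1 : ℂ) else 0 := by
  unfold lossChannel
  rw [Matrix.sum_apply]
  refine Finset.sum_congr rfl fun k _ => ?_
  have entry : ∀ p q : Fock m K, lossKraus K η i k p q =
      if q.1 = Function.update p.1 i (p.1 i + k) then (lossWeight η i k p.1 : ℂ) else 0 := by
    intro p q
    unfold lossKraus lossWeight
    split_ifs with h
    · rw [h, Function.update_self]
    · rfl
  rw [Matrix.mul_apply]
  simp only [Matrix.mul_apply, Matrix.conjTranspose_apply, entry]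
  split_ifs with h
  · rw [Finset.sum_eq_single
      ⟨Function.update q.1 i (q.1 i + k), (sum_update_add q.1 i k).trans_le h.2⟩,
      Finset.sum_eq_single
      ⟨Function.update p.1 i (p.1 i + k), (sum_update_add p.1 i k).trans_le h.1⟩]
    · simp
    · intro x _ hx
      rw [if_neg fun h' => hx (Subtype.ext h'), zero_mul]
    · simp
    · intro x _ hx
      rw [if_neg (c := x.1 = _) fun h' => hx (Subtype.ext h')]; simp
    · simp
  · refine Finset.sum_eq_zero fun x _ => ?_
    by_cases hx : x.1 = Function.update q.1 i (q.1 i + k)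
    · rw [Finset.sum_eq_zero, zero_mul]
      intro y _
      rw [if_neg, zero_mul]
      intro hy
      apply h
      rw [← sum_update_add p.1 i k, ← sum_update_add q.1 i k, ← hx, ← hy]
      exact ⟨y.2, x.2⟩
    · rw [if_neg hx]; simp

theorem add_pow_div_factorial (x y : ℂ) (r : ℕ) :
    (x + y) ^ r / r.factorial = ∑ k ∈ Finset.range (r + 1),
      x ^ k / k.factorial * (y ^ (r - k) / (r - k).factorial) := by
  rw [add_pow, Finset.sum_div]
  refine Finset.sum_congr rfl fun k hk => ?_
  have hk' : k ≤ r := Nat.lt_succ_iff.1 (Finset.mem_range.1 hk)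
  have h1 : (r.factorial : ℂ) ≠ 0 := by exact_mod_cast r.factorial_ne_zero
  have h2 : (k.factorial : ℂ) ≠ 0 := by exact_mod_cast k.factorial_ne_zero
  have h3 : ((r - k).factorial : ℂ) ≠ 0 := by exact_mod_cast (r - k).factorial_ne_zero
  have h5 : (r.choose k : ℂ) ≠ 0 := by exact_mod_cast (Nat.choose_pos hk').ne'
  have h4 : (r.choose k : ℂ) * k.factorial * (r - k).factorial = r.factorial := by
    exact_mod_cast Nat.choose_mul_factorial_mul_factorial hk'
  rw [← h4] at h1 ⊢
  field_simp

/-- Losing `k` photons from mode `i` contributes `(v_i conj w_i)^k (1-η)^k / k!`. Summed against the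
losses already recorded in `z`, this is the binomial expansion of a power of the new `z` over its
factorial. -/
theorem lossChannel_coherentOp {m K a b : ℕ} (ha : a ≤ K) (hb : b ≤ K) {η : ℝ} (h0 : 0 ≤ η)
    (h1 : η ≤ 1) (i : Fin m) (z : ℂ) (v w : Fin m → ℂ) :
    lossChannel K η i (coherentOp K a b z v w) =
      coherentOp K a b (z + (1 - η) * v i * conj (w i)) ((lossMatrix η i).mulVec v)
        ((lossMatrix η i).mulVec w) := by
  ext p q
  rw [lossChannel_apply, coherentOp_apply]
  by_cases h : ∑ i, p.1 i ≤ a ∧ ∑ i, p.1 i + b = ∑ i, q.1 i + a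
  swap
  · rw [if_neg h]
    refine Finset.sum_eq_zero fun k _ => ?_
    split_ifs with hk
    · rw [coherentOp_apply, if_neg]; · simp
      rw [sum_update_add, sum_update_add]
      omega
    · rfl
  rw [if_pos h, add_comm z, add_pow_div_factorial, Finset.sum_mul]
  have hsub : Finset.range (a - ∑ i, p.1 i + 1) ⊆ Finset.range (K + 1) := by
    apply Finset.range_subset_range.2
    omega
  rw [← Finset.sum_subset hsub]
  · refine Finset.sum_congr rfl fun k hk => ?_
    rw [Finset.mem_range] at hk
    rw [dif_pos (by omega), coherentOp_apply, if_pos (by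
      rw [sum_update_add, sum_update_add]; omega)]
    have hd := lossWeight_div h0 h1 i k
    -- The effect of losing `k` photons on one side; it is used for the ket as it stands and for the
    -- bra after conjugation.
    have key : ∀ (u : Fin m → ℂ) (p : Fin m → ℕ),
        (lossWeight η i k p : ℂ) * (monomialEval u (Function.update p i (p i + k)) /
          (Real.sqrt (occFactorial (Function.update p i (p i + k))) : ℂ)) =
        (Real.sqrt ((1 - η) ^ k / k.factorial) : ℂ) * u i ^ k *
          (monomialEval ((lossMatrix η i).mulVec u) p / (Real.sqrt (occFactorial p) : ℂ)) := by
      intro u p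
      have := congrArg (fun x : ℝ => (x : ℂ)) (hd p)
      push_cast at this
      rw [monomialEval_update_add, monomialEval_lossMatrix]
      calc _ = ((lossWeight η i k p : ℂ) /
            (Real.sqrt (occFactorial (Function.update p i (p i + k))) : ℂ)) *
            (u i ^ k * monomialEval u p) := by ring
        _ = _ := by rw [this]; ring
    have hsq : (Real.sqrt ((1 - η) ^ k / k.factorial) : ℂ) *
        (Real.sqrt ((1 - η) ^ k / k.factorial) : ℂ) = (1 - η) ^ k / k.factorial := by
      rw [← Complex.ofReal_mul, Real.mul_self_sqrt (by
        have : 0 ≤ 1 - η := by linarith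
        positivity)]
      push_cast; rfl
    have hq := congrArg (starRingEnd ℂ) (key w q.1)
    rw [map_mul, map_mul, map_mul, map_pow, Complex.conj_ofReal, Complex.conj_ofReal] at hq
    simp only [sum_update_add]
    rw [show a - (∑ i, p.1 i + k) = a - ∑ i, p.1 i - k by omega]
    calc _ = z ^ (a - ∑ i, p.1 i - k) / (a - ∑ i, p.1 i - k).factorial *
          ((lossWeight η i k p.1 : ℂ) * (monomialEval v (Function.update p.1 i (p.1 i + k)) /
          (Real.sqrt (occFactorial (Function.update p.1 i (p.1 i + k))) : ℂ))) *
          ((lossWeight η i k q.1 : ℂ) * conj (monomialEval w (Function.update q.1 i (q.1 i + k)) /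
          (Real.sqrt (occFactorial (Function.update q.1 i (q.1 i + k))) : ℂ))) := by ring
      _ = (Real.sqrt ((1 - η) ^ k / k.factorial) : ℂ) *
          (Real.sqrt ((1 - η) ^ k / k.factorial) : ℂ) * (v i ^ k * conj (w i) ^ k *
          (z ^ (a - ∑ i, p.1 i - k) / (a - ∑ i, p.1 i - k).factorial) *
          ((monomialEval ((lossMatrix η i).mulVec v) p.1 / (Real.sqrt (occFactorial p.1) : ℂ)) *
          conj (monomialEval ((lossMatrix η i).mulVec w) q.1 /
            (Real.sqrt (occFactorial q.1) : ℂ)))) := by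
          rw [key v p.1, hq]; ring
      _ = _ := by rw [hsq, mul_pow, mul_pow]; ring
  · intro k _ hk
    rw [Finset.mem_range] at hk
    split_ifs with hk'
    · rw [coherentOp_apply, if_neg]; · simp
      rw [sum_update_add, sum_update_add]
      omega
    · rfl

/-! ## Transfer matrices -/

/-- The action of an element on amplitude vectors. -/
def Element.transfer {m : ℕ} (η : ℝ) : Element m → Matrix (Fin m) (Fin m) ℂ
  | .loss i => lossMatrix η i
  | .bs g => g.matrix

/-- The action of a list of elements on amplitude vectors. -/
def transfer {m : ℕ} (η : ℝ) : List (Element m) → Matrix (Fin m) (Fin m) ℂ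
  | [] => 1
  | e :: L => transfer η L * e.transfer η

theorem transfer_append {m : ℕ} (η : ℝ) (L L' : List (Element m)) :
    transfer η (L ++ L') = transfer η L' * transfer η L := by
  induction L with
  | nil => simp [transfer]
  | cons e L ih => simp [transfer, ih, Matrix.mul_assoc]

theorem Beamsplitter.matrix_mulVec_fst {m : ℕ} (g : Beamsplitter m) (v : Fin m → ℂ) :
    g.matrix.mulVec v g.fst = g.u.1 0 0 * v g.fst + g.u.1 0 1 * v g.snd := by
  rw [Matrix.mulVec, dotProduct, Fintype.sum_eq_add g.fst g.snd g.ne]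
  · simp [Beamsplitter.matrix, g.ne.symm]
  · intro j hj
    simp [Beamsplitter.matrix, hj.1, hj.2]

theorem Beamsplitter.matrix_mulVec_snd {m : ℕ} (g : Beamsplitter m) (v : Fin m → ℂ) :
    g.matrix.mulVec v g.snd = g.u.1 1 0 * v g.fst + g.u.1 1 1 * v g.snd := by
  rw [Matrix.mulVec, dotProduct, Fintype.sum_eq_add g.fst g.snd g.ne]
  · simp [Beamsplitter.matrix, g.ne.symm]
  · intro j hj
    simp [Beamsplitter.matrix, hj.1, hj.2, g.ne.symm]

theorem Beamsplitter.matrix_mulVec_of_ne {m : ℕ} (g : Beamsplitter m) (v : Fin m → ℂ) {i : Fin m}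
    (h1 : i ≠ g.fst) (h2 : i ≠ g.snd) : g.matrix.mulVec v i = v i := by
  rw [Matrix.mulVec, dotProduct, Finset.sum_eq_single i]
  · simp [Beamsplitter.matrix, h1, h2]
  · intro j _ hj
    simp [Beamsplitter.matrix, h1, h2, hj.symm]
  · simp

theorem Beamsplitter.sum_eq {m : ℕ} (g : Beamsplitter m) {M : Type*} [AddCommMonoid M]
    (f : Fin m → M) :
    ∑ i, f i = f g.fst + f g.snd + ∑ i with i ≠ g.fst ∧ i ≠ g.snd, f i := by
  have h : (Finset.univ.filter fun i => ¬ (i ≠ g.fst ∧ i ≠ g.snd)) = {g.fst, g.snd} := by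
    ext i
    simp only [Finset.mem_filter, Finset.mem_univ, true_and, Finset.mem_insert,
      Finset.mem_singleton]
    tauto
  rw [← Finset.sum_filter_not_add_sum_filter Finset.univ (fun i => i ≠ g.fst ∧ i ≠ g.snd), h,
    Finset.sum_pair g.ne]

theorem Beamsplitter.sum_mul_conj_matrix_mulVec {m : ℕ} (g : Beamsplitter m) (v w : Fin m → ℂ) :
    ∑ i, g.matrix.mulVec v i * conj (g.matrix.mulVec w i) = ∑ i, v i * conj (w i) := by
  rw [g.sum_eq, g.sum_eq (fun i => v i * conj (w i))]
  congr 1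
  · rw [g.matrix_mulVec_fst, g.matrix_mulVec_fst, g.matrix_mulVec_snd, g.matrix_mulVec_snd]
    have h := g.u.2
    rw [Matrix.mem_unitaryGroup_iff'] at h
    have h00 := congrFun (congrFun h 0) 0
    have h01 := congrFun (congrFun h 0) 1
    have h10 := congrFun (congrFun h 1) 0
    have h11 := congrFun (congrFun h 1) 1
    simp only [Matrix.mul_apply, Matrix.star_apply, Fin.sum_univ_two, Matrix.one_apply_eq,
      Matrix.one_apply_ne (by decide : (0 : Fin 2) ≠ 1),
      Matrix.one_apply_ne (by decide : (1 : Fin 2) ≠ 0), RCLike.star_def] at h00 h01 h10 h11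
    simp only [map_add, map_mul]
    linear_combination (v g.fst * conj (w g.fst)) * h00 + (v g.snd * conj (w g.fst)) * h01 +
      (v g.fst * conj (w g.snd)) * h10 + (v g.snd * conj (w g.snd)) * h11
  · refine Finset.sum_congr rfl fun i hi => ?_
    rw [Finset.mem_filter] at hi
    rw [g.matrix_mulVec_of_ne v hi.2.1 hi.2.2, g.matrix_mulVec_of_ne w hi.2.1 hi.2.2]

theorem sum_mul_conj_lossMatrix_mulVec {m : ℕ} {η : ℝ} (h0 : 0 ≤ η) (i : Fin m)
    (v w : Fin m → ℂ) :
    ∑ j, (lossMatrix η i).mulVec v j * conj ((lossMatrix η i).mulVec w j) +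
      (1 - η) * v i * conj (w i) = ∑ j, v j * conj (w j) := by
  have hs : (Real.sqrt η : ℂ) * (Real.sqrt η : ℂ) = η := by
    rw [← Complex.ofReal_mul, Real.mul_self_sqrt h0]
  simp only [lossMatrix_mulVec]
  rw [← Finset.add_sum_erase _ _ (Finset.mem_univ i),
    ← Finset.add_sum_erase _ (fun j => v j * conj (w j)) (Finset.mem_univ i)]
  rw [Finset.sum_congr rfl fun j hj => by rw [if_neg (Finset.ne_of_mem_erase hj), one_mul, one_mul]]
  simp only [if_true, map_mul, Complex.conj_ofReal]
  linear_combination (v i * conj (w i)) * hs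

/-- Writing the increment of `z` as the overlap `⟨v, w⟩` that was lost gives one formula for both
kinds of elements (for a beamsplitter it is zero), and it telescopes along a list. -/
theorem Element.channel_coherentOp {m K a b : ℕ} (ha : a ≤ K) (hb : b ≤ K) {η : ℝ} (h0 : 0 ≤ η)
    (h1 : η ≤ 1) (e : Element m) (z : ℂ) (v w : Fin m → ℂ) :
    e.channel K η (coherentOp K a b z v w) = coherentOp K a b
      (z + ∑ i, v i * conj (w i) -
        ∑ i, (e.transfer η).mulVec v i * conj ((e.transfer η).mulVec w i))
      ((e.transfer η).mulVec v) ((e.transfer η).mulVec w) := by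
  cases e with
  | loss i =>
    rw [Element.channel, lossChannel_coherentOp ha hb h0 h1, Element.transfer,
      ← sum_mul_conj_lossMatrix_mulVec h0 i v w]
    congr 1
    ring
  | bs g =>
    rw [Element.channel, secondQuant_coherentOp ha hb, Element.transfer,
      g.sum_mul_conj_matrix_mulVec]
    congr 1
    ring

theorem channel_cons {m K : ℕ} (η : ℝ) (e : Element m) (L : List (Element m)) (ρ : Op m K) :
    channel K η (e :: L) ρ = channel K η L (e.channel K η ρ) := rfl

theorem channel_coherentOp {m K a b : ℕ} (ha : a ≤ K) (hb : b ≤ K) {η : ℝ} (h0 : 0 ≤ η)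
    (h1 : η ≤ 1) (L : List (Element m)) (z : ℂ) (v w : Fin m → ℂ) :
    channel K η L (coherentOp K a b z v w) = coherentOp K a b
      (z + ∑ i, v i * conj (w i) -
        ∑ i, (transfer η L).mulVec v i * conj ((transfer η L).mulVec w i))
      ((transfer η L).mulVec v) ((transfer η L).mulVec w) := by
  induction L generalizing z v w with
  | nil => simp [channel, transfer]
  | cons e L ih =>
    rw [channel_cons, e.channel_coherentOp ha hb h0 h1, ih, transfer]
    simp only [Matrix.mulVec_mulVec]
    congr 1
    ring

/-! ## Linearity, and determination by coherent operators -/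

theorem Element.channel_isLinear {m : ℕ} (K : ℕ) (η : ℝ) (e : Element m) :
    IsLinearMap ℂ (e.channel K η) := by
  cases e with
  | loss i =>
    constructor
    · intro x y
      simp [Element.channel, lossChannel, Matrix.mul_add, Matrix.add_mul, Finset.sum_add_distrib]
    · intro c x
      simp [Element.channel, lossChannel, Finset.smul_sum]
  | bs g =>
    constructor
    · intro x y
      simp [Element.channel, Matrix.mul_add, Matrix.add_mul]
    · intro c x
      simp [Element.channel]

theorem channel_isLinear {m : ℕ} (K : ℕ) (η : ℝ) (L : List (Element m)) :
    IsLinearMap ℂ (channel K η L) := by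
  induction L with
  | nil => exact ⟨fun _ _ => rfl, fun _ _ => rfl⟩
  | cons e L ih =>
    have he := e.channel_isLinear K η
    exact ⟨fun x y => by rw [channel_cons, he.1, ih.1]; rfl,
      fun c x => by rw [channel_cons, he.2, ih.2]; rfl⟩

/-- The channel of a list of elements as a linear map. -/
def channelLin {m : ℕ} (K : ℕ) (η : ℝ) (L : List (Element m)) : Op m K →ₗ[ℂ] Op m K :=
  (channel_isLinear K η L).mk'

@[simp] theorem channelLin_apply {m : ℕ} (K : ℕ) (η : ℝ) (L : List (Element m)) (ρ : Op m K) :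
    channelLin K η L ρ = channel K η L ρ := rfl

theorem eq_zero_of_sum_monomialEval {m K : ℕ} (c : Fock m K → ℂ)
    (h : ∀ v : Fin m → ℂ, ∑ p : Fock m K, c p * monomialEval v p.1 = 0) : c = 0 := by
  let f : MvPolynomial (Fin m) ℂ :=
    ∑ p : Fock m K, MvPolynomial.monomial (Finsupp.equivFunOnFinite.symm p.1) (c p)
  have hf : f = 0 := by
    apply MvPolynomial.funext
    intro v
    rw [map_zero, ← h v]
    simp only [f, map_sum, MvPolynomial.eval_monomial]
    refine Finset.sum_congr rfl fun p _ => ?_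
    rw [Finsupp.prod_fintype _ _ (by simp)]
    simp [monomialEval]
  funext p
  have := congrArg (MvPolynomial.coeff (Finsupp.equivFunOnFinite.symm p.1)) hf
  simp only [f, MvPolynomial.coeff_sum, MvPolynomial.coeff_monomial, EmbeddingLike.apply_eq_iff_eq,
    MvPolynomial.coeff_zero] at this
  rw [Finset.sum_eq_single p] at this
  · simpa using this
  · intro q _ hq
    rw [if_neg fun h' => hq (Subtype.ext h')]
  · simp

/-- Adding up the components of all photon numbers yields a polynomial in `v` that vanishes
everywhere, so its coefficients, which are rescaled entries of `c`, vanish. -/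
theorem eq_zero_of_sum_coherent {m K : ℕ} (c : Fock m K → ℂ)
    (h : ∀ l ≤ K, ∀ v : Fin m → ℂ, ∑ p : Fock m K, c p * coherent K l v p = 0) : c = 0 := by
  have : (fun p : Fock m K => c p / (Real.sqrt (occFactorial p.1) : ℂ)) = 0 := by
    apply eq_zero_of_sum_monomialEval
    intro v
    have h' : ∑ l ∈ Finset.range (K + 1), ∑ p : Fock m K, c p * coherent K l v p = 0 :=
      Finset.sum_eq_zero fun l hl => h l (Nat.lt_succ_iff.1 (Finset.mem_range.1 hl)) v
    rw [Finset.sum_comm] at h'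
    rw [← h']
    refine Finset.sum_congr rfl fun p _ => ?_
    rw [Finset.sum_eq_single (∑ i, p.1 i)]
    · rw [coherent, if_pos rfl]; ring
    · intro l _ hl
      rw [coherent, if_neg hl.symm, mul_zero]
    · intro hp
      exact absurd (Finset.mem_range.2 (Nat.lt_succ_of_le p.2)) hp
  funext p
  exact (div_eq_zero_iff.1 (congrFun this p)).resolve_right (sqrt_occFactorial_ne_zero p.1)

theorem coherentOp_zero {m K a b : ℕ} (v w : Fin m → ℂ) :
    coherentOp K a b 0 v w = Matrix.vecMulVec (coherent K a v) (star (coherent K b w)) := by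
  unfold coherentOp
  rw [Finset.sum_range_succ', Finset.sum_eq_zero]
  · simp
  · intro k _
    simp

/-- Polarisation: after composing with a functional, the difference is a polynomial in `v` and in
the conjugate of `w`, and the vanishing of coefficients is applied in each variable separately. -/
theorem linearMap_ext_coherentOp {m K : ℕ} {M : Type*} [AddCommGroup M] [Module ℂ M]
    [FiniteDimensional ℂ M] {f g : Op m K →ₗ[ℂ] M}
    (h : ∀ a ≤ K, ∀ b ≤ K, ∀ v w, f (coherentOp K a b 0 v w) = g (coherentOp K a b 0 v w)) :
    f = g := by
  rw [← sub_eq_zero]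
  set d := f - g with hd
  have hd0 : ∀ a ≤ K, ∀ b ≤ K, ∀ v w, d (coherentOp K a b 0 v w) = 0 := fun a ha b hb v w => by
    rw [hd, LinearMap.sub_apply, h a ha b hb, sub_self]
  have hexp : ∀ ρ : Op m K, ∀ φ : M →ₗ[ℂ] ℂ,
      φ (d ρ) = ∑ p, ∑ q, ρ p q * φ (d (Matrix.single p q 1)) := by
    intro ρ φ
    conv_lhs => rw [Matrix.matrix_eq_sum_single ρ]
    rw [map_sum, map_sum]
    refine Finset.sum_congr rfl fun p _ => ?_
    rw [map_sum, map_sum]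
    refine Finset.sum_congr rfl fun q _ => ?_
    rw [show Matrix.single p q (ρ p q) = ρ p q • Matrix.single p q (1 : ℂ) by simp,
      map_smul, map_smul, smul_eq_mul]
  have hφ : ∀ φ : M →ₗ[ℂ] ℂ, (fun p q => φ (d (Matrix.single p q 1))) = 0 := by
    intro φ
    have h2 : ∀ b ≤ K, ∀ w, (fun p => ∑ q, φ (d (Matrix.single p q 1)) *
        conj (coherent K b w q)) = 0 := by
      intro b hb w
      apply eq_zero_of_sum_coherent
      intro a ha v
      have := hexp (coherentOp K a b 0 v w) φ
      rw [hd0 a ha b hb, map_zero] at this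
      rw [this]
      refine Finset.sum_congr rfl fun p _ => ?_
      rw [Finset.sum_mul]
      refine Finset.sum_congr rfl fun q _ => ?_
      rw [coherentOp_zero, Matrix.vecMulVec_apply, Pi.star_apply, RCLike.star_def]
      ring
    funext p
    -- The bra enters antilinearly; conjugating turns the identity into one that is polynomial in
    -- `w`.
    have h3 : (fun q => conj (φ (d (Matrix.single p q 1)))) = 0 := by
      apply eq_zero_of_sum_coherent
      intro b hb w
      have := congrArg (starRingEnd ℂ) (congrFun (h2 b hb w) p)
      simpa using this
    funext q
    have := congrFun h3 q
    simpa using this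
  ext ρ
  simp only [LinearMap.zero_apply]
  rw [← Module.forall_dual_apply_eq_zero_iff ℂ]
  intro φ
  rw [hexp]
  refine Finset.sum_eq_zero fun p _ => Finset.sum_eq_zero fun q _ => ?_
  rw [show φ (d (Matrix.single p q 1)) = 0 from congrFun (congrFun (hφ φ) p) q, mul_zero]

/-- On coherent operators the lost overlaps of the two stages add up to the total lost overlap,
which depends on the product of the transfer matrices only. The two stages may use different
transmissivities, as needed for `η` and `η ^ minDepth N`. -/
theorem channel_eq_of_transfer_eq {m : ℕ} (K : ℕ) {η : ℝ} (h0 : 0 ≤ η) (h1 : η ≤ 1)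
    {L L' : List (Element m)} {η' : ℝ} (h0' : 0 ≤ η') (h1' : η' ≤ 1) {L'' : List (Element m)}
    (h : transfer η L = transfer η L' * transfer η' L'') (ρ : Op m K) :
    channel K η L ρ = channel K η L' (channel K η' L'' ρ) := by
  have : channelLin K η L = channelLin K η L' ∘ₗ channelLin K η' L'' := by
    apply linearMap_ext_coherentOp
    intro a ha b hb v w
    simp only [LinearMap.comp_apply, channelLin_apply]
    rw [channel_coherentOp ha hb h0 h1, channel_coherentOp ha hb h0' h1',
      channel_coherentOp ha hb h0 h1, h]
    simp only [Matrix.mulVec_mulVec]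
    congr 1
    ring
  exact LinearMap.congr_fun this ρ

/-! ## Extraction of uniform losses from a network -/

/-- Losses with multiplicities: `d i` loss elements on each mode `i`. -/
def lossModes {m : ℕ} (d : Fin m → ℕ) : List (Fin m) :=
  (List.finRange m).flatMap fun i => List.replicate (d i) i

theorem count_lossModes {m : ℕ} (d : Fin m → ℕ) (i : Fin m) : (lossModes d).count i = d i := by
  rw [lossModes, List.count_flatMap]
  have : (List.count i ∘ fun j => List.replicate (d j) j) = fun j => if j = i then d j else 0 := by
    funext j
    simp [List.count_replicate]
  rw [this, ← List.ofFn_eq_map, List.sum_ofFn]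
  simp

theorem length_lossModes {m : ℕ} (d : Fin m → ℕ) : (lossModes d).length = ∑ i, d i := by
  rw [lossModes, List.length_flatMap]
  simp only [List.length_replicate]
  rw [← List.ofFn_eq_map, List.sum_ofFn]

theorem transfer_map_loss {m : ℕ} (η : ℝ) (l : List (Fin m)) :
    transfer η (l.map Element.loss) =
      Matrix.diagonal fun i => (Real.sqrt η : ℂ) ^ l.count i := by
  induction l with
  | nil => simp [transfer]
  | cons a l ih =>
    rw [List.map_cons, transfer, ih, Element.transfer, lossMatrix, Matrix.diagonal_mul_diagonal]
    congr 1
    funext i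
    by_cases h : i = a
    · subst h; simp [pow_succ]
    · rw [List.count_cons_of_ne (Ne.symm h)]; simp [h]

theorem beamsplitters_append {m : ℕ} (L L' : List (Element m)) :
    beamsplitters (L ++ L') = beamsplitters L ++ beamsplitters L' := by
  simp [beamsplitters]

theorem lossCount_append {m : ℕ} (L L' : List (Element m)) :
    lossCount (L ++ L') = lossCount L + lossCount L' := by
  simp [lossCount]

theorem beamsplitters_map_loss {m : ℕ} (l : List (Fin m)) :
    beamsplitters (l.map Element.loss) = [] := by
  simp [beamsplitters]

theorem lossCount_map_loss {m : ℕ} (l : List (Fin m)) :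
    lossCount (l.map Element.loss) = l.length := by
  induction l with
  | nil => rfl
  | cons a l ih =>
    have := lossCount_append [Element.loss a] (l.map Element.loss)
    rw [ih] at this
    rw [List.map_cons, List.length_cons, ← List.singleton_append, this]
    simp [lossCount, add_comm]

theorem Network.elements_cons {m : ℕ} (g : Beamsplitter m) (N : Network m) :
    Network.elements (g :: N) =
      [Element.loss g.fst, Element.loss g.snd, Element.bs g] ++ Network.elements N := by
  simp [Network.elements]

theorem Network.lossCount_elements {m : ℕ} (N : Network m) :
    lossCount N.elements = 2 * N.length := by
  induction N with
  | nil => rfl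
  | cons g N ih =>
    rw [Network.elements_cons, lossCount_append, ih, List.length_cons]
    simp [lossCount]
    ring

/-- On the two modes that `g` mixes, the diagonal matrix is scalar. This is what lets equal losses
pass through a beamsplitter. -/
theorem Beamsplitter.diagonal_mul_matrix {m : ℕ} (g : Beamsplitter m) (c : Fin m → ℂ)
    (h : c g.fst = c g.snd) :
    Matrix.diagonal c * g.matrix = g.matrix * Matrix.diagonal c := by
  ext i j
  rw [Matrix.diagonal_mul, Matrix.mul_diagonal, mul_comm]
  by_cases hij : c i = c j
  · rw [hij]
  · have : g.matrix i j = 0 := by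
      unfold Beamsplitter.matrix
      split_ifs <;> simp_all
    rw [this]; simp

/-- The induction prepends a block at the input. Of the losses waiting behind it on its two modes,
the smaller number `k` is common to both and is pulled through; the excess `e` stays behind the
beamsplitter, and the block's own two losses raise `k` to `k + 1`. Taking the minimum matches a path
choosing the better exit, so `d i` is always realised by a path. -/
theorem Network.exists_extracted_losses {m : ℕ} (η : ℝ) (N : Network m) :
    ∃ (d : Fin m → ℕ) (L : List (Element m)), (∀ i, ∃ j, PathLength N i j (d i)) ∧
      beamsplitters L = N ∧ lossCount L + ∑ i, d i = lossCount N.elements ∧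
      transfer η N.elements =
        transfer η L * Matrix.diagonal fun i => (Real.sqrt η : ℂ) ^ d i := by
  induction N with
  | nil =>
    refine ⟨fun _ => 0, [], fun i => ⟨i, PathLength.nil i⟩, rfl, ?_, ?_⟩
    · simp [lossCount, Network.elements]
    · simp [Network.elements, transfer]
  | cons g N ih =>
    obtain ⟨d, L, hpath, hbs, hcount, htr⟩ := ih
    set k := min (d g.fst) (d g.snd) with hk
    set e : Fin m → ℕ := fun i => if i = g.fst ∨ i = g.snd then d i - k else 0 with he
    set f : Fin m → ℕ := fun i => if i = g.fst ∨ i = g.snd then k else d i with hf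
    set d' : Fin m → ℕ := fun i => if i = g.fst ∨ i = g.snd then k + 1 else d i with hd'
    have hef : ∀ i, d i = e i + f i := by
      intro i
      simp only [he, hf]
      split_ifs with h
      · rcases h with rfl | rfl <;> omega
      · omega
    have hfd : ∀ i, d' i = f i + (if i = g.fst then 1 else 0) + (if i = g.snd then 1 else 0) := by
      intro i
      have := g.ne
      simp only [hd', hf]
      by_cases h1 : i = g.fst
      · have h2 : i ≠ g.snd := h1 ▸ this
        simp [h1, this]
      · by_cases h2 : i = g.snd <;> simp [h1, h2, this.symm]
    -- `f` counts the old losses that reach the input side of the block, and `d'` adds its own ones.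
    refine ⟨d', [Element.bs g] ++ (lossModes e).map Element.loss ++ L, ?_, ?_, ?_, ?_⟩
    · intro i
      obtain ⟨i', hi', hdi'⟩ : ∃ i', (i' = g.fst ∨ i' = g.snd) ∧ d i' = k := by
        rcases min_choice (d g.fst) (d g.snd) with h | h
        · exact ⟨g.fst, Or.inl rfl, by rw [hk, h]⟩
        · exact ⟨g.snd, Or.inr rfl, by rw [hk, h]⟩
      by_cases h : i = g.fst ∨ i = g.snd
      · obtain ⟨j, hj⟩ := hpath i'
        refine ⟨j, ?_⟩
        simp only [hd', if_pos h]
        rw [hdi'] at hj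
        exact PathLength.hit h hi' hj
      · obtain ⟨j, hj⟩ := hpath i
        refine ⟨j, ?_⟩
        simp only [hd', if_neg h]
        rw [not_or] at h
        exact PathLength.miss h.1 h.2 hj
    · rw [beamsplitters_append, beamsplitters_append, beamsplitters_map_loss, hbs]
      rfl
    · rw [lossCount_append, lossCount_append, lossCount_map_loss, length_lossModes,
        Network.lossCount_elements, List.length_cons]
      rw [Network.lossCount_elements] at hcount
      have h1 : ∑ i, d' i = ∑ i, f i + 1 + 1 := by
        simp only [hfd, Finset.sum_add_distrib]
        simp
      have h2 : ∑ i, d i = ∑ i, e i + ∑ i, f i := by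
        simp only [hef, Finset.sum_add_distrib]
      have h3 : lossCount [Element.bs g] = 0 := rfl
      omega
    · rw [Network.elements_cons, transfer_append, htr, transfer_append, transfer_append,
        transfer_map_loss]
      simp only [count_lossModes, transfer, Element.transfer, Matrix.one_mul]
      have hfc : (fun i => (Real.sqrt η : ℂ) ^ f i) g.fst =
          (fun i => (Real.sqrt η : ℂ) ^ f i) g.snd := by
        simp [hf]
      have hsplit : (Matrix.diagonal fun i => (Real.sqrt η : ℂ) ^ d i) =
          (Matrix.diagonal fun i => (Real.sqrt η : ℂ) ^ e i) *
            Matrix.diagonal fun i => (Real.sqrt η : ℂ) ^ f i := by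
        rw [Matrix.diagonal_mul_diagonal]
        congr 1
        funext i
        rw [hef, pow_add]
      have hjoin : (Matrix.diagonal fun i => (Real.sqrt η : ℂ) ^ d' i) =
          (Matrix.diagonal fun i => (Real.sqrt η : ℂ) ^ f i) *
            (lossMatrix η g.snd * lossMatrix η g.fst) := by
        rw [lossMatrix, lossMatrix, Matrix.diagonal_mul_diagonal, Matrix.diagonal_mul_diagonal]
        congr 1
        funext i
        rw [hfd, pow_add, pow_add]
        split_ifs <;> simp [mul_assoc]
      rw [hsplit, hjoin]
      simp only [Matrix.mul_assoc]
      congr 2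
      rw [← Matrix.mul_assoc g.matrix (Matrix.diagonal _), ← g.diagonal_mul_matrix _ hfc,
        Matrix.mul_assoc]

theorem transfer_uniformLoss {m : ℕ} (η : ℝ) :
    transfer η ((List.finRange m).map Element.loss) =
      Matrix.diagonal fun _ => (Real.sqrt η : ℂ) := by
  rw [transfer_map_loss]
  congr 1
  funext i
  rw [List.count_eq_one_of_mem (List.nodup_finRange m) (List.mem_finRange i), pow_one]

/-- Every `d i` is a path length, hence at least `minDepth N`. That many losses per mode form the
uniform layer, and the surplus is returned to the front of the remaining network. -/
theorem Network.exists_uniform_losses {m : ℕ} {η : ℝ} (h0 : 0 ≤ η) (N : Network m) :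
    ∃ L : List (Element m), beamsplitters L = N ∧
      lossCount L + minDepth N * m = lossCount N.elements ∧
      transfer η N.elements =
        transfer η L * transfer (η ^ minDepth N) ((List.finRange m).map Element.loss) := by
  obtain ⟨d, L, hpath, hbs, hcount, htr⟩ := N.exists_extracted_losses η
  have hd : ∀ i, minDepth N ≤ d i := fun i => by
    obtain ⟨j, hj⟩ := hpath i
    exact Nat.sInf_le ⟨i, j, hj⟩
  refine ⟨(lossModes fun i => d i - minDepth N).map Element.loss ++ L, ?_, ?_, ?_⟩
  · rw [beamsplitters_append, beamsplitters_map_loss, hbs]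
    rfl
  · rw [lossCount_append, lossCount_map_loss, length_lossModes, ← hcount]
    have : ∑ i, d i = ∑ i, (d i - minDepth N) + minDepth N * m := by
      rw [← Nat.sub_add_cancel (n := ∑ i, d i) (m := minDepth N * m)]
      · rw [Finset.sum_tsub_distrib _ fun i _ => hd i]
        simp [mul_comm]
      · calc minDepth N * m = ∑ _i : Fin m, minDepth N := by simp [mul_comm]
          _ ≤ _ := Finset.sum_le_sum fun i _ => hd i
    omega
  · rw [htr, transfer_append, Matrix.mul_assoc, transfer_map_loss, transfer_uniformLoss,
      Matrix.diagonal_mul_diagonal]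
    congr 2
    funext i
    rw [count_lossModes, sqrt_pow_of_nonneg h0, Complex.ofReal_pow, ← pow_add,
      Nat.sub_add_cancel (hd i)]

/-! ## Phase-averaged product states -/

/-- The projector onto `|v⟩^{⊗ l}`. -/
def productOp {m : ℕ} (K : ℕ) (v : Fin m → ℂ) (l : ℕ) : Op m K :=
  Matrix.vecMulVec (productVec K v l) (star (productVec K v l))

theorem productOp_eq_coherentOp {m K : ℕ} (v : Fin m → ℂ) (l : ℕ) :
    productOp K v l = (l.factorial : ℂ) • coherentOp K l l 0 v v := by
  have h1 : (Real.sqrt l.factorial : ℂ) * (Real.sqrt l.factorial : ℂ) = l.factorial := by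
    rw [← Complex.ofReal_mul, Real.mul_self_sqrt (Nat.cast_nonneg _)]; simp
  ext p q
  rw [coherentOp_zero]
  simp only [productOp, Matrix.vecMulVec_apply, Matrix.smul_apply, Pi.star_apply, RCLike.star_def,
    productVec_eq_coherent, map_mul, Complex.conj_ofReal, smul_eq_mul]
  rw [← h1]
  ring

theorem continuous_phaseState (m n : ℕ) (i : Fin m) :
    Continuous fun φ : Fin n → ℝ => phaseState m n φ i := by
  unfold phaseState
  split_ifs with h
  · fun_prop
  · exact continuous_const

theorem continuous_monomialEval_comp {m : ℕ} {X : Type*} [TopologicalSpace X]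
    {v : X → Fin m → ℂ} (hv : ∀ i, Continuous fun x => v x i) (p : Fin m → ℕ) :
    Continuous fun x => monomialEval (v x) p := by
  unfold monomialEval
  exact continuous_finsetProd _ fun i _ => (hv i).pow _

theorem continuous_productVec_phaseState (m n l : ℕ) (p : Fock m n) :
    Continuous fun φ : Fin n → ℝ => productVec n (phaseState m n φ) l p := by
  simp only [productVec_eq_coherent, coherent]
  split_ifs
  · exact continuous_const.mul ((continuous_monomialEval_comp
      (fun i => continuous_phaseState m n i) p.1).div_const _)
  · simp only [mul_zero]
    exact continuous_const

theorem integrableOn_phases {E : Type*} [NormedAddCommGroup E] {n : ℕ} {f : (Fin n → ℝ) → E}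
    (hf : Continuous f) :
    IntegrableOn f (Set.Icc (0 : Fin n → ℝ) (fun _ => 2 * Real.pi)) :=
  hf.continuousOn.integrableOn_compact isCompact_Icc

theorem linearMap_op_apply {m K : ℕ} (ψ : Op m K →ₗ[ℂ] ℂ) (ρ : Op m K) :
    ψ ρ = ∑ p, ∑ q, ρ p q * ψ (Matrix.single p q 1) := by
  conv_lhs => rw [Matrix.matrix_eq_sum_single ρ]
  rw [map_sum]
  refine Finset.sum_congr rfl fun p _ => ?_
  rw [map_sum]
  refine Finset.sum_congr rfl fun q _ => ?_
  rw [show Matrix.single p q (ρ p q) = ρ p q • Matrix.single p q (1 : ℂ) by simp,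
    map_smul, smul_eq_mul]

/-- Used to move channels and matrix entries inside the phase average, so that only product states
with fixed phases have to be propagated. -/
theorem linearMap_sepState {m n : ℕ} (l : ℕ) (ψ : Op m n →ₗ[ℂ] ℂ) :
    ψ (sepState m n l) = (((2 * Real.pi) ^ n : ℝ) : ℂ)⁻¹ *
      ∫ φ in Set.Icc (0 : Fin n → ℝ) (fun _ => 2 * Real.pi),
        ψ (productOp n (phaseState m n φ) l) := by
  have hint : ∀ p q : Fock m n, IntegrableOn (fun φ : Fin n → ℝ =>
      productVec n (phaseState m n φ) l p * conj (productVec n (phaseState m n φ) l q) *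
        ψ (Matrix.single p q 1)) (Set.Icc (0 : Fin n → ℝ) (fun _ => 2 * Real.pi)) := fun p q =>
    integrableOn_phases (((continuous_productVec_phaseState m n l p).mul
      (Complex.continuous_conj.comp (continuous_productVec_phaseState m n l q))).mul_const _)
  rw [linearMap_op_apply ψ (sepState m n l)]
  have : ∀ φ : Fin n → ℝ, ψ (productOp n (phaseState m n φ) l) =
      ∑ p, ∑ q, productVec n (phaseState m n φ) l p *
        conj (productVec n (phaseState m n φ) l q) * ψ (Matrix.single p q 1) := fun φ =>
    linearMap_op_apply ψ _
  simp only [this]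
  rw [integral_finsetSum _ fun p _ => integrable_finsetSum _ fun q _ => hint p q, Finset.mul_sum]
  refine Finset.sum_congr rfl fun p _ => ?_
  rw [integral_finsetSum _ fun q _ => hint p q, Finset.mul_sum]
  refine Finset.sum_congr rfl fun q _ => ?_
  rw [integral_mul_const, sepState, mul_assoc]

theorem sum_phaseState {m n : ℕ} (hnm : n ≤ m) (hn : n ≠ 0) (φ : Fin n → ℝ) :
    ∑ i, phaseState m n φ i * conj (phaseState m n φ i) = 1 := by
  have hn' : (0 : ℝ) < n := by exact_mod_cast Nat.pos_of_ne_zero hn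
  have h : ∀ i, phaseState m n φ i * conj (phaseState m n φ i) =
      if i.1 < n then (n : ℂ)⁻¹ else 0 := by
    intro i
    unfold phaseState
    split_ifs with hi
    · rw [Complex.mul_conj, Complex.normSq_div, Complex.normSq_ofReal,
        Real.mul_self_sqrt hn'.le, Complex.normSq_eq_norm_sq]
      rw [show -(Complex.I * (φ ⟨i.1, hi⟩ : ℂ)) = ((-φ ⟨i.1, hi⟩ : ℝ) : ℂ) * Complex.I by
        push_cast; ring, Complex.norm_exp_ofReal_mul_I]
      simp
    · simp
  simp only [h]
  rw [← Finset.sum_filter, Finset.sum_const]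
  have hc : (Finset.univ.filter fun i : Fin m => i.1 < n).card = n := by
    rw [Fin.card_filter_val_lt]
    omega
  rw [hc, nsmul_eq_mul, mul_inv_cancel₀]
  exact_mod_cast hn

theorem coherent_smul {m K l : ℕ} (c : ℂ) (v : Fin m → ℂ) :
    coherent K l (c • v) = c ^ l • coherent K l v := by
  funext p
  simp only [coherent, Pi.smul_apply, smul_eq_mul]
  split_ifs with h
  · have : monomialEval (c • v) p.1 = c ^ l * monomialEval v p.1 := by
      simp only [monomialEval, Pi.smul_apply, smul_eq_mul, mul_pow, Finset.prod_mul_distrib,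
        Finset.prod_pow_eq_pow_sum, h]
    rw [this]; ring
  · simp

/-- Uniform loss only rescales `v` by `√t`, so the survivors remain in the same single-photon state;
the lost overlap `1 - t` supplies the remaining binomial factor. Normalisation is asked for `n ≠ 0`
only, because the phase state of zero photons is the zero vector. -/
theorem uniformLoss_productOp {m n : ℕ} (v : Fin m → ℂ) (hv : n ≠ 0 → ∑ i, v i * conj (v i) = 1)
    {t : ℝ} (h0 : 0 ≤ t) (h1 : t ≤ 1) :
    uniformLoss n t (productOp n v n) = ∑ l ∈ Finset.range (n + 1),
      (((n.choose l : ℝ) * t ^ l * (1 - t) ^ (n - l) : ℝ) : ℂ) • productOp n v l := by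
  have hs : (Real.sqrt t : ℂ) * (Real.sqrt t : ℂ) = t := by
    rw [← Complex.ofReal_mul, Real.mul_self_sqrt h0]
  have hmul : ∀ u : Fin m → ℂ,
      (Matrix.diagonal fun _ => (Real.sqrt t : ℂ)).mulVec u = (Real.sqrt t : ℂ) • u := by
    intro u
    funext i
    rw [Matrix.mulVec_diagonal]; rfl
  rw [productOp_eq_coherentOp, uniformLoss, (channel_isLinear _ _ _).2,
    channel_coherentOp le_rfl le_rfl h0 h1, transfer_uniformLoss, hmul, coherentOp, min_self,
    -- `coherentOp` is indexed by the number of lost photons, the target sum by the number of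
    -- survivors.
    Finset.smul_sum, ← Finset.sum_range_reflect]
  refine Finset.sum_congr rfl fun l hl => ?_
  have hl' : l ≤ n := Nat.lt_succ_iff.1 (Finset.mem_range.1 hl)
  rw [show n + 1 - 1 - l = n - l by omega, Nat.sub_sub_self hl', coherent_smul,
    productOp_eq_coherentOp, coherentOp_zero, star_smul, Matrix.smul_vecMulVec,
    Matrix.vecMulVec_smul, smul_smul, smul_smul, smul_smul, smul_smul]
  congr 1
  have hz : (0 + ∑ i, v i * conj (v i) - ∑ i, ((Real.sqrt t : ℂ) • v) i *
      conj (((Real.sqrt t : ℂ) • v) i)) ^ (n - l) = (1 - t : ℂ) ^ (n - l) := by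
    by_cases hn : n = 0
    · subst hn; simp
    · congr 1
      have : ∑ i, ((Real.sqrt t : ℂ) • v) i * conj (((Real.sqrt t : ℂ) • v) i) =
          t * ∑ i, v i * conj (v i) := by
        rw [Finset.mul_sum]
        refine Finset.sum_congr rfl fun i _ => ?_
        simp only [Pi.smul_apply, smul_eq_mul, map_mul, Complex.conj_ofReal]
        linear_combination (v i * conj (v i)) * hs
      rw [this, hv hn]; ring
  rw [hz, star_pow, RCLike.star_def, Complex.conj_ofReal]
  have h4 : (n.choose l : ℂ) * l.factorial * (n - l).factorial = n.factorial := by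
    exact_mod_cast Nat.choose_mul_factorial_mul_factorial hl'
  have h5 : ((n - l).factorial : ℂ) ≠ 0 := by exact_mod_cast (n - l).factorial_ne_zero
  have h6 : (Real.sqrt t : ℂ) ^ l * (Real.sqrt t : ℂ) ^ l = (t : ℂ) ^ l := by
    rw [← mul_pow, hs]
  rw [← h4]
  push_cast
  rw [← h6]
  field_simp

/-- This identity spares the sampler the extraction of losses: it can run the original network on
the lossless product state. -/
theorem uniformLoss_sepState {m n : ℕ} (hnm : n ≤ m) {t : ℝ} (h0 : 0 ≤ t) (h1 : t ≤ 1) :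
    uniformLoss n t (sepState m n n) = sepMixture m n t := by
  ext p q
  have h := linearMap_sepState n
    ((Matrix.entryLinearMap ℂ ℂ p q) ∘ₗ
      channelLin (m := m) n t ((List.finRange m).map Element.loss))
  simp only [LinearMap.comp_apply, channelLin_apply, Matrix.entryLinearMap_apply] at h
  have h' : ∀ l : ℕ, sepState m n l p q = _ := fun l =>
    linearMap_sepState l (Matrix.entryLinearMap ℂ ℂ p q)
  simp only [Matrix.entryLinearMap_apply] at h'
  change uniformLoss n t (sepState m n n) p q = _ at h
  rw [h]
  have hU : ∀ φ : Fin n → ℝ, channel n t ((List.finRange m).map Element.loss)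
      (productOp n (phaseState m n φ) n) p q = ∑ l ∈ Finset.range (n + 1),
      (((n.choose l : ℝ) * t ^ l * (1 - t) ^ (n - l) : ℝ) : ℂ) *
        productOp n (phaseState m n φ) l p q := by
    intro φ
    have := uniformLoss_productOp (n := n) (phaseState m n φ)
      (fun hn => sum_phaseState hnm hn φ) h0 h1
    rw [uniformLoss] at this
    rw [this, Matrix.sum_apply]
    rfl
  simp only [hU, sepMixture, Matrix.sum_apply, Matrix.smul_apply, smul_eq_mul, h']
  rw [integral_finsetSum]
  · simp only [integral_const_mul, Finset.mul_sum]
    exact Finset.sum_congr rfl fun l _ => by ring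
  · intro l _
    exact integrableOn_phases (((continuous_productVec_phaseState m n l p).mul
      (Complex.continuous_conj.comp (continuous_productVec_phaseState m n l q))).const_mul _)

/-! ### Output statistics of product states -/

/-- The probability that `n` independent particles, each of which is found in mode `j` with
probability `c j` and is lost otherwise, produce the counts `p`. -/
def multinomialProb {m : ℕ} (n : ℕ) (c : Fin m → ℝ) (p : Fin m → ℕ) : ℝ :=
  n.factorial / ((n - ∑ i, p i).factorial * occFactorial p) *
    ((∏ i, c i ^ p i) * (1 - ∑ i, c i) ^ (n - ∑ i, p i))

theorem monomialEval_mul_conj {m : ℕ} (v : Fin m → ℂ) (p : Fin m → ℕ) :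
    monomialEval v p * conj (monomialEval v p) = (∏ i, Complex.normSq (v i) ^ p i : ℝ) := by
  simp only [monomialEval, map_prod, map_pow, ← Finset.prod_mul_distrib, ← mul_pow,
    Complex.mul_conj]
  push_cast
  rfl

/-- Photons sharing one single-particle state behave as independent classical particles: diagonal
entries see `|T v|²` only, and the final `z` is the loss probability of one photon. -/
theorem channel_productOp_diag {m n : ℕ} (v : Fin m → ℂ)
    (hv : n ≠ 0 → ∑ i, v i * conj (v i) = 1) {η : ℝ} (h0 : 0 ≤ η) (h1 : η ≤ 1)
    (L : List (Element m)) (p : Fock m n) :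
    channel n η L (productOp n v n) p p =
      (multinomialProb n (fun j => Complex.normSq ((transfer η L).mulVec v j)) p.1 : ℂ) := by
  rw [productOp_eq_coherentOp, (channel_isLinear _ _ _).2, Matrix.smul_apply,
    channel_coherentOp le_rfl le_rfl h0 h1, coherentOp_apply, if_pos ⟨p.2, rfl⟩]
  set w := (transfer η L).mulVec v
  have hz : (0 + ∑ i, v i * conj (v i) - ∑ i, w i * conj (w i)) ^ (n - ∑ i, p.1 i) =
      (1 - ∑ i, (Complex.normSq (w i) : ℂ)) ^ (n - ∑ i, p.1 i) := by
    by_cases hn : n = 0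
    · subst hn; simp
    · rw [hv hn, zero_add]
      simp only [Complex.mul_conj]
  rw [hz, map_div₀, Complex.conj_ofReal, div_mul_div_comm, monomialEval_mul_conj,
    sqrt_occFactorial_mul_self, multinomialProb, smul_eq_mul]
  push_cast
  ring

theorem outputDist_channel_sepState {m n : ℕ} (hnm : n ≤ m) {η : ℝ} (h0 : 0 ≤ η) (h1 : η ≤ 1)
    (L : List (Element m)) (p : Fock m n) :
    outputDist (channel n η L (sepState m n n)) p = ((2 * Real.pi) ^ n)⁻¹ *
      ∫ φ in Set.Icc (0 : Fin n → ℝ) (fun _ => 2 * Real.pi), multinomialProb n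
        (fun j => Complex.normSq ((transfer η L).mulVec (phaseState m n φ) j)) p.1 := by
  have h := linearMap_sepState n
    ((Matrix.entryLinearMap ℂ ℂ p p) ∘ₗ channelLin (m := m) n η L)
  simp only [LinearMap.comp_apply, channelLin_apply, Matrix.entryLinearMap_apply] at h
  have hd : ∀ φ : Fin n → ℝ, channel n η L (productOp n (phaseState m n φ) n) p p = _ := fun φ =>
    channel_productOp_diag (phaseState m n φ) (fun hn => sum_phaseState hnm hn φ) h0 h1 L p
  simp only [hd] at h
  rw [outputDist, h, integral_complex_ofReal, ← Complex.ofReal_inv, ← Complex.ofReal_mul,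
    Complex.ofReal_re]

section Positivity

open scoped ComplexOrder

/-! ## Channels preserve positivity and the trace -/

theorem Element.channel_posSemidef {m K : ℕ} (η : ℝ) (e : Element m) {ρ : Op m K}
    (h : ρ.PosSemidef) : (e.channel K η ρ).PosSemidef := by
  cases e with
  | loss i =>
    exact Matrix.posSemidef_sum _ fun k _ => h.mul_mul_conjTranspose_same _
  | bs g => exact h.mul_mul_conjTranspose_same _

theorem channel_posSemidef {m K : ℕ} (η : ℝ) (L : List (Element m)) {ρ : Op m K}
    (h : ρ.PosSemidef) : (channel K η L ρ).PosSemidef := by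
  induction L generalizing ρ with
  | nil => exact h
  | cons e L ih => exact ih (e.channel_posSemidef η h)

theorem dotProduct_coherent {m K l l' : ℕ} (hl : l ≤ K) (v w : Fin m → ℂ) :
    dotProduct (coherent K l v) (star (coherent K l' w)) =
      if l = l' then (∑ i, v i * conj (w i)) ^ l / l.factorial else 0 := by
  split_ifs with h
  · subst h
    have hl0 : (l.factorial : ℂ) ≠ 0 := by exact_mod_cast l.factorial_ne_zero
    rw [eq_div_iff hl0, sum_pow_eq_sum_fock _ hl, dotProduct, Finset.sum_mul]
    refine Finset.sum_congr rfl fun p _ => ?_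
    simp only [coherent, Pi.star_apply, RCLike.star_def]
    split_ifs with hp
    · have h1 : ∏ i, (v i * conj (w i)) ^ p.1 i = monomialEval v p.1 * conj (monomialEval w p.1) := by
        simp only [monomialEval, map_prod, map_pow, ← Finset.prod_mul_distrib, ← mul_pow]
      rw [h1, map_div₀, Complex.conj_ofReal, div_mul_div_comm, sqrt_occFactorial_mul_self,
        smul_eq_mul]
      ring
    · simp
  · refine Finset.sum_eq_zero fun p _ => ?_
    simp only [coherent, Pi.star_apply]
    by_cases hp : ∑ i, p.1 i = l
    · rw [if_neg (c := ∑ i, p.1 i = l') (by omega)]; simp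
    · rw [if_neg hp, zero_mul]

theorem trace_coherentOp {m K a b : ℕ} (ha : a ≤ K) (z : ℂ) (v w : Fin m → ℂ) :
    (coherentOp K a b z v w).trace =
      if a = b then (z + ∑ i, v i * conj (w i)) ^ a / a.factorial else 0 := by
  unfold coherentOp
  rw [Matrix.trace_sum]
  simp only [Matrix.trace_smul, Matrix.trace_vecMulVec, smul_eq_mul]
  split_ifs with h
  · subst h
    rw [add_pow_div_factorial, min_self]
    refine Finset.sum_congr rfl fun k _ => ?_
    rw [dotProduct_coherent (by omega), if_pos rfl]
  · refine Finset.sum_eq_zero fun k hk => ?_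
    rw [Finset.mem_range] at hk
    rw [dotProduct_coherent (by omega), if_neg (by omega), mul_zero]

/-- The trace of a coherent operator depends on `z + ⟨v, w⟩` only, which is the conserved quantity.
-/
theorem trace_channel {m K : ℕ} {η : ℝ} (h0 : 0 ≤ η) (h1 : η ≤ 1) (L : List (Element m))
    (ρ : Op m K) : (channel K η L ρ).trace = ρ.trace := by
  have : Matrix.traceLinearMap (Fock m K) ℂ ℂ ∘ₗ channelLin K η L =
      Matrix.traceLinearMap (Fock m K) ℂ ℂ := by
    apply linearMap_ext_coherentOp
    intro a ha b hb v w
    simp only [LinearMap.comp_apply, channelLin_apply, Matrix.traceLinearMap_apply]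
    rw [channel_coherentOp ha hb h0 h1, trace_coherentOp ha, trace_coherentOp ha]
    congr 3
    ring
  exact LinearMap.congr_fun this ρ

/-! ## Distances of diagonal states -/

theorem traceDist_of_sub_eq_diagonal {α : Type*} [Fintype α] [DecidableEq α] {ρ σ : Matrix α α ℂ}
    {d : α → ℝ} (h : ρ - σ = Matrix.diagonal fun i => (d i : ℂ)) :
    traceDist ρ σ = (1 / 2) * ∑ i, |d i| := by
  unfold traceDist
  congr 1
  set A := (ρ - σ).conjTranspose * (ρ - σ)
  set hA := Matrix.isHermitian_conjTranspose_mul_self (ρ - σ)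
  have hAd : A = Matrix.diagonal fun i => ((d i ^ 2 : ℝ) : ℂ) := by
    simp only [A, h, Matrix.diagonal_conjTranspose, Matrix.diagonal_mul_diagonal]
    congr 1
    funext i
    simp [sq]
  -- The order of the eigenvalues is unknown, so they are compared with the squares `d i ^ 2` as
  -- multisets of roots.
  have h1 : A.charpoly.roots =
      Multiset.map (fun i => ((hA.eigenvalues i : ℝ) : ℂ)) Finset.univ.val := by
    rw [hA.roots_charpoly_eq_eigenvalues]; rfl
  have h2 : A.charpoly.roots = Multiset.map (fun i => ((d i ^ 2 : ℝ) : ℂ)) Finset.univ.val := by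
    rw [hAd, Matrix.charpoly_diagonal, Polynomial.roots_prod _ _
      (Finset.prod_ne_zero_iff.2 fun i _ => Polynomial.X_sub_C_ne_zero _)]
    simp only [Polynomial.roots_X_sub_C]
    exact Multiset.bind_singleton _ _
  have h3 := congrArg (fun s => (s.map fun z : ℂ => Real.sqrt z.re).sum) (h1.symm.trans h2)
  simp only [Multiset.map_map, Function.comp_def, Complex.ofReal_re, Real.sqrt_sq_eq_abs] at h3
  exact h3

/-- Since the difference is diagonal, the channel followed by the measurement acts on it as a
stochastic matrix, which contracts the `ℓ¹` norm. Nonnegativity and unit column sums come from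
positivity and trace preservation. -/
theorem tvDist_channel_le {m K : ℕ} {η : ℝ} (h0 : 0 ≤ η) (h1 : η ≤ 1) (L : List (Element m))
    {ρ σ : Op m K} {d : Fock m K → ℝ} (h : ρ - σ = Matrix.diagonal fun i => (d i : ℂ)) :
    tvDist (outputDist (channel K η L ρ)) (outputDist (channel K η L σ)) ≤
      (1 / 2) * ∑ p, |d p| := by
  unfold tvDist
  apply mul_le_mul_of_nonneg_left _ (by norm_num)
  set e : Fock m K → Op m K := fun q => channel K η L (Matrix.single q q 1)
  have hpos : ∀ q p, 0 ≤ (e q p p).re := by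
    intro q p
    have hs : (Matrix.single q q (1 : ℂ)).PosSemidef := by
      rw [← Matrix.diagonal_single, Matrix.posSemidef_diagonal_iff]
      intro i
      by_cases hi : i = q
      · subst hi; simp
      · simp [hi]
    have := (channel_posSemidef η L hs).diag_nonneg (i := p)
    exact (Complex.le_def.1 this).1
  have hsum : ∀ q, ∑ p, (e q p p).re = 1 := by
    intro q
    have := congrArg Complex.re (trace_channel h0 h1 L (Matrix.single q q (1 : ℂ)))
    rw [Matrix.trace_single_eq_same, Matrix.trace, Complex.re_sum] at this
    exact this
  have hdiff : ∀ p, outputDist (channel K η L ρ) p - outputDist (channel K η L σ) p =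
      ∑ q, d q * (e q p p).re := by
    intro p
    have hlin : channel K η L ρ - channel K η L σ = ∑ q, (d q : ℂ) • e q := by
      have := (channelLin K η L).map_sub ρ σ
      simp only [channelLin_apply] at this
      rw [← this, h, ← channelLin_apply]
      have hd : (Matrix.diagonal fun i => (d i : ℂ)) =
          ∑ q : Fock m K, (d q : ℂ) • Matrix.single q q (1 : ℂ) := by
        ext i j
        simp only [Matrix.sum_apply, Matrix.smul_apply, Matrix.single_apply, smul_eq_mul]
        by_cases hij : i = j
        · subst hij; simp
        · rw [Matrix.diagonal_apply_ne _ hij, Finset.sum_eq_zero]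
          intro q _
          rw [if_neg fun h' => hij (h'.1.symm.trans h'.2), mul_zero]
      rw [hd, map_sum]
      simp only [map_smul]
      rfl
    have := congrArg (fun M : Op m K => (M p p).re) hlin
    simpa [outputDist, Matrix.sum_apply] using this
  calc ∑ p, |outputDist (channel K η L ρ) p - outputDist (channel K η L σ) p|
      ≤ ∑ p, ∑ q, |d q| * (e q p p).re := by
        refine Finset.sum_le_sum fun p _ => ?_
        rw [hdiff]
        refine (Finset.abs_sum_le_sum_abs _ _).trans (Finset.sum_le_sum fun q _ => ?_)
        rw [abs_mul, abs_of_nonneg (hpos q p)]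
    _ = ∑ q, |d q| := by
        rw [Finset.sum_comm]
        refine Finset.sum_congr rfl fun q _ => ?_
        rw [← Finset.mul_sum, hsum, mul_one]

theorem tvDist_comm {α : Type*} [Fintype α] (P Q : α → ℝ) : tvDist P Q = tvDist Q P := by
  simp only [tvDist, abs_sub_comm]

/-! ## Uniform losses on a Fock state -/

/-- The probability that `a` of `s` photons survive. -/
def survivalProb (t : ℝ) (s a : ℕ) : ℝ := (s.choose a : ℝ) * t ^ a * (1 - t) ^ (s - a)

/-- `A` collects the modes already subjected to loss: their occupations are binomial, the others
still agree with `s`. -/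
theorem channel_map_loss_single {m K : ℕ} {t : ℝ} (h0 : 0 ≤ t) (h1 : t ≤ 1) (s : Fock m K)
    (A : Finset (Fin m)) (l : List (Fin m)) (hl : l.Nodup) (hA : ∀ i ∈ l, i ∉ A) :
    channel K t (l.map Element.loss) (Matrix.diagonal fun p : Fock m K =>
      ((∏ i, if i ∈ A then survivalProb t (s.1 i) (p.1 i) else if p.1 i = s.1 i then 1 else 0 : ℝ) : ℂ)) =
      Matrix.diagonal fun p : Fock m K =>
        ((∏ i, if i ∈ A ∪ l.toFinset then survivalProb t (s.1 i) (p.1 i)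
          else if p.1 i = s.1 i then 1 else 0 : ℝ) : ℂ) := by
  induction l generalizing A with
  | nil => simp [channel]
  | cons i l ih =>
    rw [List.nodup_cons] at hl
    have hiA : i ∉ A := hA i (by simp)
    have key : lossChannel K t i (Matrix.diagonal fun p : Fock m K =>
        ((∏ j, if j ∈ A then survivalProb t (s.1 j) (p.1 j)
          else if p.1 j = s.1 j then 1 else 0 : ℝ) : ℂ)) =
        Matrix.diagonal fun p : Fock m K =>
        ((∏ j, if j ∈ insert i A then survivalProb t (s.1 j) (p.1 j)
          else if p.1 j = s.1 j then 1 else 0 : ℝ) : ℂ) := by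
      ext p q
      rw [lossChannel_apply]
      by_cases hpq : p = q
      swap
      · rw [Matrix.diagonal_apply_ne _ hpq]
        refine Finset.sum_eq_zero fun k _ => ?_
        split_ifs with hk
        · rw [Matrix.diagonal_apply_ne, mul_zero, zero_mul]
          intro h
          apply hpq
          apply Subtype.ext
          funext j
          have hj := congrFun (congrArg Subtype.val h) j
          by_cases hji : j = i
          · subst hji
            simpa using hj
          · simpa [hji] using hj
        · rfl
      subst hpq
      rw [Matrix.diagonal_apply_eq]
      have hw : ∀ k, (lossWeight t i k p.1 : ℂ) * (lossWeight t i k p.1 : ℂ) =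
          (((p.1 i + k).choose k : ℝ) * t ^ p.1 i * (1 - t) ^ k : ℝ) := by
        intro k
        have : 0 ≤ 1 - t := by linarith
        rw [lossWeight, ← Complex.ofReal_mul, Real.mul_self_sqrt (by positivity)]
      set r : ℝ := ∏ j ∈ Finset.univ.erase i, if j ∈ A then survivalProb t (s.1 j) (p.1 j)
          else if p.1 j = s.1 j then 1 else 0 with hr
      have hprod : ∀ k, (∏ j, if j ∈ A then
          survivalProb t (s.1 j) (Function.update p.1 i (p.1 i + k) j)
          else if Function.update p.1 i (p.1 i + k) j = s.1 j then 1 else 0) =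
          (if p.1 i + k = s.1 i then 1 else 0) * r := by
        intro k
        rw [← Finset.mul_prod_erase _ _ (Finset.mem_univ i), if_neg hiA, Function.update_self]
        congr 1
        refine Finset.prod_congr rfl fun j hj => ?_
        rw [Function.update_of_ne (Finset.ne_of_mem_erase hj)]
      have hprod' : (∏ j, if j ∈ insert i A then survivalProb t (s.1 j) (p.1 j)
          else if p.1 j = s.1 j then 1 else 0) = survivalProb t (s.1 i) (p.1 i) * r := by
        rw [← Finset.mul_prod_erase _ _ (Finset.mem_univ i), if_pos (Finset.mem_insert_self _ _)]
        congr 1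
        refine Finset.prod_congr rfl fun j hj => ?_
        simp [Finset.ne_of_mem_erase hj]
      simp only [Matrix.diagonal_apply_eq, hprod, hprod']
      by_cases hr0 : r = 0
      · simp [hr0]
      -- When the other factors do not vanish, no other mode exceeds its occupation in `s`, so
      -- refilling mode `i` up to `s i` stays below the cutoff.
      have hle : ∀ j, j ≠ i → p.1 j ≤ s.1 j := by
        intro j hj
        have h := Finset.prod_ne_zero_iff.1 hr0 j (by simp [hj])
        split_ifs at h with h1 h2
        · by_contra hlt
          rw [survivalProb, Nat.choose_eq_zero_of_lt (by omega)] at h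
          simp at h
        · exact h2.le
        · exact absurd rfl h
      by_cases hi : p.1 i ≤ s.1 i
      · have hs : ∑ j, p.1 j + (s.1 i - p.1 i) ≤ K := by
          refine le_trans ?_ s.2
          rw [← Finset.add_sum_erase _ _ (Finset.mem_univ i),
            ← Finset.add_sum_erase _ s.1 (Finset.mem_univ i)]
          have := Finset.sum_le_sum (s := Finset.univ.erase i) fun j hj =>
            hle j (Finset.ne_of_mem_erase hj)
          omega
        rw [Finset.sum_eq_single (s.1 i - p.1 i)]
        · rw [dif_pos ⟨hs, hs⟩, if_pos (by omega), mul_right_comm, hw, survivalProb,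
            ← Complex.ofReal_mul, one_mul, Nat.add_sub_cancel' hi, Nat.choose_symm hi]
        · intro k _ hk
          rw [if_neg (by omega)]
          simp
        · intro hk
          exfalso; apply hk
          rw [Finset.mem_range]; omega
      · rw [survivalProb, Nat.choose_eq_zero_of_lt (by omega)]
        rw [Finset.sum_eq_zero]
        · simp
        · intro k _
          rw [if_neg (by omega)]
          simp
    rw [List.map_cons, channel_cons, Element.channel, key, ih _ hl.2]
    · simp [Finset.insert_union, Finset.union_insert]
    · intro j hj
      have : j ≠ i := fun h => hl.1 (h ▸ hj)
      simp [this, hA j (by simp [hj])]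

theorem uniformLoss_single {m K : ℕ} {t : ℝ} (h0 : 0 ≤ t) (h1 : t ≤ 1) (s : Fock m K) :
    uniformLoss K t (Matrix.single s s 1) = Matrix.diagonal fun p : Fock m K =>
      ((∏ i, survivalProb t (s.1 i) (p.1 i) : ℝ) : ℂ) := by
  have h := channel_map_loss_single h0 h1 s ∅ (List.finRange m) (List.nodup_finRange m) (by simp)
  have hs : Matrix.single s s (1 : ℂ) = Matrix.diagonal fun p : Fock m K =>
      ((∏ i, if i ∈ (∅ : Finset (Fin m)) then survivalProb t (s.1 i) (p.1 i)
        else if p.1 i = s.1 i then 1 else 0 : ℝ) : ℂ) := by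
    rw [← Matrix.diagonal_single]
    congr 1
    funext p
    by_cases hp : p = s
    · subst hp; simp
    · have : ∃ i, p.1 i ≠ s.1 i := by
        by_contra hcon
        push Not at hcon
        exact hp (Subtype.ext (funext hcon))
      obtain ⟨i, hi⟩ := this
      simp only [Finset.notMem_empty, if_false]
      rw [Finset.prod_eq_zero (Finset.mem_univ i) (by simp [hi])]
      simp [hp]
  rw [uniformLoss, hs, h]
  simp

end Positivity

/-! ## The separable states are diagonal -/

theorem integral_phase_pow (c : ℝ) (a b : ℕ) :
    ∫ x in Set.Icc (0 : ℝ) (2 * Real.pi), (Complex.exp (-(Complex.I * (x : ℂ))) / (c : ℂ)) ^ a *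
        conj (Complex.exp (-(Complex.I * (x : ℂ))) / (c : ℂ)) ^ b =
      if a = b then ((2 * Real.pi : ℝ) : ℂ) / ((c ^ 2) ^ a : ℝ) else 0 := by
  have hpi : (0 : ℝ) ≤ 2 * Real.pi := by positivity
  have hfun : ∀ x : ℝ, (Complex.exp (-(Complex.I * (x : ℂ))) / (c : ℂ)) ^ a *
        conj (Complex.exp (-(Complex.I * (x : ℂ))) / (c : ℂ)) ^ b =
      Complex.exp ((((b : ℤ) - a : ℤ) : ℂ) * Complex.I * x) / (c : ℂ) ^ (a + b) := by
    intro x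
    rw [map_div₀, Complex.conj_ofReal, ← Complex.exp_conj, div_pow, div_pow, div_mul_div_comm,
      ← Complex.exp_nat_mul, ← Complex.exp_nat_mul, ← Complex.exp_add, ← pow_add]
    congr 2
    simp only [map_neg, map_mul, Complex.conj_I, Complex.conj_ofReal]
    push_cast
    ring
  simp only [hfun]
  rw [integral_Icc_eq_integral_Ioc, ← intervalIntegral.integral_of_le hpi,
    intervalIntegral.integral_div]
  split_ifs with h
  · subst h
    simp [← two_mul, pow_mul]
  · have hc : (((b : ℤ) - a : ℤ) : ℂ) * Complex.I ≠ 0 := by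
      refine mul_ne_zero ?_ Complex.I_ne_zero
      rw [Int.cast_ne_zero]
      omega
    rw [integral_exp_mul_complex hc]
    have : (((b : ℤ) - a : ℤ) : ℂ) * Complex.I * ((2 * Real.pi : ℝ) : ℂ) =
        (((b : ℤ) - a : ℤ) : ℂ) * (2 * Real.pi * Complex.I) := by push_cast; ring
    rw [this, Complex.exp_int_mul_two_pi_mul_I]
    simp

theorem restrict_Icc_pi (n : ℕ) :
    (volume : Measure (Fin n → ℝ)).restrict (Set.Icc (0 : Fin n → ℝ) (fun _ => 2 * Real.pi)) =
      Measure.pi fun _ => (volume : Measure ℝ).restrict (Set.Icc 0 (2 * Real.pi)) := by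
  rw [← Measure.restrict_pi_pi, Set.pi_univ_Icc]
  rfl

/-- Fubini and the orthogonality of characters in each phase. Modes beyond the first `n` carry
amplitude zero and contribute powers of `0`, which survive only for exponent `0`. -/
theorem integral_monomialEval_phaseState {m n : ℕ} (hnm : n ≤ m) (p q : Fin m → ℕ) :
    ∫ φ in Set.Icc (0 : Fin n → ℝ) (fun _ => 2 * Real.pi),
        monomialEval (phaseState m n φ) p * conj (monomialEval (phaseState m n φ) q) =
      if p = q ∧ ∀ i : Fin m, n ≤ i.1 → p i = 0 then
        ((2 * Real.pi) ^ n / (n : ℝ) ^ ∑ i, p i : ℝ) else 0 := by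
  obtain ⟨r, rfl⟩ := Nat.exists_eq_add_of_le hnm
  have hfun : ∀ φ : Fin n → ℝ,
      monomialEval (phaseState (n + r) n φ) p * conj (monomialEval (phaseState (n + r) n φ) q) =
      (∏ k : Fin n, (Complex.exp (-(Complex.I * (φ k : ℂ))) / (Real.sqrt n : ℂ)) ^
          p (Fin.castAdd r k) *
        conj (Complex.exp (-(Complex.I * (φ k : ℂ))) / (Real.sqrt n : ℂ)) ^ q (Fin.castAdd r k)) *
      ∏ k : Fin r, ((0 : ℂ) ^ p (Fin.natAdd n k) * (0 : ℂ) ^ q (Fin.natAdd n k)) := by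
    intro φ
    simp only [monomialEval, map_prod, map_pow, ← Finset.prod_mul_distrib]
    rw [Fin.prod_univ_add]
    congr 1
    · refine Finset.prod_congr rfl fun k _ => ?_
      simp [phaseState]
    · refine Finset.prod_congr rfl fun k _ => ?_
      simp [phaseState]
  simp only [hfun]
  rw [integral_mul_const, restrict_Icc_pi, integral_fintype_prod_eq_prod (fun k (x : ℝ) =>
    (Complex.exp (-(Complex.I * (x : ℂ))) / (Real.sqrt n : ℂ)) ^ p (Fin.castAdd r k) *
        conj (Complex.exp (-(Complex.I * (x : ℂ))) / (Real.sqrt n : ℂ)) ^ q (Fin.castAdd r k))]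
  simp only [integral_phase_pow, Real.sq_sqrt (Nat.cast_nonneg n)]
  split_ifs with h
  · obtain ⟨rfl, h⟩ := h
    have hz : ∀ k : Fin r, p (Fin.natAdd n k) = 0 := fun k => h _ (by simp)
    simp only [if_true, hz]
    rw [Fin.sum_univ_add]
    simp only [hz, Finset.sum_const_zero, add_zero, Finset.prod_div_distrib]
    simp [Finset.prod_pow_eq_pow_sum]
  · by_cases hp : ∀ k : Fin r, p (Fin.natAdd n k) = 0 ∧ q (Fin.natAdd n k) = 0
    · have : ∃ k : Fin n, p (Fin.castAdd r k) ≠ q (Fin.castAdd r k) := by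
        by_contra hcon
        push Not at hcon
        apply h
        refine ⟨?_, ?_⟩
        · funext i
          refine Fin.addCases hcon (fun k => ?_) i
          rw [(hp k).1, (hp k).2]
        · intro i
          refine Fin.addCases (fun k hk => ?_) (fun k _ => (hp k).1) i
          have := k.2
          simp at hk
          omega
      obtain ⟨k, hk⟩ := this
      rw [Finset.prod_eq_zero (Finset.mem_univ k) (if_neg hk), zero_mul,
        Complex.ofReal_zero]
    · push Not at hp
      obtain ⟨k, hk⟩ := hp
      have hz : (0 : ℂ) ^ p (Fin.natAdd n k) * (0 : ℂ) ^ q (Fin.natAdd n k) = 0 := by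
        by_cases h0 : p (Fin.natAdd n k) = 0
        · rw [zero_pow (hk h0), mul_zero]
        · rw [zero_pow h0, zero_mul]
      rw [Finset.prod_eq_zero (Finset.mem_univ k) hz, mul_zero, Complex.ofReal_zero]

/-- The diagonal entries of `sepState`. -/
def sepWeight {m : ℕ} (n l : ℕ) (p : Fin m → ℕ) : ℝ :=
  if ∑ i, p i = l ∧ ∀ i : Fin m, n ≤ i.1 → p i = 0 then
    l.factorial / (occFactorial p * (n : ℝ) ^ l) else 0

theorem sepState_eq_diagonal {m n : ℕ} (hnm : n ≤ m) (l : ℕ) :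
    sepState m n l = Matrix.diagonal fun p : Fock m n => (sepWeight n l p.1 : ℂ) := by
  have h1 : (Real.sqrt l.factorial : ℂ) * (Real.sqrt l.factorial : ℂ) = l.factorial := by
    rw [← Complex.ofReal_mul, Real.mul_self_sqrt (Nat.cast_nonneg _)]; simp
  ext p q
  have hfun : ∀ φ : Fin n → ℝ,
      productVec n (phaseState m n φ) l p * conj (productVec n (phaseState m n φ) l q) =
      (if ∑ i, p.1 i = l ∧ ∑ i, q.1 i = l then (l.factorial : ℂ) /
        ((Real.sqrt (occFactorial p.1) : ℂ) * (Real.sqrt (occFactorial q.1) : ℂ)) else 0) *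
      (monomialEval (phaseState m n φ) p.1 * conj (monomialEval (phaseState m n φ) q.1)) := by
    intro φ
    rw [productVec_eq_coherent, productVec_eq_coherent, coherent, coherent]
    by_cases hp : ∑ i, p.1 i = l
    · by_cases hq : ∑ i, q.1 i = l
      · rw [if_pos hp, if_pos hq, if_pos ⟨hp, hq⟩, ← h1]
        simp only [map_mul, map_div₀, Complex.conj_ofReal]
        ring
      · simp [hq]
    · simp [hp]
  have h2pi : (((2 * Real.pi) ^ n : ℝ) : ℂ) ≠ 0 := by
    have : (2 * Real.pi) ^ n ≠ 0 := by positivity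
    exact_mod_cast this
  rw [sepState]
  simp only [hfun]
  rw [integral_const_mul, integral_monomialEval_phaseState hnm]
  by_cases hpq : p = q
  · subst hpq
    rw [Matrix.diagonal_apply_eq, sepWeight]
    simp only [and_self, true_and, sqrt_occFactorial_mul_self]
    by_cases hp : ∑ i, p.1 i = l
    · by_cases hs : ∀ i : Fin m, n ≤ i.1 → p.1 i = 0
      · rw [if_pos hp, if_pos hs, if_pos ⟨hp, hs⟩, hp]
        push_cast at h2pi ⊢
        field_simp
      · simp [hs]
    · simp [hp]
  · have hpq' : p.1 ≠ q.1 := fun h => hpq (Subtype.ext h)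
    rw [Matrix.diagonal_apply_ne _ hpq]
    simp [hpq']

/-! ## The distance between the separable mixture and the lossy Fock state -/

/-- The multinomial expansion of `n ^ l = (1 + ⋯ + 1) ^ l`, divided by `n ^ l`. -/
theorem sum_sepWeight {m n l : ℕ} (hnm : n ≤ m) (hl : l ≤ n) :
    ∑ p : Fock m n, sepWeight n l p.1 = 1 := by
  have h := sum_pow_eq_sum_fock (fun i : Fin m => if i.1 < n then (1 : ℂ) else 0) hl
  have hc : (∑ i : Fin m, if i.1 < n then (1 : ℂ) else 0) = n := by
    rw [← Finset.sum_filter, Finset.sum_const, Fin.card_filter_val_lt, min_eq_right hnm]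
    simp
  rw [hc] at h
  have hn : ((n : ℂ) ^ l) ≠ 0 := by
    rcases Nat.eq_zero_or_pos n with rfl | hn
    · rw [Nat.le_zero.1 hl, pow_zero]; exact one_ne_zero
    · exact pow_ne_zero _ (by exact_mod_cast hn.ne')
  have h' : ((∑ p : Fock m n, sepWeight n l p.1 : ℝ) : ℂ) = 1 := by
    rw [← div_self hn]
    nth_rw 1 [h]
    rw [Finset.sum_div]
    push_cast
    refine Finset.sum_congr rfl fun p _ => ?_
    have hprod : (∏ i : Fin m, (if i.1 < n then (1 : ℂ) else 0) ^ p.1 i) =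
        if ∀ i : Fin m, n ≤ i.1 → p.1 i = 0 then 1 else 0 := by
      split_ifs with hs
      · refine Finset.prod_eq_one fun i _ => ?_
        by_cases hi : i.1 < n
        · simp [hi]
        · simp [hs i (by omega)]
      · push Not at hs
        obtain ⟨i, hi, hpi⟩ := hs
        exact Finset.prod_eq_zero (Finset.mem_univ i) (by
          rw [if_neg (by omega), zero_pow hpi])
    rw [hprod, sepWeight]
    by_cases hp : ∑ i, p.1 i = l
    · by_cases hs : ∀ i : Fin m, n ≤ i.1 → p.1 i = 0
      · rw [if_pos ⟨hp, hs⟩, if_pos hp, if_pos hs]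
        push_cast
        rw [smul_eq_mul, mul_one, div_div]
      · rw [if_neg fun h => hs h.2, if_pos hp, if_neg hs]; simp
    · rw [if_neg fun h => hp h.1, if_neg hp]; simp
  exact_mod_cast h'

/-- Collision-free occupations are indicator functions of subsets of the first `n` modes, so they
are counted by cardinality. -/
theorem sum_fock_le_standardOcc {m n : ℕ} (hnm : n ≤ m) {M : Type*} [AddCommMonoid M]
    (f : ℕ → M) :
    ∑ p : Fock m n with ∀ i, p.1 i ≤ (standardOcc m n).1 i, f (∑ i, p.1 i) =
      ∑ l ∈ Finset.range (n + 1), n.choose l • f l := by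
  set F : Finset (Fin m) := Finset.univ.filter fun i => i.1 < n
  have hF : F.card = n := by
    simp only [F]
    rw [Fin.card_filter_val_lt, min_eq_right hnm]
  have h := Finset.sum_powerset_apply_card f (x := F)
  rw [hF] at h
  rw [← h]
  symm
  have hcard : ∀ S : Finset (Fin m), ∑ i, (if i ∈ S then 1 else 0) = S.card := by
    intro S; simp
  refine Finset.sum_bij (fun S hS => ⟨fun i => if i ∈ S then 1 else 0, by
    rw [hcard, ← hF]; exact Finset.card_le_card (Finset.mem_powerset.1 hS)⟩) ?_ ?_ ?_ ?_
  · intro S hS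
    rw [Finset.mem_filter]
    refine ⟨Finset.mem_univ _, fun i => ?_⟩
    simp only [standardOcc]
    by_cases hi : i ∈ S
    · have := Finset.mem_filter.1 (Finset.mem_powerset.1 hS hi)
      simp [hi, this.2]
    · simp [hi]
  · intro S _ S' _ hSS
    ext i
    have := congrFun (congrArg Subtype.val hSS) i
    by_cases h1 : i ∈ S <;> by_cases h2 : i ∈ S' <;> simp_all
  · intro p hp
    have hp' := (Finset.mem_filter.1 hp).2
    simp only [standardOcc] at hp'
    refine ⟨Finset.univ.filter fun i => p.1 i = 1, ?_, ?_⟩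
    · rw [Finset.mem_powerset]
      intro i hi
      have h1 := (Finset.mem_filter.1 hi).2
      have h2 := hp' i
      simp only [F, Finset.mem_filter, Finset.mem_univ, true_and]
      by_contra hcon
      rw [if_neg hcon] at h2
      omega
    · apply Subtype.ext
      funext i
      have h2 := hp' i
      simp only [Finset.mem_filter, Finset.mem_univ, true_and]
      split_ifs at h2 ⊢ <;> omega
  · intro S _
    simp

theorem prod_survivalProb_standardOcc {m n : ℕ} (t : ℝ) (p : Fock m n) :
    ∏ i, survivalProb t ((standardOcc m n).1 i) (p.1 i) =
      if ∀ i, p.1 i ≤ (standardOcc m n).1 i then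
        t ^ (∑ i, p.1 i) * (1 - t) ^ (∑ i, (standardOcc m n).1 i - ∑ i, p.1 i) else 0 := by
  split_ifs with h
  · rw [← Finset.sum_tsub_distrib _ fun i _ => h i, ← Finset.prod_pow_eq_pow_sum,
      ← Finset.prod_pow_eq_pow_sum, ← Finset.prod_mul_distrib]
    refine Finset.prod_congr rfl fun i _ => ?_
    have hc : ((standardOcc m n).1 i).choose (p.1 i) = 1 := by
      have h1 : (standardOcc m n).1 i ≤ 1 := by
        simp only [standardOcc]; split_ifs <;> omega
      have h2 := h i
      interval_cases h3 : (standardOcc m n).1 i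
      · simp [Nat.le_zero.1 h2]
      · interval_cases h4 : p.1 i <;> rfl
    rw [survivalProb, hc, Nat.cast_one, one_mul]
  · push Not at h
    obtain ⟨i, hi⟩ := h
    exact Finset.prod_eq_zero (Finset.mem_univ i) (by
      rw [survivalProb, Nat.choose_eq_zero_of_lt hi]; simp)

theorem sum_standardOcc {m n : ℕ} (hnm : n ≤ m) : ∑ i, (standardOcc m n).1 i = n := by
  simp only [standardOcc]
  rw [Finset.sum_boole, Fin.card_filter_val_lt, min_eq_right hnm]
  rfl

/-- The diagonal entries of the difference of the separable mixture and the lossy Fock state. -/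
def sepDiff {m : ℕ} (n : ℕ) (t : ℝ) (p : Fock m n) : ℝ :=
  (∑ l ∈ Finset.range (n + 1), ((n.choose l : ℝ) * t ^ l * (1 - t) ^ (n - l)) *
    sepWeight n l p.1) - ∏ i, survivalProb t ((standardOcc m n).1 i) (p.1 i)

theorem sepMixture_sub_uniformLoss {m n : ℕ} (hnm : n ≤ m) {t : ℝ} (h0 : 0 ≤ t) (h1 : t ≤ 1) :
    sepMixture m n t - uniformLoss n t (inputState m n) =
      Matrix.diagonal fun p => (sepDiff n t p : ℂ) := by
  rw [sepMixture, inputState, uniformLoss_single h0 h1]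
  simp only [sepState_eq_diagonal hnm]
  ext p q
  rw [Matrix.sub_apply, Matrix.sum_apply]
  simp only [Matrix.smul_apply, Matrix.diagonal_apply, sepDiff]
  split_ifs
  · push_cast; rfl
  · simp

theorem factorial_div_le_one {n l : ℕ} (hl : l ≤ n) :
    (n.factorial : ℝ) / ((n : ℝ) ^ l * ((n - l).factorial : ℝ)) ≤ 1 := by
  have h : (n.factorial : ℝ) = n.descFactorial l * (n - l).factorial := by
    rw [← Nat.factorial_mul_descFactorial hl]; push_cast; ring
  have h2 : ((n.descFactorial l : ℕ) : ℝ) ≤ (n : ℝ) ^ l := by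
    exact_mod_cast Nat.descFactorial_le_pow n l
  rw [h]
  apply div_le_one_of_le₀ _ (by positivity)
  gcongr

theorem sum_sepDiff {m n : ℕ} (hnm : n ≤ m) (t : ℝ) : ∑ p : Fock m n, sepDiff n t p = 0 := by
  simp only [sepDiff, Finset.sum_sub_distrib, prod_survivalProb_standardOcc, sum_standardOcc hnm]
  rw [Finset.sum_comm, ← Finset.sum_filter,
    sum_fock_le_standardOcc hnm (fun l => t ^ l * (1 - t) ^ (n - l)), sub_eq_zero]
  refine Finset.sum_congr rfl fun l hl => ?_
  rw [← Finset.mul_sum, sum_sepWeight hnm (Nat.lt_succ_iff.1 (Finset.mem_range.1 hl)),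
    nsmul_eq_mul]
  ring

/-- The sign is known: the difference is nonpositive on collision-free outcomes, by the birthday
probability, and nonnegative elsewhere, where the lossy Fock state has no weight. As the total is
zero, half the `ℓ¹` norm is the mass of the negative part. -/
theorem abs_sepDiff {m n : ℕ} (hnm : n ≤ m) {t : ℝ} (h0 : 0 ≤ t) (h1 : t ≤ 1) (p : Fock m n) :
    |sepDiff n t p| = sepDiff n t p +
      2 * if ∀ i, p.1 i ≤ (standardOcc m n).1 i then
        t ^ (∑ i, p.1 i) * (1 - t) ^ (n - ∑ i, p.1 i) *
          (1 - (n.factorial : ℝ) / ((n : ℝ) ^ (∑ i, p.1 i) * ((n - ∑ i, p.1 i).factorial : ℝ)))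
        else 0 := by
  have h1' : 0 ≤ 1 - t := by linarith
  have hw : ∀ l, 0 ≤ sepWeight n l p.1 := by
    intro l; unfold sepWeight; split_ifs <;> positivity
  split_ifs with h
  · have hocc : occFactorial p.1 = 1 := by
      refine Finset.prod_eq_one fun i _ => ?_
      have h2 : (standardOcc m n).1 i ≤ 1 := by
        simp only [standardOcc]; split_ifs <;> omega
      have h3 := (h i).trans h2
      interval_cases p.1 i <;> rfl
    have hsupp : ∀ i : Fin m, n ≤ i.1 → p.1 i = 0 := by
      intro i hi
      have h2 := h i
      simp only [standardOcc] at h2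
      rw [if_neg (by omega)] at h2
      omega
    have hval : sepDiff n t p = - (t ^ (∑ i, p.1 i) * (1 - t) ^ (n - ∑ i, p.1 i) *
          (1 - (n.factorial : ℝ) / ((n : ℝ) ^ (∑ i, p.1 i) *
            ((n - ∑ i, p.1 i).factorial : ℝ)))) := by
      rw [sepDiff, prod_survivalProb_standardOcc, if_pos h, sum_standardOcc hnm,
        Finset.sum_eq_single (∑ i, p.1 i)]
      · have hch : (n.choose (∑ i, p.1 i) : ℝ) * (∑ i, p.1 i).factorial *
            (n - ∑ i, p.1 i).factorial = n.factorial := by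
          exact_mod_cast Nat.choose_mul_factorial_mul_factorial p.2
        have hf : ((n - ∑ i, p.1 i).factorial : ℝ) ≠ 0 := by
          exact_mod_cast (n - ∑ i, p.1 i).factorial_ne_zero
        rw [sepWeight, if_pos ⟨rfl, hsupp⟩, hocc, ← hch]
        field_simp
        push_cast
        ring
      · intro l _ hl
        rw [sepWeight, if_neg fun hh => hl hh.1.symm, mul_zero]
      · intro hp
        exact absurd (Finset.mem_range.2 (Nat.lt_succ_of_le p.2)) hp
    have hnonneg : 0 ≤ t ^ (∑ i, p.1 i) * (1 - t) ^ (n - ∑ i, p.1 i) *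
          (1 - (n.factorial : ℝ) / ((n : ℝ) ^ (∑ i, p.1 i) *
            ((n - ∑ i, p.1 i).factorial : ℝ))) := by
      have := factorial_div_le_one p.2
      have h2 : 0 ≤ 1 - (n.factorial : ℝ) / ((n : ℝ) ^ (∑ i, p.1 i) *
            ((n - ∑ i, p.1 i).factorial : ℝ)) := by linarith
      positivity
    rw [abs_of_nonpos (by rw [hval]; linarith), hval]
    ring
  · rw [mul_zero, add_zero, abs_of_nonneg]
    rw [sepDiff, prod_survivalProb_standardOcc, if_neg h, sub_zero]
    exact Finset.sum_nonneg fun l _ => mul_nonneg (by positivity) (hw l)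

theorem sum_abs_sepDiff {m n : ℕ} (hnm : n ≤ m) {t : ℝ} (h0 : 0 ≤ t) (h1 : t ≤ 1) :
    (1 / 2) * ∑ p : Fock m n, |sepDiff n t p| = ∑ l ∈ Finset.range (n + 1),
      (n.choose l : ℝ) * t ^ l * (1 - t) ^ (n - l) *
        (1 - (n.factorial : ℝ) / ((n : ℝ) ^ l * ((n - l).factorial : ℝ))) := by
  simp only [abs_sepDiff hnm h0 h1, Finset.sum_add_distrib, sum_sepDiff hnm, ← Finset.mul_sum]
  rw [← Finset.sum_filter, sum_fock_le_standardOcc hnm (fun l => t ^ l * (1 - t) ^ (n - l) *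
    (1 - (n.factorial : ℝ) / ((n : ℝ) ^ l * ((n - l).factorial : ℝ))))]
  rw [zero_add, ← mul_assoc, one_div, inv_mul_cancel₀ two_ne_zero, one_mul]
  refine Finset.sum_congr rfl fun l _ => ?_
  rw [nsmul_eq_mul]
  ring

theorem sepDist_eq {m n : ℕ} (hnm : n ≤ m) {t : ℝ} (h0 : 0 ≤ t) (h1 : t ≤ 1) :
    sepDist m n t = ∑ l ∈ Finset.range (n + 1),
      (n.choose l : ℝ) * t ^ l * (1 - t) ^ (n - l) *
        (1 - (n.factorial : ℝ) / ((n : ℝ) ^ l * ((n - l).factorial : ℝ))) := by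
  rw [sepDist, traceDist_of_sub_eq_diagonal (sepMixture_sub_uniformLoss hnm h0 h1),
    sum_abs_sepDiff hnm h0 h1]

/-- The union bound over the `l(l-1)/2` pairs: the particle added to `l` others collides with
probability at most `l / n`. -/
theorem one_sub_factorial_div_le {n l : ℕ} (hn : 0 < n) (hl : l ≤ n) :
    1 - (n.factorial : ℝ) / ((n : ℝ) ^ l * ((n - l).factorial : ℝ)) ≤
      (l : ℝ) * (l - 1) / (2 * n) := by
  have hn' : (0 : ℝ) < n := by exact_mod_cast hn
  induction l with
  | zero =>
    have : (n.factorial : ℝ) ≠ 0 := by exact_mod_cast n.factorial_ne_zero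
    simp [this]
  | succ l ih =>
    have ih' := ih (by omega)
    have hle := factorial_div_le_one (n := n) (l := l) (by omega)
    set x := (n.factorial : ℝ) / ((n : ℝ) ^ l * ((n - l).factorial : ℝ)) with hx
    have hstep : (n.factorial : ℝ) / ((n : ℝ) ^ (l + 1) * ((n - (l + 1)).factorial : ℝ)) =
        x * ((n - l) / n) := by
      have hfac : ((n - l).factorial : ℝ) = (n - l) * (n - (l + 1)).factorial := by
        rw [show n - l = n - (l + 1) + 1 by omega, Nat.factorial_succ]
        push_cast
        rw [Nat.cast_sub hl]
        push_cast
        ring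
      have hnl : ((n : ℝ) - l) ≠ 0 := by
        have : ((l + 1 : ℕ) : ℝ) ≤ n := by exact_mod_cast hl
        push_cast at this
        linarith
      have hf : ((n - (l + 1)).factorial : ℝ) ≠ 0 := by
        exact_mod_cast (n - (l + 1)).factorial_ne_zero
      rw [hx, hfac, pow_succ]
      field_simp
    rw [hstep]
    have h1 : x * ((n - l) / n) = x - x * (l / n) := by field_simp
    have h2 : x * ((l : ℝ) / n) ≤ l / n := mul_le_of_le_one_left (by positivity) hle
    have h3 : ((l + 1 : ℕ) : ℝ) * ((l + 1 : ℕ) - 1) / (2 * n) =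
        (l : ℝ) * (l - 1) / (2 * n) + l / n := by
      push_cast
      field_simp
      ring
    rw [h1, h3]
    linarith

theorem sepDist_le {m n : ℕ} (hnm : n ≤ m) {t : ℝ} (h0 : 0 ≤ t) (h1 : t ≤ 1) :
    sepDist m n t ≤ t ^ 2 * n / 2 + t * (1 - t) / 2 := by
  have h1' : 0 ≤ 1 - t := by linarith
  rw [sepDist_eq hnm h0 h1]
  rcases Nat.eq_zero_or_pos n with rfl | hn
  · simp; positivity
  have hn' : (0 : ℝ) < n := by exact_mod_cast hn
  -- The second factorial moment of the binomial distribution.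
  have hmom : ∑ l ∈ Finset.range (n + 1), (n.choose l : ℝ) * t ^ l * (1 - t) ^ (n - l) *
      ((l : ℝ) * (l - 1)) = n * (n - 1) * t ^ 2 := by
    have h := congrArg (Polynomial.eval t) (bernsteinPolynomial.sum_mul_smul ℝ n)
    simp only [Polynomial.eval_finsetSum, nsmul_eq_mul, bernsteinPolynomial, Polynomial.eval_mul,
      Polynomial.eval_natCast, Polynomial.eval_pow, Polynomial.eval_X, Polynomial.eval_sub,
      Polynomial.eval_one] at h
    have hcast : ∀ k : ℕ, ((k * (k - 1) : ℕ) : ℝ) = (k : ℝ) * (k - 1) := by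
      intro k
      cases k <;> simp
    simp only [hcast] at h
    rw [← h]
    exact Finset.sum_congr rfl fun l _ => by ring
  calc _ ≤ ∑ l ∈ Finset.range (n + 1), (n.choose l : ℝ) * t ^ l * (1 - t) ^ (n - l) *
        ((l : ℝ) * (l - 1) / (2 * n)) := by
        refine Finset.sum_le_sum fun l hl => ?_
        exact mul_le_mul_of_nonneg_left
          (one_sub_factorial_div_le hn (Nat.lt_succ_iff.1 (Finset.mem_range.1 hl)))
          (by positivity)
    _ = (n * (n - 1) * t ^ 2) / (2 * n) := by
        rw [← hmom, Finset.sum_div]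
        exact Finset.sum_congr rfl fun l _ => by ring
    _ = t ^ 2 * n / 2 - t ^ 2 / 2 := by field_simp
    -- There is slack: the claimed bound exceeds the one obtained by `t / 2`.
    _ ≤ _ := by nlinarith

theorem tvDist_channel_le_sepDist {m n : ℕ} (hnm : n ≤ m) {η t : ℝ} (hη0 : 0 ≤ η) (hη1 : η ≤ 1)
    (h0 : 0 ≤ t) (h1 : t ≤ 1) (L : List (Element m)) :
    tvDist (outputDist (channel n η L (uniformLoss n t (inputState m n))))
      (outputDist (channel n η L (sepMixture m n t))) ≤ sepDist m n t := by
  rw [tvDist_comm, sepDist, traceDist_of_sub_eq_diagonal (sepMixture_sub_uniformLoss hnm h0 h1)]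
  exact tvDist_channel_le hη0 hη1 L (sepMixture_sub_uniformLoss hnm h0 h1)

/-! ## Reasoning about programs -/

/-- Started in a store satisfying `P`, the program `c` halts within `B` steps in a store
satisfying `Q`. -/
def Runs (ω : ℕ → unitInterval) (c : Cmd) (B : ℕ) (P Q : Store → Prop) : Prop :=
  ∀ st, P st → ∃ t ≤ B, ∃ st', Exec ω c st t st' ∧ Q st'

theorem Runs.seq {ω : ℕ → unitInterval} {c d : Cmd} {B B' : ℕ} {P Q R : Store → Prop}
    (h : Runs ω c B P Q) (h' : Runs ω d B' Q R) : Runs ω (.seq c d) (B + B') P R := by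
  intro st hst
  obtain ⟨t, ht, st', he, hst'⟩ := h st hst
  obtain ⟨t', ht', st'', he', hst''⟩ := h' st' hst'
  exact ⟨t + t', add_le_add ht ht', st'', .seq he he', hst''⟩

/-- The invariant is indexed by the number of completed rounds. The test is evaluated once more than
the body, which accounts for the last `D`. -/
theorem Runs.loop {ω : ℕ → unitInterval} {b : Test} {c : Cmd} {B D n : ℕ} (I : ℕ → Store → Prop)
    (hD : b.cost = D)
    (hb : ∀ k st, I k st → (b.holds st ↔ k < n))
    (hc : ∀ k, k < n → Runs ω c B (I k) (I (k + 1))) :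
    Runs ω (.loop b c) (n * (D + B) + D) (I 0) (I n) := by
  subst hD
  have main : ∀ r k, k + r = n →
      Runs ω (.loop b c) (r * (b.cost + B) + b.cost) (I k) (I n) := by
    intro r
    induction r with
    | zero =>
      intro k hk st hst
      have hkn : k = n := by omega
      refine ⟨b.cost, by omega, st, .loopDone ?_, hkn ▸ hst⟩
      rw [hb k st hst]
      omega
    | succ r ih =>
      intro k hk st hst
      obtain ⟨t, ht, st', he, hst'⟩ := hc k (by omega) st hst
      obtain ⟨t', ht', st'', he', hst''⟩ := ih (k + 1) (by omega) st' hst'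
      refine ⟨_, ?_, st'', .loopStep ((hb k st hst).2 (by omega)) he he', hst''⟩
      rw [Nat.succ_mul]
      omega
  exact main n 0 (by omega)

@[simp] theorem Store.nat_writeN (st : Store) (a k v a' k' : ℕ) :
    (st.writeN a k v).nat a' k' = if a' = a ∧ k' = k then v else st.nat a' k' := by
  by_cases h : a' = a
  · subst h
    by_cases h' : k' = k
    · subst h'; simp [Store.writeN]
    · simp [Store.writeN, h']
  · simp [Store.writeN, h]

@[simp] theorem Store.real_writeR (st : Store) (a k : ℕ) (v : ℝ) (a' k' : ℕ) :
    (st.writeR a k v).real a' k' = if a' = a ∧ k' = k then v else st.real a' k' := by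
  by_cases h : a' = a
  · subst h
    by_cases h' : k' = k
    · subst h'; simp [Store.writeR]
    · simp [Store.writeR, h']
  · simp [Store.writeR, h]

@[simp] theorem Store.real_writeN (st : Store) (a k v : ℕ) :
    (st.writeN a k v).real = st.real := rfl
@[simp] theorem Store.nat_writeR (st : Store) (a k : ℕ) (v : ℝ) :
    (st.writeR a k v).nat = st.nat := rfl
@[simp] theorem Store.used_writeN (st : Store) (a k v : ℕ) :
    (st.writeN a k v).used = st.used := rfl
@[simp] theorem Store.used_writeR (st : Store) (a k : ℕ) (v : ℝ) :
    (st.writeR a k v).used = st.used := rfl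
@[simp] theorem Store.nat_tick (st : Store) : st.tick.nat = st.nat := rfl
@[simp] theorem Store.real_tick (st : Store) : st.tick.real = st.real := rfl
@[simp] theorem Store.used_tick (st : Store) : st.tick.used = st.used + 1 := rfl

/-! ## The sampling program -/

namespace Sampler

/-- The outer loop counter. -/
abbrev outer : NExp := .get 4 (.const 0)
/-- The inner loop counter. -/
abbrev inner : NExp := .get 4 (.const 1)
/-- The number of modes. -/
abbrev modes : NExp := .get 0 (.const 0)
/-- The number of photons. -/
abbrev photons : NExp := .get 0 (.const 1)
/-- The number of blocks. -/
abbrev blocks : NExp := .get 0 (.const 2)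
/-- Temporary real cells. -/
abbrev temp (k : ℕ) : RExp := .get 11 (.const k)

/-- Draw the amplitude of one mode of the initial single-photon state. -/
def phaseBody : Cmd :=
  .seq (.phase 9 outer 10 outer) <|
  .seq (.setR 9 outer (.div (.get 9 outer) (.sqrt (.ofNat photons)))) <|
  -- The sine changes sign because the phase factor is `exp(-iφ)`.
  .seq (.setR 10 outer (.div (.sub (.const 0) (.get 10 outer)) (.sqrt (.ofNat photons)))) <|
  .setN 4 (.const 0) (.add outer (.const 1))

/-- Real part of a row of the current block applied to the current amplitudes. -/
def rowRe (a : ℕ) : RExp :=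
  -- The two input losses of a block are equal, so they act as a common factor `√η` on its two
  -- outputs.
  .mul (.sqrt (.get 0 (.const 0)))
    (.add (.sub (.mul (.get a outer) (.get 9 (.get 1 outer)))
        (.mul (.get (a + 1) outer) (.get 10 (.get 1 outer))))
      (.sub (.mul (.get (a + 2) outer) (.get 9 (.get 2 outer)))
        (.mul (.get (a + 3) outer) (.get 10 (.get 2 outer)))))

/-- Imaginary part of a row of the current block applied to the current amplitudes. -/
def rowIm (a : ℕ) : RExp :=
  .mul (.sqrt (.get 0 (.const 0)))
    (.add (.add (.mul (.get a outer) (.get 10 (.get 1 outer)))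
        (.mul (.get (a + 1) outer) (.get 9 (.get 1 outer))))
      (.add (.mul (.get (a + 2) outer) (.get 10 (.get 2 outer)))
        (.mul (.get (a + 3) outer) (.get 9 (.get 2 outer)))))

/-- Apply one lossy block to the amplitudes. -/
def blockBody : Cmd :=
  -- All four new values are computed before any old amplitude is overwritten.
  .seq (.setR 11 (.const 3) (rowRe 1)) <|
  .seq (.setR 11 (.const 4) (rowIm 1)) <|
  .seq (.setR 11 (.const 5) (rowRe 5)) <|
  .seq (.setR 11 (.const 6) (rowIm 5)) <|
  .seq (.setR 9 (.get 1 outer) (temp 3)) <|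
  .seq (.setR 10 (.get 1 outer) (temp 4)) <|
  .seq (.setR 9 (.get 2 outer) (temp 5)) <|
  .seq (.setR 10 (.get 2 outer) (temp 6)) <|
  .setN 4 (.const 0) (.add outer (.const 1))

/-- The right end of the detection interval of the current mode. -/
def nextCumul : RExp := .add (temp 1)
  (.add (.mul (.get 9 inner) (.get 9 inner)) (.mul (.get 10 inner) (.get 10 inner)))

/-- Compare the random number of the current photon with the detection interval of one mode. -/
def detectBody : Cmd :=
  .seq (.setR 11 (.const 2) nextCumul) <|
  .seq (.ite (.ltR (temp 0) (temp 1)) .skip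
    (.ite (.ltR (temp 0) (temp 2)) (.setN 3 inner (.add (.get 3 inner) (.const 1))) .skip)) <|
  .seq (.setR 11 (.const 1) (temp 2)) <|
  .setN 4 (.const 1) (.add inner (.const 1))

/-- Prepare the detection of one photon. -/
def drawPhoton : Cmd :=
  .seq (.uniform 11 (.const 0)) <|
  .seq (.setN 4 (.const 1) (.const 0)) <|
  .setR 11 (.const 1) (.const 0)

/-- Advance the outer loop counter. -/
def nextOuter : Cmd := .setN 4 (.const 0) (.add outer (.const 1))

/-- Reset the outer loop counter. -/
def resetOuter : Cmd := .setN 4 (.const 0) (.const 0)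

/-- Detect one photon. -/
def photonBody : Cmd :=
  .seq drawPhoton (.seq (.loop (.ltN inner modes) detectBody) nextOuter)

/-- The sampling program. -/
def program : Cmd :=
  .seq (.loop (.ltN outer photons) phaseBody) <|
  .seq resetOuter <|
  .seq (.loop (.ltN outer blocks) blockBody) <|
  .seq resetOuter <|
  .loop (.ltN outer photons) photonBody

/-- The input data are intact. -/
def Intact {m : ℕ} (n : ℕ) (η : ℝ) (N : Network m) (st : Store) : Prop :=
  (∀ a < 3, ∀ k, st.nat a k = (inputStore n η N).nat a k) ∧
    ∀ a < 9, ∀ k, st.real a k = (inputStore n η N).real a k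

/-- The amplitude stored for a mode. -/
def amp (st : Store) (i : ℕ) : ℂ := ⟨st.real 9 i, st.real 10 i⟩

/-- Sum of the weights of the modes below `j`. -/
def cumul {m : ℕ} (c : Fin m → ℝ) (j : ℕ) : ℝ := ∑ i with i.1 < j, c i

theorem cumul_zero {m : ℕ} (c : Fin m → ℝ) : cumul c 0 = 0 := by simp [cumul]

theorem cumul_succ {m : ℕ} (c : Fin m → ℝ) (j : Fin m) :
    cumul c (j.1 + 1) = cumul c j.1 + c j := by
  unfold cumul
  have : (Finset.univ.filter fun i : Fin m => i.1 < j.1 + 1) =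
      insert j (Finset.univ.filter fun i : Fin m => i.1 < j.1) := by
    ext i
    simp only [Finset.mem_filter, Finset.mem_univ, true_and, Finset.mem_insert, Fin.ext_iff]
    omega
  rw [this, Finset.sum_insert (by simp), add_comm]

open Classical in
/-- The number of the first `n` terms of `u` that lie in the detection interval of mode `j`. -/
def detections {m : ℕ} (c : Fin m → ℝ) (u : ℕ → ℝ) (n : ℕ) (j : Fin m) : ℕ :=
  ((Finset.range n).filter fun k => cumul c j.1 ≤ u k ∧ u k < cumul c (j.1 + 1)).card

open Classical in
theorem detections_succ {m : ℕ} (c : Fin m → ℝ) (u : ℕ → ℝ) (n : ℕ) (j : Fin m) :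
    detections c u (n + 1) j = detections c u n j +
      if cumul c j.1 ≤ u n ∧ u n < cumul c (j.1 + 1) then 1 else 0 := by
  unfold detections
  rw [Finset.range_add_one, Finset.filter_insert]
  split_ifs with h
  · rw [Finset.card_insert_of_notMem (by simp)]
  · rfl

/-! ### Loop invariants and running time of the program -/

section Correctness

variable {m : ℕ} {n : ℕ} {η : ℝ} {N : Network m} {ω : ℕ → unitInterval}

theorem Intact.modes {st : Store} (h : Intact n η N st) : st.nat 0 0 = m := by
  rw [h.1 0 (by norm_num)]; rfl
theorem Intact.photons {st : Store} (h : Intact n η N st) : st.nat 0 1 = n := by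
  rw [h.1 0 (by norm_num)]; rfl
theorem Intact.blocks {st : Store} (h : Intact n η N st) : st.nat 0 2 = N.length := by
  rw [h.1 0 (by norm_num)]; rfl

theorem Intact.writeN {st : Store} (h : Intact n η N st) {a : ℕ} (ha : 3 ≤ a) (k v : ℕ) :
    Intact n η N (st.writeN a k v) := by
  refine ⟨fun a' ha' k' => ?_, h.2⟩
  rw [Store.nat_writeN, if_neg (by omega), h.1 a' ha']

theorem Intact.writeR {st : Store} (h : Intact n η N st) {a : ℕ} (ha : 9 ≤ a) (k : ℕ) (v : ℝ) :
    Intact n η N (st.writeR a k v) := by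
  refine ⟨h.1, fun a' ha' k' => ?_⟩
  rw [Store.real_writeR, if_neg (by omega), h.2 a' ha']

theorem Intact.tick {st : Store} (h : Intact n η N st) : Intact n η N st.tick := h

/-- Invariant of the first loop. -/
def PhaseInv {m : ℕ} (n : ℕ) (η : ℝ) (N : Network m) (ω : ℕ → unitInterval) (k : ℕ)
    (st : Store) : Prop :=
  Intact n η N st ∧ (∀ i, st.nat 3 i = 0) ∧ st.nat 4 0 = k ∧ st.used = k ∧
    ∀ i, amp st i = if i < k then
      Complex.exp (-(Complex.I * ((2 * Real.pi * (ω i : ℝ) : ℝ) : ℂ))) / (Real.sqrt n : ℂ) else 0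

theorem runs_phaseBody (k : ℕ) :
    Runs ω phaseBody 40 (PhaseInv n η N ω k) (PhaseInv n η N ω (k + 1)) := by
  rintro st ⟨hI, h3, h4, hu, ha⟩
  refine ⟨_, ?_, _, .seq (.phase _ _ _ _ _) (.seq (.setR _ _ _ _) (.seq (.setR _ _ _ _)
    (.setN _ _ _ _))), ?_⟩
  · simp [NExp.cost, RExp.cost]
  · refine ⟨((((hI.writeR (by norm_num) _ _).writeR (by norm_num) _ _).tick.writeR
      (by norm_num) _ _).writeR (by norm_num) _ _).writeN (by norm_num) _ _, ?_, ?_, ?_, ?_⟩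
    · intro i; simp [h3]
    · simp [NExp.eval, h4]
    · simp [hu]
    · intro i
      have hn := hI.photons
      have hi := ha i
      unfold amp at hi ⊢
      simp only [NExp.eval, RExp.eval, h4, hu, hn, Store.nat_writeR, Store.nat_tick,
        Store.real_writeN, Store.real_writeR, Store.real_tick]
      by_cases hik : i = k
      · subst hik
        have hexp : -(Complex.I * ((2 * Real.pi * (ω i : ℝ) : ℝ) : ℂ)) =
            ((-(2 * Real.pi * (ω i : ℝ)) : ℝ) : ℂ) * Complex.I := by push_cast; ring
        rw [if_pos (Nat.lt_succ_self i), hexp]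
        apply Complex.ext
        · rw [Complex.div_ofReal_re, Complex.exp_ofReal_mul_I_re, Real.cos_neg]
          simp
        · rw [Complex.div_ofReal_im, Complex.exp_ofReal_mul_I_im, Real.sin_neg]
          simp
      · have h1 : (i < k + 1) = (i < k) := by
          apply propext; omega
        simp only [hik, and_false, if_false, h1]
        exact hi

/-- Invariant of the second loop: the amplitudes after the first `k` blocks. -/
def BlockInv {m : ℕ} (n : ℕ) (η : ℝ) (N : Network m) (v : Fin m → ℂ) (k : ℕ)
    (st : Store) : Prop :=
  Intact n η N st ∧ (∀ i, st.nat 3 i = 0) ∧ st.nat 4 0 = k ∧ st.used = n ∧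
    ∀ i : Fin m, amp st i = (transfer η (Network.elements (N.take k))).mulVec v i

theorem elements_append (N N' : Network m) :
    Network.elements (N ++ N') = N.elements ++ N'.elements := by
  simp [Network.elements]

theorem transfer_block (g : Beamsplitter m) (v : Fin m → ℂ) (i : Fin m) :
    (transfer η (Network.elements [g])).mulVec v i =
      if i = g.fst then
        (Real.sqrt η : ℂ) * (g.u.1 0 0 * v g.fst + g.u.1 0 1 * v g.snd)
      else if i = g.snd then
        (Real.sqrt η : ℂ) * (g.u.1 1 0 * v g.fst + g.u.1 1 1 * v g.snd)
      else v i := by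
  have h : transfer η (Network.elements [g]) =
      g.matrix * (lossMatrix η g.snd * lossMatrix η g.fst) := by
    simp [Network.elements, transfer, Element.transfer, Matrix.mul_assoc]
  rw [h, ← Matrix.mulVec_mulVec, ← Matrix.mulVec_mulVec]
  have hne := g.ne
  split_ifs with h1 h2
  · subst h1
    rw [g.matrix_mulVec_fst]
    simp only [lossMatrix_mulVec, hne, hne.symm, if_true, if_false]
    ring
  · subst h2
    rw [g.matrix_mulVec_snd]
    simp only [lossMatrix_mulVec, hne, hne.symm, if_true, if_false]
    ring
  · rw [g.matrix_mulVec_of_ne _ h1 h2]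
    simp [lossMatrix_mulVec, h1, h2]

theorem runs_blockBody (v : Fin m → ℂ) (k : ℕ) (hk : k < N.length) :
    Runs ω blockBody 500 (BlockInv n η N v k) (BlockInv n η N v (k + 1)) := by
  rintro st ⟨hI, h3, h4, hu, ha⟩
  refine ⟨_, ?_, _, .seq (.setR _ _ _ _) (.seq (.setR _ _ _ _) (.seq (.setR _ _ _ _)
    (.seq (.setR _ _ _ _) (.seq (.setR _ _ _ _) (.seq (.setR _ _ _ _) (.seq (.setR _ _ _ _)
    (.seq (.setR _ _ _ _) (.setN _ _ _ _)))))))), ?_⟩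
  · simp [NExp.cost, RExp.cost, rowRe, rowIm]
  set g := N[k] with hg
  have hgk : N[k]? = some g := List.getElem?_eq_getElem hk
  have hfst : st.nat 1 k = g.fst.1 := by
    rw [hI.1 1 (by norm_num)]; simp [inputStore, hgk]
  have hsnd : st.nat 2 k = g.snd.1 := by
    rw [hI.1 2 (by norm_num)]; simp [inputStore, hgk]
  have hη : st.real 0 0 = η := by
    rw [hI.2 0 (by norm_num)]; simp [inputStore]
  have u1 : st.real 1 k = (g.u.1 0 0).re := by
    rw [hI.2 1 (by norm_num)]; simp [inputStore, hgk]
  have u2 : st.real 2 k = (g.u.1 0 0).im := by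
    rw [hI.2 2 (by norm_num)]; simp [inputStore, hgk]
  have u3 : st.real 3 k = (g.u.1 0 1).re := by
    rw [hI.2 3 (by norm_num)]; simp [inputStore, hgk]
  have u4 : st.real 4 k = (g.u.1 0 1).im := by
    rw [hI.2 4 (by norm_num)]; simp [inputStore, hgk]
  have u5 : st.real 5 k = (g.u.1 1 0).re := by
    rw [hI.2 5 (by norm_num)]; simp [inputStore, hgk]
  have u6 : st.real 6 k = (g.u.1 1 0).im := by
    rw [hI.2 6 (by norm_num)]; simp [inputStore, hgk]
  have u7 : st.real 7 k = (g.u.1 1 1).re := by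
    rw [hI.2 7 (by norm_num)]; simp [inputStore, hgk]
  have u8 : st.real 8 k = (g.u.1 1 1).im := by
    rw [hI.2 8 (by norm_num)]; simp [inputStore, hgk]
  refine ⟨?_, ?_, ?_, ?_, ?_⟩
  · repeat' first | apply Intact.writeN | apply Intact.writeR
    exacts [hI, by norm_num, by norm_num, by norm_num, by norm_num, by norm_num, by norm_num,
      by norm_num, by norm_num, by norm_num]
  · intro i; simp [h3]
  · simp [NExp.eval, h4]
  · simp [hu]
  · intro i
    have htake : N.take (k + 1) = N.take k ++ [g] := by
      rw [List.take_succ_eq_append_getElem hk]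
    rw [htake, elements_append, transfer_append, ← Matrix.mulVec_mulVec, transfer_block,
      ← ha g.fst, ← ha g.snd, ← ha i]
    have hne : g.fst.1 ≠ g.snd.1 := fun h => g.ne (Fin.ext h)
    simp only [amp, NExp.eval, RExp.eval, rowRe, rowIm, h4, hfst, hsnd, hη, u1, u2, u3, u4, u5, u6,
      u7, u8, Store.nat_writeR, Store.real_writeN, Store.real_writeR]
    norm_num [u1, u2, u3, u4, u5, u6, u7, u8, hη, Fin.ext_iff]
    by_cases hi1 : i.1 = g.fst.1
    · have hi2 : i.1 ≠ g.snd.1 := by omega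
      simp only [hi1, hne, if_true, if_false]
      apply Complex.ext <;> simp
    · by_cases hi2 : i.1 = g.snd.1
      · simp only [hi2, hne.symm, if_true, if_false]
        apply Complex.ext <;> simp
      · simp only [hi1, hi2, if_false]

open Classical in
/-- Invariant of the detection loop. -/
def DetectInv {m : ℕ} (n : ℕ) (η : ℝ) (N : Network m) (w : Fin m → ℂ) (k : ℕ) (u : ℝ)
    (base : Fin m → ℕ) (j : ℕ) (st : Store) : Prop :=
  Intact n η N st ∧ st.nat 4 0 = k ∧ st.nat 4 1 = j ∧ st.used = n + k + 1 ∧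
    (∀ i : Fin m, amp st i = w i) ∧ st.real 11 0 = u ∧
    st.real 11 1 = cumul (fun i => Complex.normSq (w i)) j ∧
    ∀ i : Fin m, st.nat 3 i = base i +
      if i.1 < j ∧ cumul (fun i => Complex.normSq (w i)) i ≤ u ∧
        u < cumul (fun i => Complex.normSq (w i)) (i + 1) then 1 else 0

theorem runs_detectBody (w : Fin m → ℂ) (k : ℕ) (u : ℝ) (base : Fin m → ℕ) (j : ℕ) (hj : j < m) :
    Runs ω detectBody 70 (DetectInv n η N w k u base j) (DetectInv n η N w k u base (j + 1)) := by
  rintro st ⟨hI, h40, h41, hu, ha, hr0, hr1, h3⟩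
  set c : Fin m → ℝ := fun i => Complex.normSq (w i) with hc
  have hcum : cumul c (j + 1) = cumul c j + c ⟨j, hj⟩ := cumul_succ c ⟨j, hj⟩
  have hw : c ⟨j, hj⟩ = st.real 9 j * st.real 9 j + st.real 10 j * st.real 10 j := by
    simp only [hc]
    rw [← ha ⟨j, hj⟩, Complex.normSq_apply]
    rfl
  set st₁ : Store := st.writeR 11 2 (cumul c (j + 1)) with hst₁
  -- The random number lies to the left of the interval of mode `j`, inside it, or to its right.
  -- Only the middle case changes a count, and only that of `j`.
  have hmid : ∃ t ≤ 30, ∃ st₂, Exec ω (.ite (.ltR (temp 0) (temp 1)) .skip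
      (.ite (.ltR (temp 0) (temp 2)) (.setN 3 inner (.add (.get 3 inner) (.const 1))) .skip))
      st₁ t st₂ ∧ st₂.real = st₁.real ∧ st₂.used = st₁.used ∧ Intact n η N st₂ ∧
      (∀ i, st₂.nat 4 i = st₁.nat 4 i) ∧
      ∀ i : Fin m, st₂.nat 3 i = base i +
      if i.1 < j + 1 ∧ cumul c i ≤ u ∧ u < cumul c (i + 1) then 1 else 0 := by
    have hI₁ : Intact n η N st₁ := hI.writeR (by norm_num) _ _
    have hother : ∀ i : Fin m, i.1 ≠ j → ((i.1 < j + 1) = (i.1 < j)) := fun i hi => by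
      apply propext; omega
    by_cases h1 : u < cumul c j
    · refine ⟨_, ?_, st₁, .iteTrue ?_ (.skip _), rfl, rfl, hI₁, fun _ => rfl, ?_⟩
      · simp [Test.cost, RExp.cost, NExp.cost]
      · simpa [Test.holds, RExp.eval, NExp.eval, hst₁, hr0, hr1] using h1
      · intro i
        have : st₁.nat 3 i = st.nat 3 i := rfl
        rw [this, h3]
        congr 1
        by_cases hi : i.1 = j
        · rw [if_neg (by omega), if_neg (by rw [hi]; intro h; exact absurd h.2.1 (not_le.2 h1))]
        · simp only [hother i hi]
    · have h1' : ¬ (Test.ltR (temp 0) (temp 1)).holds st₁ := by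
        simpa [Test.holds, RExp.eval, NExp.eval, hst₁, hr0, hr1] using h1
      by_cases h2 : u < cumul c (j + 1)
      · refine ⟨_, ?_, _, .iteFalse h1' (.iteTrue ?_ (.setN _ _ _ _)), rfl, rfl,
          hI₁.writeN (by norm_num) _ _, ?_, ?_⟩
        · simp [Test.cost, RExp.cost, NExp.cost]
        · simpa [Test.holds, RExp.eval, NExp.eval, hst₁, hr0] using h2
        · intro i; simp
        · intro i
          simp only [NExp.eval, Store.nat_writeN, hst₁, Store.nat_writeR, h41, true_and]
          by_cases hi : i.1 = j
          · have := h3 i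
            rw [if_neg (by omega)] at this
            rw [if_pos hi, ← hi, this, hi, if_pos ⟨by omega, not_lt.1 h1, h2⟩]
          · rw [if_neg hi, h3]; simp only [hother i hi]
      · refine ⟨_, ?_, st₁, .iteFalse h1' (.iteFalse ?_ (.skip _)), rfl, rfl, hI₁,
          fun _ => rfl, ?_⟩
        · simp [Test.cost, RExp.cost, NExp.cost]
        · simpa [Test.holds, RExp.eval, NExp.eval, hst₁, hr0] using h2
        · intro i
          have : st₁.nat 3 i = st.nat 3 i := rfl
          rw [this, h3]
          congr 1
          by_cases hi : i.1 = j
          · rw [if_neg (by omega), if_neg (by rw [hi]; intro h; exact absurd h.2.2 h2)]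
          · simp only [hother i hi]
  obtain ⟨t, ht, st₂, he, hreal, hused, hI₂, h4, h3'⟩ := hmid
  have he₁ : Exec ω (.setR 11 (.const 2) nextCumul) st 20 st₁ := by
    have := Exec.setR (ω := ω) st 11 (.const 2) nextCumul
    simp only [nextCumul, NExp.eval, RExp.eval, hr1, h41, ← hw, ← hcum] at this
    exact this
  refine ⟨_, ?_, _, .seq he₁ (.seq he (.seq (.setR _ _ _ _) (.setN _ _ _ _))), ?_⟩
  · simp [RExp.cost, NExp.cost]
    omega
  · refine ⟨(hI₂.writeR (by norm_num) _ _).writeN (by norm_num) _ _, ?_, ?_, ?_, ?_, ?_, ?_, ?_⟩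
    · simp [NExp.eval, h4, hst₁, h40]
    · simp [NExp.eval, h4, hst₁, h41]
    · simp [hused, hst₁, hu]
    · intro i
      simp [amp, hreal, hst₁]
      exact ha i
    · simp [NExp.eval, RExp.eval, hreal, hst₁, hr0]
    · simp [NExp.eval, RExp.eval, hreal, hst₁, hc]
    · intro i
      exact h3' i

/-- Invariant of the third loop: the detections of the first `k` photons. -/
def PhotonInv {m : ℕ} (n : ℕ) (η : ℝ) (N : Network m) (w : Fin m → ℂ) (ω : ℕ → unitInterval)
    (k : ℕ) (st : Store) : Prop :=
  Intact n η N st ∧ st.nat 4 0 = k ∧ st.used = n + k ∧ (∀ i : Fin m, amp st i = w i) ∧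
    ∀ i : Fin m, st.nat 3 i =
      detections (fun i => Complex.normSq (w i)) (fun k => (ω (n + k) : ℝ)) k i

theorem runs_photonBody (w : Fin m → ℂ) (k : ℕ) :
    Runs ω photonBody (20 + ((m * (5 + 70) + 5) + 20)) (PhotonInv n η N w ω k)
      (PhotonInv n η N w ω (k + 1)) := by
  set base : Fin m → ℕ :=
    detections (fun i => Complex.normSq (w i)) (fun k => (ω (n + k) : ℝ)) k with hbase
  -- The phases consumed the first `n` random numbers, so photon `k` uses the one with index `n +
  -- k`.
  refine Runs.seq (Q := DetectInv n η N w k (ω (n + k)) base 0) ?_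
    (Runs.seq (Q := DetectInv n η N w k (ω (n + k)) base m) ?_ ?_)
  · rintro st ⟨hI, h4, hu, ha, h3⟩
    refine ⟨_, ?_, _, .seq (.uniform _ _ _) (.seq (.setN _ _ _ _) (.setR _ _ _ _)), ?_⟩
    · simp [RExp.cost, NExp.cost]
    · refine ⟨((hI.writeR (by norm_num) _ _).tick.writeN (by norm_num) _ _).writeR
        (by norm_num) _ _, ?_, ?_, ?_, ?_, ?_, ?_, ?_⟩
      · simp [NExp.eval, h4]
      · simp [NExp.eval]
      · simp [hu]
      · intro i
        simp [amp]
        exact ha i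
      · simp [NExp.eval, hu]
      · simp [NExp.eval, RExp.eval, cumul_zero]
      · intro i
        simp [NExp.eval, h3, hbase]
  · refine Runs.loop (DetectInv n η N w k (ω (n + k)) base) rfl ?_
      (fun j hj => runs_detectBody w k _ base j hj)
    rintro j st ⟨hI, _, h41, _⟩
    simp [Test.holds, NExp.eval, h41, hI.modes]
  · rintro st ⟨hI, h40, _, hu, ha, _, _, h3⟩
    refine ⟨_, ?_, _, .setN _ _ _ _, ?_⟩
    · simp [NExp.cost]
    · refine ⟨hI.writeN (by norm_num) _ _, ?_, ?_, ?_, ?_⟩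
      · simp [NExp.eval, h40]
      · simp [hu]; ring
      · intro i
        simp [amp]
        exact ha i
      · intro i
        rw [detections_succ]
        simp [NExp.eval, h3, hbase]

/-- The detection probabilities for the drawn phases. -/
def weights (n : ℕ) (η : ℝ) (N : Network m) (φ : Fin n → ℝ) (i : Fin m) : ℝ :=
  Complex.normSq ((transfer η N.elements).mulVec (phaseState m n φ) i)

theorem runs_program :
    Runs ω program ((n * (5 + 40) + 5) + (10 + ((N.length * (5 + 500) + 5) + (10 +
        (n * (5 + (20 + ((m * (5 + 70) + 5) + 20))) + 5)))))
      (fun st => st = inputStore n η N)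
      (fun st => ∀ j : Fin m, st.nat 3 j =
        detections (weights n η N fun k => 2 * Real.pi * (ω k : ℝ))
          (fun k => (ω (n + k) : ℝ)) n j) := by
  set v : Fin m → ℂ := phaseState m n fun k => 2 * Real.pi * (ω k : ℝ) with hv
  set w : Fin m → ℂ := (transfer η N.elements).mulVec v with hw
  refine Runs.seq (Q := PhaseInv n η N ω n) ?_ (Runs.seq (Q := BlockInv n η N v 0) ?_
    (Runs.seq (Q := BlockInv n η N v N.length) ?_ (Runs.seq (Q := PhotonInv n η N w ω 0) ?_ ?_)))
  · have h0 : PhaseInv n η N ω 0 (inputStore n η N) := by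
      refine ⟨⟨fun _ _ _ => rfl, fun _ _ _ => rfl⟩, fun _ => rfl, rfl, rfl, fun i => ?_⟩
      rw [if_neg (by omega)]
      rfl
    have hloop : Runs ω (.loop (.ltN outer photons) phaseBody) (n * (5 + 40) + 5)
        (PhaseInv n η N ω 0) (PhaseInv n η N ω n) := by
      refine Runs.loop (PhaseInv n η N ω) rfl ?_ (fun k _ => runs_phaseBody k)
      rintro k st ⟨hI, _, h4, _⟩
      simp [Test.holds, NExp.eval, h4, hI.photons]
    intro st hst
    subst hst
    exact hloop _ h0
  · rintro st ⟨hI, h3, h4, hu, ha⟩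
    refine ⟨_, ?_, _, .setN _ _ _ _, ?_⟩
    · simp [NExp.cost]
    · refine ⟨hI.writeN (by norm_num) _ _, ?_, ?_, ?_, ?_⟩
      · intro i; simp [h3]
      · simp [NExp.eval]
      · simp [hu]
      · intro i
        have := ha i
        simp only [List.take_zero, Network.elements, List.flatMap_nil, transfer, Matrix.one_mulVec,
          hv, phaseState]
        split_ifs at this ⊢ with h
        · exact this
        · exact this
  · refine Runs.loop (BlockInv n η N v) rfl ?_ (fun k hk => runs_blockBody v k hk)
    rintro k st ⟨hI, _, h4, _⟩
    simp [Test.holds, NExp.eval, h4, hI.blocks]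
  · rintro st ⟨hI, h3, h4, hu, ha⟩
    refine ⟨_, ?_, _, .setN _ _ _ _, ?_⟩
    · simp [NExp.cost]
    · refine ⟨hI.writeN (by norm_num) _ _, ?_, ?_, ?_, ?_⟩
      · simp [NExp.eval]
      · simp [hu]
      · intro i
        have := ha i
        rw [List.take_length] at this
        exact this
      · intro i
        simp [h3, detections]
  · have hloop : Runs ω (.loop (.ltN outer photons) photonBody)
        (n * (5 + (20 + ((m * (5 + 70) + 5) + 20))) + 5)
        (PhotonInv n η N w ω 0) (PhotonInv n η N w ω n) := by
      refine Runs.loop (PhotonInv n η N w ω) rfl ?_ (fun k _ => runs_photonBody w k)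
      rintro k st ⟨hI, h4, _⟩
      simp [Test.holds, NExp.eval, h4, hI.photons]
    intro st hst
    obtain ⟨t, ht, st', he, hst'⟩ := hloop st hst
    exact ⟨t, ht, st', he, hst'.2.2.2.2⟩

/-- A polynomial step bound. -/
def stepBound : Polynomial ℕ := Polynomial.C 1000 * (Polynomial.X + 1) ^ 2

/-- The only nonlinear cost is the product `n * m`, from scanning all modes for each photon; the
constant of `stepBound` is generous. -/
theorem exists_exec_program :
    ∃ t ≤ stepBound.eval (m + n + N.length), ∃ st', Exec ω program (inputStore n η N) t st' ∧
      ∀ j : Fin m, st'.nat 3 j = detections (weights n η N fun k => 2 * Real.pi * (ω k : ℝ))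
        (fun k => (ω (n + k) : ℝ)) n j := by
  obtain ⟨t, ht, st', h⟩ := runs_program (ω := ω) (inputStore n η N) rfl
  refine ⟨t, ht.trans ?_, st', h⟩
  simp only [stepBound, Polynomial.eval_mul, Polynomial.eval_C, Polynomial.eval_pow,
    Polynomial.eval_add, Polynomial.eval_X, Polynomial.eval_one]
  nlinarith [Nat.zero_le (m * n), Nat.zero_le (m * N.length), Nat.zero_le (n * N.length),
    Nat.zero_le (m ^ 2), Nat.zero_le (n ^ 2), Nat.zero_le (N.length ^ 2)]

end Correctness

end Sampler

/-! ## Independent particles and multinomial probabilities -/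

/-- The number of particles found in each mode. -/
def labelCounts {m n : ℕ} (f : Fin n → Option (Fin m)) (j : Fin m) : ℕ :=
  (Finset.univ.filter fun k => f k = some j).card

theorem sum_labelCounts_add {m n : ℕ} (f : Fin n → Option (Fin m)) :
    (Finset.univ.filter fun k => f k = none).card + ∑ j, labelCounts f j = n := by
  have h := Finset.card_eq_sum_card_fiberwise (s := Finset.univ) (t := Finset.univ) (f := f)
    (fun _ _ => Finset.mem_coe.2 (Finset.mem_univ _))
  rw [Finset.card_univ, Fintype.card_fin, Fintype.sum_option] at h
  exact h.symm

/-- Here `creation v` serves as a mere linear form: the power is the generating function of the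
multinomial law, with the constant `c` standing for a lost particle. -/
theorem coeff_creation_add_C_pow {m n : ℕ} (v : Fin m → ℂ) (c : ℂ) (p : Fock m n) :
    ((MvPolynomial.C c + creation v) ^ n).coeff (Finsupp.equivFunOnFinite.symm p.1) =
      n.factorial / ((n - ∑ i, p.1 i).factorial * occFactorial p.1) *
        (monomialEval v p.1 * c ^ (n - ∑ i, p.1 i)) := by
  rw [add_comm, add_pow, MvPolynomial.coeff_sum, Finset.sum_eq_single (∑ i, p.1 i)]
  · have h : creation v ^ (∑ i, p.1 i) * MvPolynomial.C c ^ (n - ∑ i, p.1 i) *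
        (n.choose (∑ i, p.1 i) : MvPolynomial (Fin m) ℂ) =
        MvPolynomial.C (c ^ (n - ∑ i, p.1 i) * n.choose (∑ i, p.1 i)) *
          creation v ^ (∑ i, p.1 i) := by
      simp only [map_mul, map_pow, map_natCast]
      ring
    rw [h, MvPolynomial.coeff_C_mul, coeff_creation_pow, if_pos rfl]
    have hch : (n.choose (∑ i, p.1 i) : ℂ) * (∑ i, p.1 i).factorial *
        (n - ∑ i, p.1 i).factorial = n.factorial := by
      exact_mod_cast Nat.choose_mul_factorial_mul_factorial p.2
    have hf : ((n - ∑ i, p.1 i).factorial : ℂ) ≠ 0 := by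
      exact_mod_cast (n - ∑ i, p.1 i).factorial_ne_zero
    rw [← hch]
    field_simp
  · intro k _ hk
    have h : creation v ^ k * MvPolynomial.C c ^ (n - k) *
        (n.choose k : MvPolynomial (Fin m) ℂ) =
        MvPolynomial.C (c ^ (n - k) * n.choose k) * creation v ^ k := by
      simp only [map_mul, map_pow, map_natCast]
      ring
    rw [h, MvPolynomial.coeff_C_mul, coeff_creation_pow, if_neg hk.symm, mul_zero]
  · intro hp
    exact absurd (Finset.mem_range.2 (Nat.lt_succ_of_le p.2)) hp

/-- One coefficient of `(q none + ∑ j, q (some j) X j) ^ n` computed twice: by expanding into words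
`f`, and by the multinomial formula. -/
theorem sum_prod_labelCounts {m n : ℕ} (q : Option (Fin m) → ℝ)
    (hq : q none = 1 - ∑ j, q (some j)) (p : Fock m n) :
    ∑ f : Fin n → Option (Fin m) with labelCounts f = p.1, ∏ k, q (f k) =
      multinomialProb n (fun j => q (some j)) p.1 := by
  let X : Option (Fin m) → MvPolynomial (Fin m) ℂ := fun o => o.elim 1 MvPolynomial.X
  have hX : ∀ f : Fin n → Option (Fin m), ∏ k, (MvPolynomial.C (q (f k) : ℂ) * X (f k)) =
      MvPolynomial.monomial (Finsupp.equivFunOnFinite.symm (labelCounts f))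
        ((∏ k, q (f k) : ℝ) : ℂ) := by
    intro f
    rw [Finset.prod_mul_distrib, MvPolynomial.monomial_eq, Finsupp.prod_fintype _ _ (by simp)]
    congr 1
    · push_cast; rw [map_prod]
    · rw [← Finset.prod_fiberwise Finset.univ f, Fintype.prod_option]
      rw [Finset.prod_eq_one, one_mul]
      · refine Finset.prod_congr rfl fun j _ => ?_
        rw [Finset.prod_congr rfl (g := fun _ => MvPolynomial.X j), Finset.prod_const]
        · rfl
        · intro k hk
          rw [(Finset.mem_filter.1 hk).2]; rfl
      · intro k hk
        rw [(Finset.mem_filter.1 hk).2]; rfl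
  have hsum : MvPolynomial.C (q none : ℂ) + creation (fun j => (q (some j) : ℂ)) =
      ∑ o, MvPolynomial.C (q o : ℂ) * X o := by
    rw [Fintype.sum_option]
    simp [X, creation]
  have h := coeff_creation_add_C_pow (fun j => (q (some j) : ℂ)) (q none : ℂ) p
  rw [hsum, Fintype.sum_pow, MvPolynomial.coeff_sum] at h
  simp only [hX, MvPolynomial.coeff_monomial, EmbeddingLike.apply_eq_iff_eq] at h
  rw [← Finset.sum_filter] at h
  have h' : ((∑ f : Fin n → Option (Fin m) with labelCounts f = p.1, ∏ k, q (f k) : ℝ) : ℂ) =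
      (multinomialProb n (fun j => q (some j)) p.1 : ℂ) := by
    rw [Complex.ofReal_sum, h, multinomialProb, ← hq, monomialEval]
    push_cast
    ring
  exact_mod_cast h'

theorem measureReal_labelCounts {m n : ℕ} {α : Type*} [MeasurableSpace α] (μ : Measure α)
    [IsProbabilityMeasure μ] (ℓ : α → Option (Fin m)) (hℓ : ∀ o, MeasurableSet (ℓ ⁻¹' {o}))
    (p : Fock m n) :
    (Measure.pi fun _ : Fin n => μ).real {x | labelCounts (fun k => ℓ (x k)) = p.1} =
      multinomialProb n (fun j => μ.real (ℓ ⁻¹' {some j})) p.1 := by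
  have hset : {x : Fin n → α | labelCounts (fun k => ℓ (x k)) = p.1} =
      ⋃ f ∈ (Finset.univ.filter fun f : Fin n → Option (Fin m) => labelCounts f = p.1),
        Set.pi Set.univ fun k => ℓ ⁻¹' {f k} := by
    ext x
    simp only [Set.mem_ofPred_eq, Finset.mem_filter, Finset.mem_univ, true_and, Set.mem_iUnion,
      Set.mem_univ_pi, Set.mem_preimage, Set.mem_singleton_iff, exists_prop]
    constructor
    · intro h
      exact ⟨_, h, fun _ => rfl⟩
    · rintro ⟨f, hf, h⟩
      rw [show (fun k => ℓ (x k)) = f from funext h, hf]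
  have hq : μ.real (ℓ ⁻¹' {none}) = 1 - ∑ j, μ.real (ℓ ⁻¹' {some j}) := by
    have h1 : (1 : ℝ) = ∑ o, μ.real (ℓ ⁻¹' {o}) := by
      have : (Set.univ : Set α) = ⋃ o ∈ (Finset.univ : Finset (Option (Fin m))), ℓ ⁻¹' {o} := by
        ext x; simp
      rw [← probReal_univ (μ := μ), this, measureReal_biUnion_finset]
      · intro o _ o' _ hne
        exact Disjoint.preimage _ (by simpa using hne)
      · exact fun o _ => hℓ o
    rw [h1, Fintype.sum_option]
    ring
  rw [hset, measureReal_biUnion_finset]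
  · rw [← sum_prod_labelCounts (fun o => μ.real (ℓ ⁻¹' {o})) hq]
    refine Finset.sum_congr rfl fun f _ => ?_
    rw [Measure.real, Measure.pi_pi, ENNReal.toReal_prod]
    rfl
  · intro f _ f' _ hne
    rw [Function.onFun, Set.disjoint_left]
    intro x hx hx'
    apply hne
    funext k
    have h1 := hx k (Set.mem_univ k)
    have h2 := hx' k (Set.mem_univ k)
    exact h1.symm.trans h2
  · exact fun f _ => MeasurableSet.univ_pi fun k => hℓ _

namespace Sampler

/-! ## Detection intervals -/

theorem cumul_mono {m : ℕ} {c : Fin m → ℝ} (hc : ∀ i, 0 ≤ c i) : Monotone (cumul c) := by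
  intro a b hab
  refine Finset.sum_le_sum_of_subset_of_nonneg ?_ fun i _ _ => hc i
  intro i hi
  rw [Finset.mem_filter] at hi ⊢
  exact ⟨hi.1, hi.2.trans_le hab⟩

theorem cumul_le_sum {m : ℕ} {c : Fin m → ℝ} (hc : ∀ i, 0 ≤ c i) (j : ℕ) :
    cumul c j ≤ ∑ i, c i :=
  Finset.sum_le_sum_of_subset_of_nonneg (Finset.filter_subset _ _) fun i _ _ => hc i

open Classical in
/-- The mode whose detection interval contains `x`. -/
def detected {m : ℕ} (c : Fin m → ℝ) (x : ℝ) : Option (Fin m) :=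
  if h : ∃ j : Fin m, cumul c j.1 ≤ x ∧ x < cumul c (j.1 + 1) then some h.choose else none

/-- For nonnegative weights the half-open detection intervals are disjoint, so the choice in
`detected` is forced. -/
theorem detected_eq_some_iff {m : ℕ} {c : Fin m → ℝ} (hc : ∀ i, 0 ≤ c i) (x : ℝ) (j : Fin m) :
    detected c x = some j ↔ cumul c j.1 ≤ x ∧ x < cumul c (j.1 + 1) := by
  have huniq : ∀ i j : Fin m, cumul c i.1 ≤ x → x < cumul c (j.1 + 1) → i.1 ≤ j.1 := by
    intro i j hi hj
    by_contra hlt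
    exact absurd (cumul_mono hc (show j.1 + 1 ≤ i.1 by omega)) (not_le.2 (hi.trans_lt hj))
  unfold detected
  split_ifs with h
  · have hs := h.choose_spec
    constructor
    · intro he
      rw [Option.some.injEq] at he
      rw [← he]
      exact hs
    · intro hj
      rw [Option.some.injEq]
      exact Fin.ext (le_antisymm (huniq _ _ hs.1 hj.2) (huniq _ _ hj.1 hs.2))
  · constructor
    · intro he
      cases he
    · intro hj
      exact absurd ⟨j, hj⟩ h

theorem detections_eq_labelCounts {m : ℕ} {c : Fin m → ℝ} (hc : ∀ i, 0 ≤ c i) (u : ℕ → ℝ)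
    (n : ℕ) : detections c u n = labelCounts fun k : Fin n => detected c (u k) := by
  funext j
  unfold detections labelCounts
  simp only [detected_eq_some_iff hc]
  rw [Finset.card_filter, Finset.card_filter, Finset.sum_range]

theorem measurableSet_detected {m : ℕ} {c : Fin m → ℝ} (hc : ∀ i, 0 ≤ c i)
    (o : Option (Fin m)) :
    MeasurableSet ((fun x : unitInterval => detected c (x : ℝ)) ⁻¹' {o}) := by
  have hsome : ∀ j, MeasurableSet ((fun x : unitInterval => detected c (x : ℝ)) ⁻¹' {some j}) := by
    intro j
    have : (fun x : unitInterval => detected c (x : ℝ)) ⁻¹' {some j} =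
        Subtype.val ⁻¹' Set.Ico (cumul c j.1) (cumul c (j.1 + 1)) := by
      ext x
      simp only [Set.mem_preimage, Set.mem_singleton_iff, detected_eq_some_iff hc, Set.mem_Ico]
    rw [this]
    exact measurable_subtype_coe measurableSet_Ico
  cases o with
  | some j => exact hsome j
  | none =>
    have : (fun x : unitInterval => detected c (x : ℝ)) ⁻¹' {none} =
        (⋃ j, (fun x : unitInterval => detected c (x : ℝ)) ⁻¹' {some j})ᶜ := by
      ext x
      simp [Option.eq_none_iff_forall_ne_some]
    rw [this]
    exact (MeasurableSet.iUnion hsome).compl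

/-- A total weight of at most `1` keeps every detection interval inside `[0, 1]`, so its full length
counts. -/
theorem volume_detected {m : ℕ} {c : Fin m → ℝ} (hc : ∀ i, 0 ≤ c i) (hc1 : ∑ i, c i ≤ 1)
    (j : Fin m) :
    (volume : Measure unitInterval).real
      ((fun x : unitInterval => detected c (x : ℝ)) ⁻¹' {some j}) = c j := by
  have hset : (fun x : unitInterval => detected c (x : ℝ)) ⁻¹' {some j} =
      Subtype.val ⁻¹' Set.Ico (cumul c j.1) (cumul c (j.1 + 1)) := by
    ext x
    simp only [Set.mem_preimage, Set.mem_singleton_iff, detected_eq_some_iff hc, Set.mem_Ico]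
  have h0 : 0 ≤ cumul c j.1 := by
    rw [← cumul_zero c]; exact cumul_mono hc (Nat.zero_le _)
  have hsub : Set.Ico (cumul c j.1) (cumul c (j.1 + 1)) ⊆ unitInterval := fun x hx =>
    ⟨h0.trans hx.1, hx.2.le.trans ((cumul_le_sum hc _).trans hc1)⟩
  rw [hset, Measure.real, unitInterval.measurePreserving_coe.measure_preimage
    measurableSet_Ico.nullMeasurableSet, Measure.restrict_apply measurableSet_Ico,
    Set.inter_eq_left.2 hsub, Real.volume_Ico, cumul_succ, add_sub_cancel_left,
    ENNReal.toReal_ofReal (hc j)]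

/-! ## The law of the random numbers -/

/-- Phases and detection numbers are read from disjoint sets of tape cells, hence they are
independent. -/
theorem map_tapeLaw (n : ℕ) :
    tapeLaw.map (fun ω => ((fun k : Fin n => ω k), fun k : Fin n => ω (n + k))) =
      (Measure.pi fun _ : Fin n => (volume : Measure unitInterval)).prod
        (Measure.pi fun _ : Fin n => (volume : Measure unitInterval)) := by
  let f : Fin n ⊕ Fin n → ℕ := Sum.elim (fun k => k.1) fun k => n + k.1
  have hf : Function.Injective f := by
    rintro (a | a) (b | b) h
    · exact congrArg Sum.inl (Fin.ext h)
    · have := a.2; simp only [f, Sum.elim_inl, Sum.elim_inr] at h; omega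
    · have := b.2; simp only [f, Sum.elim_inl, Sum.elim_inr] at h; omega
    · simp only [f, Sum.elim_inr] at h
      exact congrArg Sum.inr (Fin.ext (by omega))
  have h1 := (Measure.map_infinitePi_infinitePi_of_inj
    (P := fun _ : ℕ => (volume : Measure unitInterval)) hf).trans
      (Measure.infinitePi_eq_pi _)
  have h2 := (measurePreserving_sumPiEquivProdPi
    (fun _ : Fin n ⊕ Fin n => (volume : Measure unitInterval))).map_eq
  rw [← h1, Measure.map_map (MeasurableEquiv.measurable _) (by fun_prop)] at h2
  exact h2

theorem map_two_pi_mul :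
    (volume : Measure unitInterval).map (fun x : unitInterval => 2 * Real.pi * (x : ℝ)) =
      (ENNReal.ofReal (2 * Real.pi)⁻¹) • volume.restrict (Set.Icc 0 (2 * Real.pi)) := by
  have hpi : 0 < 2 * Real.pi := by positivity
  have h1 : (volume : Measure unitInterval).map (fun x : unitInterval => 2 * Real.pi * (x : ℝ)) =
      ((volume : Measure ℝ).restrict unitInterval).map (fun x : ℝ => 2 * Real.pi * x) := by
    rw [← unitInterval.measurePreserving_coe.map_eq,
      Measure.map_map (by fun_prop) measurable_subtype_coe]
    rfl
  have h2 : unitInterval = (fun x : ℝ => 2 * Real.pi * x) ⁻¹' Set.Icc 0 (2 * Real.pi) := by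
    ext x
    simp only [Set.mem_preimage, Set.mem_Icc]
    constructor
    · rintro ⟨ha, hb⟩
      exact ⟨by positivity, by nlinarith⟩
    · rintro ⟨ha, hb⟩
      constructor
      · exact nonneg_of_mul_nonneg_right ha hpi
      · nlinarith
  rw [h1, h2, ← Measure.restrict_map (by fun_prop) measurableSet_Icc,
    Real.map_volume_mul_left hpi.ne', Measure.restrict_smul, abs_of_pos (by positivity)]

theorem integral_phases {n : ℕ} {g : (Fin n → ℝ) → ℝ} (hg : Continuous g) :
    ∫ θ, g (fun k => 2 * Real.pi * (θ k : ℝ))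
        ∂(Measure.pi fun _ : Fin n => (volume : Measure unitInterval)) =
      ((2 * Real.pi) ^ n)⁻¹ * ∫ φ in Set.Icc (0 : Fin n → ℝ) (fun _ => 2 * Real.pi), g φ := by
  have hpi : 0 < 2 * Real.pi := by positivity
  have hprob : ∀ _ : Fin n, IsProbabilityMeasure ((volume : Measure unitInterval).map
      fun x : unitInterval => 2 * Real.pi * (x : ℝ)) := fun _ =>
    Measure.isProbabilityMeasure_map (by fun_prop)
  have hmap : (Measure.pi fun _ : Fin n => (volume : Measure unitInterval)).map
      (fun θ k => 2 * Real.pi * (θ k : ℝ)) =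
      (ENNReal.ofReal (2 * Real.pi)⁻¹) ^ n •
        volume.restrict (Set.Icc (0 : Fin n → ℝ) (fun _ => 2 * Real.pi)) := by
    rw [Measure.pi_map_pi (f := fun _ (x : unitInterval) => 2 * Real.pi * (x : ℝ))
      (fun _ => by fun_prop)]
    refine Measure.pi_eq fun s _ => ?_
    rw [restrict_Icc_pi, Measure.smul_apply, Measure.pi_pi]
    simp only [map_two_pi_mul, Measure.smul_apply, smul_eq_mul, Finset.prod_mul_distrib]
    simp
  have h := integral_map (μ := Measure.pi fun _ : Fin n => (volume : Measure unitInterval))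
    (φ := fun θ k => 2 * Real.pi * (θ k : ℝ)) (f := g)
    (Measurable.aemeasurable (by fun_prop)) hg.aestronglyMeasurable
  rw [← h, hmap, integral_smul_measure, smul_eq_mul, ENNReal.toReal_pow,
    ENNReal.toReal_ofReal (by positivity), inv_pow]

/-! ## The output distribution of the program -/

theorem sum_normSq_eq {m : ℕ} (v : Fin m → ℂ) :
    ((∑ i, Complex.normSq (v i) : ℝ) : ℂ) = ∑ i, v i * conj (v i) := by
  push_cast
  simp only [Complex.mul_conj]

/-- The diagonal case `v = w` of the overlap identities: losses shrink the norm and beamsplitters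
preserve it. It makes the detection weights a subprobability vector. -/
theorem sum_normSq_transfer_le {m : ℕ} {η : ℝ} (h0 : 0 ≤ η) (h1 : η ≤ 1) (L : List (Element m))
    (v : Fin m → ℂ) :
    ∑ i, Complex.normSq ((transfer η L).mulVec v i) ≤ ∑ i, Complex.normSq (v i) := by
  induction L generalizing v with
  | nil => simp [transfer]
  | cons e L ih =>
    rw [transfer, ← Matrix.mulVec_mulVec]
    refine (ih _).trans ?_
    cases e with
    | loss i =>
      have h := sum_mul_conj_lossMatrix_mulVec h0 i v v
      rw [← sum_normSq_eq, ← sum_normSq_eq, mul_assoc, Complex.mul_conj] at h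
      have h' : ∑ j, Complex.normSq ((lossMatrix η i).mulVec v j) +
          (1 - η) * Complex.normSq (v i) = ∑ j, Complex.normSq (v j) := by
        exact_mod_cast h
      have : 0 ≤ (1 - η) * Complex.normSq (v i) :=
        mul_nonneg (by linarith) (Complex.normSq_nonneg _)
      change ∑ j, Complex.normSq ((lossMatrix η i).mulVec v j) ≤ _
      linarith
    | bs g =>
      have h := g.sum_mul_conj_matrix_mulVec v v
      rw [← sum_normSq_eq, ← sum_normSq_eq] at h
      have h' : ∑ j, Complex.normSq (g.matrix.mulVec v j) = ∑ j, Complex.normSq (v j) := by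
        exact_mod_cast h
      exact h'.le

theorem sum_weights_le_one {m n : ℕ} (hnm : n ≤ m) {η : ℝ} (h0 : 0 ≤ η) (h1 : η ≤ 1)
    (N : Network m) (φ : Fin n → ℝ) : ∑ i, weights (m := m) n η N φ i ≤ 1 := by
  refine (sum_normSq_transfer_le h0 h1 N.elements (phaseState m n φ)).trans ?_
  rcases Nat.eq_zero_or_pos n with rfl | hn
  · simp [phaseState]
  · have h := sum_phaseState hnm hn.ne' φ
    rw [← sum_normSq_eq] at h
    exact (by exact_mod_cast h : ∑ i, Complex.normSq (phaseState m n φ i) = 1).le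

theorem weights_nonneg {m n : ℕ} {η : ℝ} (N : Network m) (φ : Fin n → ℝ) (i : Fin m) :
    0 ≤ weights n η N φ i := Complex.normSq_nonneg _

theorem continuous_weights {m n : ℕ} (η : ℝ) (N : Network m) (i : Fin m) :
    Continuous fun φ : Fin n → ℝ => weights n η N φ i := by
  unfold weights
  refine Complex.continuous_normSq.comp ?_
  simp only [Matrix.mulVec, dotProduct]
  exact continuous_finsetSum _ fun j _ => continuous_const.mul (continuous_phaseState m n j)

theorem continuous_cumul_weights {m n : ℕ} (η : ℝ) (N : Network m) (j : ℕ) :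
    Continuous fun φ : Fin n → ℝ => cumul (weights (m := m) n η N φ) j :=
  continuous_finsetSum _ fun i _ => continuous_weights η N i

theorem continuous_multinomialProb_weights {m n : ℕ} (η : ℝ) (N : Network m) (p : Fin m → ℕ) :
    Continuous fun φ : Fin n → ℝ => multinomialProb n (weights n η N φ) p := by
  unfold multinomialProb
  refine continuous_const.mul (Continuous.mul ?_ ?_)
  · exact continuous_finsetProd _ fun i _ => (continuous_weights η N i).pow _
  · exact (continuous_const.sub (continuous_finsetSum _ fun i _ => continuous_weights η N i)).pow _

/-- The event that the random phases and the random detection numbers produce the counts `p`. -/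
def countEvent {m : ℕ} (n : ℕ) (η : ℝ) (N : Network m) (p : Fin m → ℕ) :
    Set ((Fin n → unitInterval) × (Fin n → unitInterval)) :=
  {x | (labelCounts fun k : Fin n => detected
    (weights n η N fun k => 2 * Real.pi * (x.1 k : ℝ)) (x.2 k : ℝ)) = p}

theorem measurableSet_countEvent {m : ℕ} (n : ℕ) (η : ℝ) (N : Network m) (p : Fin m → ℕ) :
    MeasurableSet (countEvent n η N p) := by
  classical
  have hc : ∀ j : ℕ, Measurable fun x : (Fin n → unitInterval) × (Fin n → unitInterval) =>
      cumul (weights (m := m) n η N fun k => 2 * Real.pi * (x.1 k : ℝ)) j := fun j =>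
    (continuous_cumul_weights η N j).measurable.comp (by fun_prop)
  have hset : countEvent n η N p = ⋂ j, (fun x => labelCounts (fun k : Fin n => detected
      (weights n η N fun k => 2 * Real.pi * (x.1 k : ℝ)) (x.2 k : ℝ)) j) ⁻¹' {p j} := by
    ext x
    simp [countEvent, funext_iff]
  rw [hset]
  refine MeasurableSet.iInter fun j => ?_
  have hcount : Measurable fun x : (Fin n → unitInterval) × (Fin n → unitInterval) =>
      labelCounts (fun k : Fin n => detected
      (weights n η N fun k => 2 * Real.pi * (x.1 k : ℝ)) (x.2 k : ℝ)) j := by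
    unfold labelCounts
    simp only [detected_eq_some_iff (weights_nonneg N _), Finset.card_filter]
    refine Finset.measurable_sum _ fun k _ => ?_
    refine Measurable.ite ?_ measurable_const measurable_const
    refine MeasurableSet.inter ?_ ?_
    · exact measurableSet_le (hc j.1) (by fun_prop)
    · exact measurableSet_lt (by fun_prop) (hc (j.1 + 1))
  exact hcount (MeasurableSet.singleton _)

theorem measureReal_labelCounts_detected {m n : ℕ} {c : Fin m → ℝ} (hc : ∀ i, 0 ≤ c i)
    (hc1 : ∑ i, c i ≤ 1) (p : Fock m n) :
    (Measure.pi fun _ : Fin n => (volume : Measure unitInterval)).real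
      {x | (labelCounts fun k => detected c (x k : ℝ)) = p.1} = multinomialProb n c p.1 := by
  have h := measureReal_labelCounts (volume : Measure unitInterval)
    (fun x : unitInterval => detected c (x : ℝ)) (measurableSet_detected hc) p
  have hq : (fun j => (volume : Measure unitInterval).real
      ((fun x : unitInterval => detected c (x : ℝ)) ⁻¹' {some j})) = c :=
    funext fun j => volume_detected hc hc1 j
  rw [hq] at h
  exact h

/-- Fubini: for fixed phases the section has multinomial probability, and integrating over the
phases reproduces the formula of `outputDist_channel_sepState`. -/
theorem measureReal_countEvent {m n : ℕ} (hnm : n ≤ m) {η : ℝ} (h0 : 0 ≤ η) (h1 : η ≤ 1)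
    (N : Network m) (p : Fock m n) :
    ((Measure.pi fun _ : Fin n => (volume : Measure unitInterval)).prod
        (Measure.pi fun _ : Fin n => (volume : Measure unitInterval))).real
      (countEvent n η N p.1) = outputDist (channel n η N.elements (sepState m n n)) p := by
  set μ := Measure.pi fun _ : Fin n => (volume : Measure unitInterval)
  have hsec : ∀ θ : Fin n → unitInterval, μ.real (Prod.mk θ ⁻¹' countEvent n η N p.1) =
      multinomialProb n (weights n η N fun k => 2 * Real.pi * (θ k : ℝ)) p.1 := by
    intro θ
    have h := measureReal_labelCounts_detected
      (weights_nonneg N fun k => 2 * Real.pi * (θ k : ℝ))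
      (sum_weights_le_one hnm h0 h1 N fun k => 2 * Real.pi * (θ k : ℝ)) p
    rw [← h]
    rfl
  rw [outputDist_channel_sepState hnm h0 h1, Measure.real,
    Measure.prod_apply (measurableSet_countEvent n η N p.1)]
  have hmeas : Measurable fun θ => μ (Prod.mk θ ⁻¹' countEvent n η N p.1) :=
    measurable_measure_prodMk_left (measurableSet_countEvent n η N p.1)
  rw [← integral_toReal hmeas.aemeasurable (Filter.Eventually.of_forall fun θ => measure_lt_top _ _)]
  have := integral_phases (continuous_multinomialProb_weights η N p.1 (n := n))
  simp only [← hsec] at this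
  exact this

theorem samplesWithin_program {m n : ℕ} (hnm : n ≤ m) {η : ℝ} (h0 : 0 ≤ η) (h1 : η ≤ 1)
    (N : Network m) :
    SamplesWithin program (inputStore n η N) (stepBound.eval (m + n + N.length))
      (outputDist (channel n η N.elements (sepState m n n))) := by
  let label : (ℕ → unitInterval) → Fin n → Option (Fin m) := fun ω k =>
    detected (weights n η N fun k => 2 * Real.pi * (ω k : ℝ)) (ω (n + k) : ℝ)
  refine ⟨fun ω => ⟨labelCounts (label ω), ?_⟩, fun ω => ?_, fun p => ?_⟩
  · have := sum_labelCounts_add (label ω)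
    omega
  · obtain ⟨t, ht, st', he, hst'⟩ := exists_exec_program (n := n) (η := η) (N := N) (ω := ω)
    refine ⟨t, ht, st', he, fun j => ?_⟩
    rw [hst', detections_eq_labelCounts (weights_nonneg N _)]
  · have hmeas : Measurable fun ω : ℕ → unitInterval =>
        ((fun k : Fin n => ω k), fun k : Fin n => ω (n + k)) := by fun_prop
    have hset : (fun ω => (⟨labelCounts (label ω), by
        have := sum_labelCounts_add (label ω); omega⟩ : Fock m n)) ⁻¹' {p} =
        (fun ω : ℕ → unitInterval => ((fun k : Fin n => ω k), fun k : Fin n => ω (n + k))) ⁻¹'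
          countEvent n η N p.1 := by
      ext ω
      simp only [Set.mem_preimage, Set.mem_singleton_iff, Subtype.ext_iff]
      rfl
    rw [hset]
    refine ⟨hmeas (measurableSet_countEvent n η N p.1), ?_⟩
    rw [← map_measureReal_apply hmeas (measurableSet_countEvent n η N p.1), map_tapeLaw,
      measureReal_countEvent hnm h0 h1]

end Sampler

/-! ### Combining extraction, sampling and the distance bound; logarithmic depth -/

theorem Network.exists_sampleable_approximation {m : ℕ} (N : Network m) {η : ℝ} (h0 : 0 ≤ η)
    (h1 : η ≤ 1) :
    ∃ N' : List (Element m),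
      beamsplitters N' = N ∧
      lossCount N' + minDepth N * m = lossCount N.elements ∧
      (∀ (K : ℕ) (ρ : Op m K),
        channel K η N.elements ρ = channel K η N' (uniformLoss K (η ^ minDepth N) ρ)) ∧
      ∀ n : ℕ, n ≤ m →
        SamplesWithin Sampler.program (inputStore n η N)
          (Sampler.stepBound.eval (m + n + N.length))
          (outputDist (channel n η N' (sepMixture m n (η ^ minDepth N)))) ∧
        tvDist (outputDist (channel n η N.elements (inputState m n)))
          (outputDist (channel n η N' (sepMixture m n (η ^ minDepth N)))) ≤
            sepDist m n (η ^ minDepth N) := by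
  have ht0 : 0 ≤ η ^ minDepth N := pow_nonneg h0 _
  have ht1 : η ^ minDepth N ≤ 1 := pow_le_one₀ h0 h1
  obtain ⟨L, hb, hl, ht⟩ := Network.exists_uniform_losses h0 N
  have hch : ∀ (K : ℕ) (ρ : Op m K),
      channel K η N.elements ρ = channel K η L (uniformLoss K (η ^ minDepth N) ρ) := fun K ρ =>
    channel_eq_of_transfer_eq K h0 h1 ht0 ht1 ht ρ
  refine ⟨L, hb, hl, hch, fun n hnm => ⟨?_, ?_⟩⟩
  -- The extracted losses are put back, which leaves the original network acting on the lossless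
  -- product state.
  · rw [← uniformLoss_sepState hnm ht0 ht1, ← hch]
    exact Sampler.samplesWithin_program hnm h0 h1 N
  · rw [hch]
    exact tvDist_channel_le_sepDist hnm h0 h1 ht0 ht1 L

/-- From `η ≤ exp(η - 1)`; unlike the constant `1 / log(1/η)`, the constant `1 / (1 - η)` also
covers `η = 0` without a separate case. -/
theorem pow_le_inv_of_log_le {η x : ℝ} (h0 : 0 ≤ η) (h1 : η < 1) (hx : 0 < x) {s : ℕ}
    (h : (1 - η)⁻¹ * Real.log x ≤ s) : η ^ s ≤ x⁻¹ := by
  have hη : 0 < 1 - η := sub_pos.2 h1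
  rw [inv_mul_le_iff₀ hη] at h
  calc η ^ s ≤ Real.exp (η - 1) ^ s :=
        pow_le_pow_left₀ h0 (by linarith [Real.add_one_le_exp (η - 1)]) s
    _ = Real.exp (s * (η - 1)) := (Real.exp_nat_mul _ _).symm
    _ ≤ Real.exp (-Real.log x) := Real.exp_le_exp.2 (by linarith)
    _ = x⁻¹ := by rw [Real.exp_neg, Real.exp_log hx]

/-- With `t n ≤ 1` both terms of the bound are at most `t / 2`. -/
theorem sepDist_le_inv {m n : ℕ} (hnm : n ≤ m) (hn : 0 < n) {t : ℝ} (h0 : 0 ≤ t) (h1 : t ≤ 1)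
    (ht : t ≤ (n : ℝ)⁻¹) : sepDist m n t ≤ (n : ℝ)⁻¹ := by
  have hn' : (0 : ℝ) < n := Nat.cast_pos.2 hn
  have htn : t * n ≤ 1 := by
    calc t * n ≤ (n : ℝ)⁻¹ * n := mul_le_mul_of_nonneg_right ht hn'.le
      _ = 1 := inv_mul_cancel₀ hn'.ne'
  refine (sepDist_le hnm h0 h1).trans ?_
  nlinarith [mul_le_mul_of_nonneg_left htn h0, mul_nonneg h0 h0]

end LossyOptics

end

theorem mainTheorem3 :
    ∃ (prog : Cmd) (T : Polynomial ℕ),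
      (∀ (m : ℕ) (N : Network m) (η : ℝ), 0 ≤ η → η ≤ 1 →
        ∃ N' : List (Element m),
          beamsplitters N' = N ∧
          lossCount N' + minDepth N * m = lossCount N.elements ∧
          (∀ (K : ℕ) (ρ : Op m K),
            channel K η N.elements ρ = channel K η N' (uniformLoss K (η ^ minDepth N) ρ)) ∧
          ∀ n : ℕ, n ≤ m →
            SamplesWithin prog (inputStore n η N) (T.eval (m + n + N.length))
              (outputDist (channel n η N' (sepMixture m n (η ^ minDepth N)))) ∧
            tvDist (outputDist (channel n η N.elements (inputState m n)))
              (outputDist (channel n η N' (sepMixture m n (η ^ minDepth N)))) ≤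
                sepDist m n (η ^ minDepth N) ∧
            sepDist m n (η ^ minDepth N) =
              ∑ l ∈ Finset.range (n + 1),
                (n.choose l : ℝ) * (η ^ minDepth N) ^ l * (1 - η ^ minDepth N) ^ (n - l) *
                  (1 - (n.factorial : ℝ) / ((n : ℝ) ^ l * ((n - l).factorial : ℝ))) ∧
            sepDist m n (η ^ minDepth N) ≤
              (η ^ minDepth N) ^ 2 * n / 2 + η ^ minDepth N * (1 - η ^ minDepth N) / 2) ∧
      ∀ η : ℝ, 0 ≤ η → η < 1 →
        ∃ C : ℝ, 0 < C ∧ ∀ ε : ℝ, 0 < ε →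
          ∃ n₀ : ℕ, ∀ n : ℕ, n₀ ≤ n → ∀ m : ℕ, n ≤ m → ∀ N : Network m,
            C * Real.log n ≤ minDepth N →
              ∃ Q : Fock m n → ℝ,
                SamplesWithin prog (inputStore n η N) (T.eval (m + n + N.length)) Q ∧
                tvDist (outputDist (channel n η N.elements (inputState m n))) Q ≤ ε := by
  refine ⟨Sampler.program, Sampler.stepBound, fun m N η h0 h1 => ?_, fun η h0 h1 => ?_⟩
  · have ht0 : 0 ≤ η ^ minDepth N := pow_nonneg h0 _
    have ht1 : η ^ minDepth N ≤ 1 := pow_le_one₀ h0 h1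
    obtain ⟨N', hb, hl, hch, h⟩ := N.exists_sampleable_approximation h0 h1
    exact ⟨N', hb, hl, hch, fun n hnm =>
      ⟨(h n hnm).1, (h n hnm).2, sepDist_eq hnm ht0 ht1, sepDist_le hnm ht0 ht1⟩⟩
  · refine ⟨(1 - η)⁻¹, inv_pos.2 (sub_pos.2 h1), fun ε hε => ?_⟩
    -- The error is at most `1 / n`, so `n > 1 / ε` suffices.
    obtain ⟨n₀, hn₀⟩ := exists_nat_gt ε⁻¹
    refine ⟨n₀, fun n hn m hnm N hs => ?_⟩
    have hεn : ε⁻¹ < n := hn₀.trans_le (Nat.cast_le.2 hn)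
    have hn' : (0 : ℝ) < n := (inv_pos.2 hε).trans hεn
    have ht := pow_le_inv_of_log_le h0 h1 hn' hs
    obtain ⟨N', -, -, -, h⟩ := N.exists_sampleable_approximation h0 h1.le
    exact ⟨_, (h n hnm).1, (h n hnm).2.trans <|
      (sepDist_le_inv hnm (Nat.cast_pos.1 hn') (pow_nonneg h0 _) (pow_le_one₀ h0 h1.le) ht).trans
        (inv_le_of_inv_le₀ hε hεn.le)⟩
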